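/- Let $\mathfrak g$ be a (finite-dimensional) complex semisimple Lie algebra with Cartan subalgebra $\mathfrak h$, simple roots $\{\alpha_i\}_{i\in I}$ and simple coroots $\{h_i\}_{i\in I}$. Let $P=\{\mu\in\mathfrak h^*:\mu(h_i)\in\mathbb Z\ \forall i\}$ and $P^+=\{\mu\in\mathfrak h^*:\mu(h_i)\in\mathbb Z_{\ge0}\ \forall i\}$ be the sets of integral and of dominant integral weights, let $Q^+=\sum_i\mathbb Z_{\ge0}\alpha_i$, and for weights $\eta,\nu$ write $\eta\le\nu$ if $\nu-\eta\in Q^+$. Call $\mu\in P^+$ regular if $\mu(h_i)>0$ for all $i\in I$. For $\mu\in P^+$ let $V(\mu)$ be the finite-dimensional simple $\mathfrak g$-module with highest weight $\mu$. Let $V$ be a finite-dimensional $\mathfrak g$-module, with weight spaces $V_\mu=\{v\in V: hv=\mu(h)v\ \forall h\in\mathfrak h\}$ and set of weights $\mathrm{wt}(V)=\{\mu\in\mathfrak h^*: V_\mu\neq0\}$. Let $\Psi\subseteq\mathrm{wt}(V)$ satisfy the following condition: whenever $\sum_{\alpha\in\Psi}m_\alpha\alpha=\sum_{\beta\in\mathrm{wt}(V)}r_\beta\beta$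 with all $m_\alpha,r_\beta\in\mathbb Z_{\ge0}$, one has $\sum_\alpha m_\alpha\le\sum_\beta r_\beta$, with equality if and only if $\beta\in\Psi$ whenever $r_\beta>0$. Put $$\lambda_\Psi:=\sum_{\mu\in\Psi}(\dim V_\mu)\,\mu,\qquad N_\Psi:=\sum_{\mu\in\Psi}\dim V_\mu .$$ Then $\lambda_\Psi\in P$, and: (i) If $\nu,\ \nu+\lambda_\Psi\in P^+$, then $\dim\operatorname{Hom}_{\mathfrak g}\big(\wedge^{N_\Psi}V\otimes V(\nu),\,V(\nu+\lambda_\Psi)\big)\le1$. (ii) For every $\eta\in P^+$ there is $\nu\in P^+$ such that $\nu$ and $\nu+\lambda_\Psi$ both lie in $P^+$ and are regular, $\eta\le\nu$, and $\dim\operatorname{Hom}_{\mathfrak g}\big(\wedge^{N_\Psi}V\otimes V(\nu),\,V(\nu+\lambda_\Psi)\big)=1$. -/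

import Mathlib

open Module LieAlgebra LieAlgebra.IsKilling
open scoped TensorProduct

/-! ### The exterior powers of a module over a Lie algebra -/

namespace exteriorPower

section Derivation

variable {R M : Type*} [CommRing R] [AddCommGroup M] [Module R M]

/-- The alternating map `(v₁, …, vₙ) ↦ ∑ᵢ v₁ ∧ ⋯ ∧ f vᵢ ∧ ⋯ ∧ vₙ` attached to an endomorphism `f`. -/
noncomputable def derivAlternating (n : ℕ) (f : M →ₗ[R] M) : M [⋀^Fin n]→ₗ[R] ⋀[R]^n M where
  toMultilinearMap := ∑ i : Fin n,
    (ιMulti R n (M := M)).toMultilinearMap.compLinearMap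
      (Function.update (fun _ => LinearMap.id) i f)
  map_eq_zero_of_eq' := by
    intro v i j hv hij
    have key : ∀ k, (fun l => (Function.update (fun _ => (LinearMap.id : M →ₗ[R] M)) k f) l (v l))
        = Function.update v k (f (v k)) := by
      intro k
      funext l
      by_cases h : l = k
      · subst h; simp
      · simp [h]
    simp only [MultilinearMap.toFun_eq_coe, sum_apply,
      MultilinearMap.compLinearMap_apply, key, AlternatingMap.coe_multilinearMap]
    rw [← Finset.sum_subset (Finset.subset_univ {i, j}), Finset.sum_pair hij]
    · have hs : Function.update v j (f (v j)) =
          Function.update v i (f (v i)) ∘ Equiv.swap i j := by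
        funext l
        by_cases hi : l = i
        · subst hi; simp [hij, hv, hij.symm]
        · by_cases hj : l = j
          · subst hj; simp [hv]
          · simp [hi, hj, Equiv.swap_apply_of_ne_of_ne hi hj]
      rw [hs, AlternatingMap.map_swap _ _ hij, add_neg_cancel]
    · intro k _ hk
      simp only [Finset.mem_insert, Finset.mem_singleton, not_or] at hk
      refine AlternatingMap.map_eq_zero_of_eq _ _ (i := i) (j := j) ?_ hij
      simp [Ne.symm hk.1, Ne.symm hk.2, hv]

theorem derivAlternating_apply (n : ℕ) (f : M →ₗ[R] M) (v : Fin n → M) :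
    derivAlternating n f v = ∑ i, ιMulti R n (Function.update v i (f (v i))) := by
  change (∑ i : Fin n, (ιMulti R n (M := M)).toMultilinearMap.compLinearMap
      (Function.update (fun _ => LinearMap.id) i f)) v = _
  rw [sum_apply]
  refine Finset.sum_congr rfl fun k _ => ?_
  rw [MultilinearMap.compLinearMap_apply]
  change ιMulti R n _ = _
  congr 1
  funext l
  by_cases h : l = k
  · subst h; simp
  · simp [h]

/-- The endomorphism of `⋀ⁿ M` induced by an endomorphism `f` of `M` through the Leibniz rule. -/
noncomputable def deriv (n : ℕ) (f : M →ₗ[R] M) : ⋀[R]^n M →ₗ[R] ⋀[R]^n M :=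
  alternatingMapLinearEquiv (derivAlternating n f)

theorem deriv_ιMulti (n : ℕ) (f : M →ₗ[R] M) (v : Fin n → M) :
    deriv n f (ιMulti R n v) = ∑ i, ιMulti R n (Function.update v i (f (v i))) := by
  rw [deriv, alternatingMapLinearEquiv_apply_ιMulti, derivAlternating_apply]

theorem deriv_add (n : ℕ) (f g : M →ₗ[R] M) : deriv n (f + g) = deriv n f + deriv n g := by
  apply linearMap_ext
  ext1 v
  simp [deriv_ιMulti, Finset.sum_add_distrib]

theorem deriv_smul (n : ℕ) (c : R) (f : M →ₗ[R] M) : deriv n (c • f) = c • deriv n f := by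
  apply linearMap_ext
  ext1 v
  simp [deriv_ιMulti, Finset.smul_sum]

theorem deriv_lie (n : ℕ) (f g : M →ₗ[R] M) : deriv n ⁅f, g⁆ = ⁅deriv n f, deriv n g⁆ := by
  apply linearMap_ext
  ext1 v
  have e : ∀ p q : M →ₗ[R] M, deriv n p (deriv n q (ιMulti R n v)) =
      ∑ i, ιMulti R n (Function.update v i (p (q (v i)))) +
      ∑ i, ∑ j ∈ Finset.univ.erase i,
        ιMulti R n (Function.update (Function.update v i (q (v i))) j (p (v j))) := by
    intro p q
    rw [deriv_ιMulti, map_sum, ← Finset.sum_add_distrib]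
    refine Finset.sum_congr rfl fun i _ => ?_
    rw [deriv_ιMulti, ← Finset.add_sum_erase _ _ (Finset.mem_univ i)]
    congr 1
    · simp
    · refine Finset.sum_congr rfl fun j hj => ?_
      rw [Function.update_of_ne (Finset.ne_of_mem_erase hj)]
  have c : ∑ i, ∑ j ∈ Finset.univ.erase i,
        ιMulti R n (Function.update (Function.update v i (g (v i))) j (f (v j))) =
      ∑ i, ∑ j ∈ Finset.univ.erase i,
        ιMulti R n (Function.update (Function.update v i (f (v i))) j (g (v j))) := by
    rw [Finset.sum_comm' (t' := Finset.univ) (s' := fun j => Finset.univ.erase j)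
      (by intro x y; simp [ne_comm])]
    refine Finset.sum_congr rfl fun i _ => Finset.sum_congr rfl fun j hj => ?_
    rw [Function.update_comm (Finset.ne_of_mem_erase hj)]
  change deriv n ⁅f, g⁆ (ιMulti R n v) = ⁅deriv n f, deriv n g⁆ (ιMulti R n v)
  rw [LieRing.of_associative_ring_bracket (deriv n f), LinearMap.sub_apply, Module.End.mul_apply,
    Module.End.mul_apply, e, e, c, add_sub_add_right_eq_sub, deriv_ιMulti,
    ← Finset.sum_sub_distrib]
  refine Finset.sum_congr rfl fun i _ => ?_
  rw [LieRing.of_associative_ring_bracket, LinearMap.sub_apply, AlternatingMap.map_update_sub]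
  rfl

end Derivation

section Lie

attribute [local instance 100] LieRing.ofAssociativeRing

variable {R L M : Type*} [CommRing R] [LieRing L] [LieAlgebra R L]
  [AddCommGroup M] [Module R M] [LieRingModule L M] [LieModule R L M]

/-- The action of a Lie algebra on an exterior power:
`x · (v₁ ∧ ⋯ ∧ vₙ) = ∑ᵢ v₁ ∧ ⋯ ∧ x vᵢ ∧ ⋯ ∧ vₙ`. -/
noncomputable instance instLieRingModule (n : ℕ) : LieRingModule L (⋀[R]^n M) where
  bracket x w := deriv n (LieModule.toEnd R L M x) w
  add_lie x y w := by
    change deriv n _ w = deriv n _ w + deriv n _ w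
    rw [map_add, deriv_add, LinearMap.add_apply]
  lie_add x w w' := map_add _ w w'
  leibniz_lie x y w := by
    change deriv n _ (deriv n _ w) = deriv n _ w + deriv n _ (deriv n _ w)
    have h : LieModule.toEnd R L M ⁅x, y⁆ = ⁅LieModule.toEnd R L M x, LieModule.toEnd R L M y⁆ :=
      LieHom.map_lie _ x y
    rw [h, deriv_lie, LieRing.of_associative_ring_bracket, LinearMap.sub_apply,
      Module.End.mul_apply, Module.End.mul_apply, sub_add_cancel]

instance instLieModule (n : ℕ) : LieModule R L (⋀[R]^n M) where
  smul_lie c x w := by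
    change deriv n _ w = c • deriv n _ w
    rw [map_smul, deriv_smul, LinearMap.smul_apply]
  lie_smul c x w := map_smul _ c w

theorem lie_ιMulti (n : ℕ) (x : L) (v : Fin n → M) :
    ⁅x, ιMulti R n v⁆ = ∑ i, ιMulti R n (Function.update v i ⁅x, v i⁆) :=
  deriv_ιMulti n _ v

end Lie

end exteriorPower

/-! ### Weights of a complex semisimple Lie algebra

`H` is a Cartan subalgebra of `𝔤` and `b` is a base (a set of simple roots) of the root system
of `(𝔤, H)`. -/

section Weights

variable {𝔤 : Type*} [LieRing 𝔤] [LieAlgebra ℂ 𝔤] [FiniteDimensional ℂ 𝔤]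
  [LieAlgebra.IsSemisimple ℂ 𝔤] {H : LieSubalgebra ℂ 𝔤} [H.IsCartanSubalgebra]

/-- `P`: the weights `μ ∈ 𝔥*` with `μ(hᵢ) ∈ ℤ` for every simple coroot `hᵢ`, that is, the
`ℤ`-span of the fundamental weights. -/
def weightLattice (b : (rootSystem H).Base) : Set (Dual ℂ H) :=
  {μ | ∀ i ∈ b.support, ∃ z : ℤ, μ ((rootSystem H).coroot i) = z}

/-- `P⁺`: the weights `μ ∈ 𝔥*` with `μ(hᵢ) ∈ ℤ₊` for every simple coroot `hᵢ`, that is, the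
`ℤ₊`-span of the fundamental weights. -/
def dominantWeights (b : (rootSystem H).Base) : Set (Dual ℂ H) :=
  {μ | ∀ i ∈ b.support, ∃ n : ℕ, μ ((rootSystem H).coroot i) = n}

/-- The regular elements of `P⁺`: those with `μ(hᵢ) > 0` for every simple coroot `hᵢ`. -/
def regularDominantWeights (b : (rootSystem H).Base) : Set (Dual ℂ H) :=
  {μ | ∀ i ∈ b.support, ∃ n : ℕ, 0 < n ∧ μ ((rootSystem H).coroot i) = n}

/-- `Q⁺`: the `ℤ₊`-span of the simple roots. -/
def positiveRootCone (b : (rootSystem H).Base) : AddSubmonoid (Dual ℂ H) :=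
  AddSubmonoid.closure ((rootSystem H).root '' b.support)

/-! ### The simple module of highest weight `μ` -/

/-- The left ideal of `U(𝔤)` generated by `𝔫⁺` and by all `h - μ(h)` for `h ∈ 𝔥`. -/
def vermaIdeal (b : (rootSystem H).Base) (μ : Dual ℂ H) :
    Submodule (UniversalEnvelopingAlgebra ℂ 𝔤) (UniversalEnvelopingAlgebra ℂ 𝔤) :=
  Submodule.span _
    ({u | ∃ α : H.root, (rootSystem H).root α ∈ positiveRootCone b ∧
        ∃ x ∈ rootSpace H (α : LieModule.Weight ℂ H 𝔤), u = UniversalEnvelopingAlgebra.ι ℂ x} ∪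
     {u | ∃ h : H, u = UniversalEnvelopingAlgebra.ι ℂ (h : 𝔤) -
        algebraMap ℂ (UniversalEnvelopingAlgebra ℂ 𝔤) (μ h)})

/-- The Verma module of highest weight `μ`. -/
abbrev VermaModule (b : (rootSystem H).Base) (μ : Dual ℂ H) : Type _ :=
  UniversalEnvelopingAlgebra ℂ 𝔤 ⧸ vermaIdeal b μ

/-- The maximal proper submodule of the Verma module: the sum of all its proper submodules. -/
def vermaMaximal (b : (rootSystem H).Base) (μ : Dual ℂ H) :
    Submodule (UniversalEnvelopingAlgebra ℂ 𝔤) (VermaModule b μ) :=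
  sSup {N | N ≠ ⊤}

/-- `V(μ)`: the simple `𝔤`-module of highest weight `μ`, i.e. the unique simple quotient of the
Verma module of highest weight `μ`. It is finite-dimensional if (and only if) `μ ∈ P⁺`. -/
def SimpleHighestWeightModule (b : (rootSystem H).Base) (μ : Dual ℂ H) : Type _ :=
  VermaModule b μ ⧸ vermaMaximal b μ

namespace SimpleHighestWeightModule

attribute [local instance 100] LieRing.ofAssociativeRing

variable (b : (rootSystem H).Base) (μ : Dual ℂ H)

noncomputable instance : AddCommGroup (SimpleHighestWeightModule b μ) :=
  inferInstanceAs (AddCommGroup (VermaModule b μ ⧸ vermaMaximal b μ))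

noncomputable instance :
    Module (UniversalEnvelopingAlgebra ℂ 𝔤) (SimpleHighestWeightModule b μ) :=
  inferInstanceAs (Module _ (VermaModule b μ ⧸ vermaMaximal b μ))

noncomputable instance : Module ℂ (SimpleHighestWeightModule b μ) :=
  inferInstanceAs (Module ℂ (VermaModule b μ ⧸ vermaMaximal b μ))

instance : IsScalarTower ℂ (UniversalEnvelopingAlgebra ℂ 𝔤) (SimpleHighestWeightModule b μ) :=
  inferInstanceAs (IsScalarTower ℂ (UniversalEnvelopingAlgebra ℂ 𝔤)
    (VermaModule b μ ⧸ vermaMaximal b μ))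

/-- The Lie algebra `𝔤` acts on `V(μ)` through `𝔤 → U(𝔤)`. -/
noncomputable instance : LieRingModule 𝔤 (SimpleHighestWeightModule b μ) where
  bracket x w := UniversalEnvelopingAlgebra.ι ℂ x • w
  add_lie x y w := by
    change UniversalEnvelopingAlgebra.ι ℂ (x + y) • w = _ • w + _ • w
    rw [map_add, add_smul]
  lie_add x w w' := smul_add _ w w'
  leibniz_lie x y w := by
    change _ • _ • w = UniversalEnvelopingAlgebra.ι ℂ ⁅x, y⁆ • w + _ • _ • w
    have h : UniversalEnvelopingAlgebra.ι ℂ ⁅x, y⁆ =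
        ⁅UniversalEnvelopingAlgebra.ι ℂ x, UniversalEnvelopingAlgebra.ι ℂ y⁆ :=
      LieHom.map_lie _ x y
    rw [h, LieRing.of_associative_ring_bracket, sub_smul, mul_smul, mul_smul,
      sub_add_cancel]

instance : LieModule ℂ 𝔤 (SimpleHighestWeightModule b μ) where
  smul_lie c x w := by
    change UniversalEnvelopingAlgebra.ι ℂ (c • x) • w = c • (UniversalEnvelopingAlgebra.ι ℂ x • w)
    rw [map_smul, smul_assoc]
  lie_smul c x w := by
    change UniversalEnvelopingAlgebra.ι ℂ x • (c • w) = c • (UniversalEnvelopingAlgebra.ι ℂ x • w)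
    rw [← algebraMap_smul (UniversalEnvelopingAlgebra ℂ 𝔤) c w,
      ← algebraMap_smul (UniversalEnvelopingAlgebra ℂ 𝔤) c (_ • w), ← mul_smul, ← mul_smul,
      Algebra.commutes]

end SimpleHighestWeightModule

/-! ### Weights of a finite-dimensional module -/

variable (H) (V : Type*) [AddCommGroup V] [Module ℂ V] [LieRingModule 𝔤 V] [LieModule ℂ 𝔤 V]

/-- `wt(V)`: the `μ ∈ 𝔥*` with `V_μ = {v | h v = μ(h) v for all h ∈ 𝔥} ≠ 0`. -/
def weightsOf : Set (Dual ℂ H) :=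
  {μ | LieModule.weightSpace V (μ : H → ℂ) ≠ ⊥}

/-- The rigidity condition on a set `Ψ` of weights of `V`: if `∑_{α ∈ Ψ} m_α α = ∑_{β ∈ wt(V)} r_β β`
with coefficients in `ℤ₊`, then `∑ m_α ≤ ∑ r_β`, with equality if and only if `β ∈ Ψ` whenever
`r_β > 0`. -/
def IsRigid (Ψ : Finset (Dual ℂ H)) : Prop :=
  ∀ m r : Dual ℂ H →₀ ℕ, (m.support : Set (Dual ℂ H)) ⊆ Ψ →
    (r.support : Set (Dual ℂ H)) ⊆ weightsOf H V →
    (m.sum fun α k => k • α) = (r.sum fun β k => k • β) →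
      (m.sum fun _ k => k) ≤ (r.sum fun _ k => k) ∧
      ((m.sum fun _ k => k) = (r.sum fun _ k => k) ↔ ∀ β, 0 < r β → β ∈ Ψ)

/-- `N_Ψ = ∑_{μ ∈ Ψ} dim V_μ`. -/
noncomputable def weightCount (Ψ : Finset (Dual ℂ H)) : ℕ :=
  ∑ μ ∈ Ψ, finrank ℂ (LieModule.weightSpace V (μ : H → ℂ))

/-- `λ_Ψ = ∑_{μ ∈ Ψ} (dim V_μ) μ`. -/
noncomputable def weightSum (Ψ : Finset (Dual ℂ H)) : Dual ℂ H :=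
  ∑ μ ∈ Ψ, finrank ℂ (LieModule.weightSpace V (μ : H → ℂ)) • μ

end Weights

/-! Write `W` for the exterior power of degree `N_Ψ` and `λ` for `λ_Ψ`. A basis of weight vectors of
`V` gives a basis of `W` indexed by the sets of `N_Ψ` basis vectors, the weight being the sum of the
weights in the set. The set `S` of all basis vectors with weight in `Ψ` has `N_Ψ` elements and
weight `λ`. If another set of that size has weight `λ`, the equality case of rigidity puts all its
weights in `Ψ`, so it is `S`. Hence `λ` has multiplicity one in `W`
(`exists_exteriorPower_weightBasis`), and parts (i) and (ii) use nothing else about rigidity.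

For (i), compose `f : W ⊗ V(ν) → V(ν + λ)` with the projection `p` onto the highest weight line.
Since `p ∘ f` kills the image of `𝔫⁻` and `V(ν) = U(𝔫⁻) v_ν`, it is determined on `W ⊗ v_ν`, hence,
comparing weights, by one number, its value at `w_λ ⊗ v_ν`. If that number is zero, the image of `f`
misses the highest weight vector and `f = 0` (`rank_lieModuleHom_le_one`).

For (ii), take `ν = η + tδ` with `t` large, where `δ` (`gradingDual`) is the Killing dual of the
element `h₀` on which all simple roots take the value 1; `δ` lies in `Q⁺` and is positive on the
simple coroots. A functional on `W ⊗ V(ν)` that kills the image of `𝔫⁻` is the same as an `𝔫⁻`-map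
`V(ν) → W*`. Prescribing the image of `v_ν` always defines such a map on the Verma module, which is
free over `U(𝔫⁻)`. It descends to `V(ν)` if the maximal submodule lies deeper than the weights of
`W*` reach. A shallowest weight vector of that submodule, of weight `ν + γ`, is singular, so `ν + γ`
and `ν` have equal Casimir scalars. Their difference is affine in `t` with slope `2γ(h₀) ≠ 0`, and
only finitely many `γ` have bounded depth, so this fails for large `t`
(`IsSingular.eq_zero_of_depth_le`, `exists_neg_linearMap`).

Let `Y` be the quotient of `W ⊗ V(ν)` by the largest submodule in the kernel of the functional. The
Casimir operator is a scalar on `Y`, and a second comparison of scalars shows that the image of `w_λ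
⊗ v_ν` is singular and generates `Y`. Therefore `Y` maps onto `V(ν + λ)`
(`SimpleHighestWeightModule.exists_lieModuleHom_ne_zero`). Neither complete reducibility nor
finite-dimensionality of `V(ν)` enters; the weight decomposition of `V` is obtained from
`sl₂`-triples. -/

/-! ### Weight vectors and highest weight modules -/

section WeightVectors

variable {𝔤 : Type*} [LieRing 𝔤] [LieAlgebra ℂ 𝔤] (H : LieSubalgebra ℂ 𝔤)

/-- A basis of `𝔤` consisting of weight vectors for `H`, together with an element of `H` whose
eigenvalues on `𝔤` are integers and whose centralizer is contained in `H`. -/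
structure TriangularBasis (J : Type*) where
  basis : Basis J ℂ 𝔤
  wt : J → Dual ℂ H
  deg : J → ℤ
  grading : H
  wt_grading : ∀ j, wt j grading = deg j
  lie_basis : ∀ (h : H) j, ⁅(h : 𝔤), basis j⁆ = wt j h • basis j
  mem_of_deg_eq_zero : ∀ j, deg j = 0 → basis j ∈ H
  lie_eq_zero : ∀ h h' : H, ⁅(h : 𝔤), (h' : 𝔤)⁆ = 0

/-- The vectors on which `H` acts through `χ`. -/
def weightVectors (M : Type*) [AddCommGroup M] [Module ℂ M] [LieRingModule 𝔤 M] [LieModule ℂ 𝔤 M]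
    (χ : Dual ℂ H) : Submodule ℂ M where
  carrier := {m | ∀ h : H, ⁅(h : 𝔤), m⁆ = χ h • m}
  add_mem' := by
    intro a b ha hb h
    rw [lie_add, ha h, hb h, smul_add]
  zero_mem' := by intro h; simp
  smul_mem' := by
    intro c x hx h
    rw [lie_smul, hx h, smul_comm]

variable {H}
variable {M : Type*} [AddCommGroup M] [Module ℂ M] [LieRingModule 𝔤 M] [LieModule ℂ 𝔤 M]

theorem lie_mem_weightVectors {χ ψ : Dual ℂ H} {x : 𝔤} {m : M} (hx : x ∈ weightVectors H 𝔤 ψ)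
    (hm : m ∈ weightVectors H M χ) : ⁅x, m⁆ ∈ weightVectors H M (χ + ψ) := by
  intro h
  rw [leibniz_lie, hx h, hm h, smul_lie, lie_smul, ← add_smul, LinearMap.add_apply, add_comm]

/-- A subspace stable under `H` contains the weight components of its elements. -/
theorem mem_of_sum_weightVectors_mem (N : Submodule ℂ M)
    (hN : ∀ (h : H), ∀ m ∈ N, ⁅(h : 𝔤), m⁆ ∈ N) (s : Finset (Dual ℂ H)) :
    ∀ x : Dual ℂ H → M, (∀ χ ∈ s, x χ ∈ weightVectors H M χ) → ∑ χ ∈ s, x χ ∈ N →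
      ∀ χ ∈ s, x χ ∈ N := by
  classical
  induction s using Finset.induction_on with
  | empty => simp
  | insert ψ s hψ ih =>
    intro x hx hsum
    have hs : ∀ χ ∈ s, x χ ∈ N := by
      intro χ hχ
      have hne : χ - ψ ≠ 0 := by
        rw [sub_ne_zero]; rintro rfl; exact hψ hχ
      obtain ⟨h, hh⟩ : ∃ h, (χ - ψ) h ≠ 0 := by
        by_contra! hc
        exact hne (LinearMap.ext hc)
      -- The operator `h - ψ(h)` kills the component of weight `ψ` and multiplies the one of weight
      -- `χ` by `(χ - ψ)(h)`, so the sum loses a term and stays in `N`.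
      have key := ih (fun χ => (χ - ψ) h • x χ)
        (fun χ hχ => Submodule.smul_mem _ _ (hx χ (Finset.mem_insert_of_mem hχ))) (by
          have h1 := N.sub_mem (hN h _ hsum) (N.smul_mem (ψ h) hsum)
          convert h1 using 1
          rw [lie_sum, Finset.smul_sum, ← Finset.sum_sub_distrib, Finset.sum_insert hψ,
            hx ψ (Finset.mem_insert_self _ _) h, sub_self, zero_add]
          refine Finset.sum_congr rfl fun χ hχ => ?_
          rw [hx χ (Finset.mem_insert_of_mem hχ) h, LinearMap.sub_apply, sub_smul]) χ hχ
      exact (Submodule.smul_mem_iff _ hh).1 key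
    intro χ hχ
    rcases Finset.mem_insert.1 hχ with rfl | hχ
    · rw [Finset.sum_insert hψ] at hsum
      exact (N.add_mem_iff_left (N.sum_mem hs)).1 hsum
    · exact hs χ hχ

/-- If `M` is spanned by weight vectors with weights in `A`, then so is each `H`-stable
subspace. -/
theorem mem_iSup_inf_weightVectors {A : Set (Dual ℂ H)} (N : Submodule ℂ M)
    (hN : ∀ (h : H), ∀ m ∈ N, ⁅(h : 𝔤), m⁆ ∈ N) {m : M} (hm : m ∈ N)
    (hA : m ∈ ⨆ χ ∈ A, weightVectors H M χ) :
    m ∈ ⨆ χ ∈ A, N ⊓ weightVectors H M χ := by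
  classical
  rw [iSup_subtype', Submodule.mem_iSup_iff_exists_finsupp] at hA
  obtain ⟨f, hf, hsum⟩ := hA
  let x : Dual ℂ H → M := fun χ => if h : χ ∈ A then f ⟨χ, h⟩ else 0
  have hx : ∀ a : A, x a = f a := fun a => by simp [x, a.2]
  have hsum' : ∑ χ ∈ f.support.map (Function.Embedding.subtype _), x χ = m := by
    rw [Finset.sum_map, ← hsum, Finsupp.sum]
    exact Finset.sum_congr rfl fun a _ => hx a
  have hmem : ∀ χ ∈ f.support.map (Function.Embedding.subtype _), x χ ∈ N :=
    mem_of_sum_weightVectors_mem N hN _ x (by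
      intro χ hχ
      obtain ⟨a, ha, rfl⟩ := Finset.mem_map.1 hχ
      simpa [hx a] using hf a) (by rwa [hsum'])
  rw [← hsum']
  refine Submodule.sum_mem _ fun χ hχ => ?_
  have h1 := hmem χ hχ
  obtain ⟨a, ha, rfl⟩ := Finset.mem_map.1 hχ
  refine Submodule.mem_iSup_of_mem (a : Dual ℂ H) (Submodule.mem_iSup_of_mem a.2 ⟨h1, ?_⟩)
  simpa [hx a] using hf a

theorem eq_zero_of_mem_weightVectors_of_mem_iSup {A : Set (Dual ℂ H)} {χ : Dual ℂ H} (hχ : χ ∉ A)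
    {m : M} (hm : m ∈ weightVectors H M χ) (hA : m ∈ ⨆ ψ ∈ A, weightVectors H M ψ) : m = 0 := by
  have h := mem_iSup_inf_weightVectors (weightVectors H M χ)
    (fun h m hm => by rw [hm h]; exact Submodule.smul_mem _ _ hm) hm hA
  have hle : ⨆ ψ ∈ A, weightVectors H M χ ⊓ weightVectors H M ψ ≤ ⊥ := by
    refine iSup₂_le fun ψ hψ x hx => ?_
    have hne : χ - ψ ≠ 0 := by
      rw [sub_ne_zero]; rintro rfl; exact hχ hψ
    obtain ⟨h, hh⟩ : ∃ h, (χ - ψ) h ≠ 0 := by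
      by_contra! hc
      exact hne (LinearMap.ext hc)
    have := (hx.1 h).symm.trans (hx.2 h)
    rw [← sub_eq_zero, ← sub_smul] at this
    exact (smul_eq_zero.1 this).resolve_left hh
  exact hle h

/-- In a basis of weight vectors, the coordinates of a weight vector vanish at the basis vectors of
other weights. -/
theorem repr_eq_zero_of_mem_weightVectors {I : Type*} (w : Basis I ℂ M) {wt : I → Dual ℂ H}
    (hw : ∀ i, w i ∈ weightVectors H M (wt i)) {χ : Dual ℂ H} {x : M}
    (hx : x ∈ weightVectors H M χ) {i : I} (hi : wt i ≠ χ) : w.repr x i = 0 := by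
  obtain ⟨h, hh⟩ : ∃ h, (wt i - χ) h ≠ 0 := by
    by_contra! hc
    exact (sub_ne_zero.2 hi) (LinearMap.ext hc)
  have h1 : w.coord i ∘ₗ LieModule.toEnd ℂ 𝔤 M (h : 𝔤) = wt i h • w.coord i := by
    refine w.ext fun k => ?_
    rw [LinearMap.comp_apply, LieModule.toEnd_apply_apply, hw k h]
    by_cases hki : k = i
    · subst hki; simp
    · simp [Finsupp.single_eq_of_ne' hki]
  have h2 : w.repr ⁅(h : 𝔤), x⁆ i = wt i h * w.repr x i := LinearMap.congr_fun h1 x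
  rw [hx h, map_smul, Finsupp.smul_apply, smul_eq_mul] at h2
  have h3 : (wt i - χ) h * w.repr x i = 0 := by
    rw [LinearMap.sub_apply, sub_mul, ← h2, sub_self]
  exact (mul_eq_zero.1 h3).resolve_left hh

end WeightVectors

/-! ### Singular vectors and the modules they generate. -/

namespace TriangularBasis

variable {𝔤 : Type*} [LieRing 𝔤] [LieAlgebra ℂ 𝔤] {H : LieSubalgebra ℂ 𝔤} {J : Type*}
  (T : TriangularBasis H J)
variable {M : Type*} [AddCommGroup M] [Module ℂ M] [LieRingModule 𝔤 M] [LieModule ℂ 𝔤 M]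

theorem basis_mem (j : J) : T.basis j ∈ weightVectors H 𝔤 (T.wt j) := fun h => T.lie_basis h j

theorem wt_eq_zero {j : J} (hj : T.deg j = 0) : T.wt j = 0 := by
  ext h
  have h1 := T.lie_basis h j
  rw [T.lie_eq_zero h ⟨_, T.mem_of_deg_eq_zero j hj⟩] at h1
  exact (smul_eq_zero.1 h1.symm).resolve_right (T.basis.ne_zero j)

/-- The coordinates of a weight vector vanish at the basis vectors of other weights. -/
theorem repr_eq_zero {χ : Dual ℂ H} {x : 𝔤} (hx : x ∈ weightVectors H 𝔤 χ) {j : J}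
    (hj : T.wt j ≠ χ) : T.basis.repr x j = 0 :=
  repr_eq_zero_of_mem_weightVectors T.basis T.basis_mem hx hj

/-- To check that `x` acts into a subspace it suffices to check the basis vectors occurring in
`x`. -/
theorem lie_mem_of_basis {S : Submodule ℂ M} {x : 𝔤} {m : M}
    (h : ∀ j, T.basis.repr x j ≠ 0 → ⁅T.basis j, m⁆ ∈ S) : ⁅x, m⁆ ∈ S := by
  rw [← T.basis.linearCombination_repr x, Finsupp.linearCombination_apply, Finsupp.sum,
    sum_lie]
  refine S.sum_mem fun j hj => ?_
  rw [smul_lie]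
  exact S.smul_mem _ (h j (Finsupp.mem_support_iff.1 hj))

theorem lie_mem_of_forall_basis {S : Submodule ℂ M} {m : M}
    (h : ∀ j, ⁅T.basis j, m⁆ ∈ S) (x : 𝔤) : ⁅x, m⁆ ∈ S :=
  T.lie_mem_of_basis fun j _ => h j

/-- `z` is killed by the basis vectors of positive degree and has weight `μ`. -/
structure IsSingular (μ : Dual ℂ H) (z : M) : Prop where
  pos : ∀ j, 0 < T.deg j → ⁅T.basis j, z⁆ = 0
  weight : z ∈ weightVectors H M μ

variable {T}

/-- The submodule generated by a singular vector is spanned by the vectors obtained by applying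
negative basis vectors. -/
theorem IsSingular.le_of_mem {μ : Dual ℂ H} {z : M} (hz : T.IsSingular μ z) {S : Submodule ℂ M}
    (hzS : z ∈ S) (hS : ∀ j, T.deg j < 0 → ∀ m ∈ S, ⁅T.basis j, m⁆ ∈ S) :
    ∃ N : LieSubmodule ℂ 𝔤 M, z ∈ N ∧ N.toSubmodule ≤ S := by
  let F : Set (Submodule ℂ M) :=
    {S | z ∈ S ∧ ∀ j, T.deg j < 0 → ∀ m ∈ S, ⁅T.basis j, m⁆ ∈ S}
  have hz0 : z ∈ sInf F := by
    rw [Submodule.mem_sInf]; exact fun p hp => hp.1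
  have hneg : ∀ j, T.deg j < 0 → ∀ m ∈ sInf F, ⁅T.basis j, m⁆ ∈ sInf F := by
    intro j hj m hm
    rw [Submodule.mem_sInf] at hm ⊢
    exact fun p hp => hp.2 j hj m (hm p hp)
  -- The largest part of `sInf F` that `𝔤` maps into `sInf F`. It belongs to `F` itself, so
  -- minimality makes `sInf F` stable under all of `𝔤`.
  let U : Submodule ℂ M :=
    { carrier := {m | m ∈ sInf F ∧ ∀ x : 𝔤, ⁅x, m⁆ ∈ sInf F}
      add_mem' := fun ha hb => ⟨Submodule.add_mem _ ha.1 hb.1, fun x => by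
        rw [lie_add]; exact Submodule.add_mem _ (ha.2 x) (hb.2 x)⟩
      zero_mem' := ⟨Submodule.zero_mem _, fun x => by rw [lie_zero]; exact Submodule.zero_mem _⟩
      smul_mem' := fun c m hm => ⟨Submodule.smul_mem _ c hm.1, fun x => by
        rw [lie_smul]; exact Submodule.smul_mem _ c (hm.2 x)⟩ }
  have hU : U ∈ F := by
    refine ⟨⟨hz0, T.lie_mem_of_forall_basis fun j => ?_⟩, fun j hj m hm => ⟨hneg j hj m hm.1, ?_⟩⟩
    · rcases lt_trichotomy (T.deg j) 0 with h | h | h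
      · exact hneg j h z hz0
      · have := hz.weight ⟨_, T.mem_of_deg_eq_zero j h⟩
        change ⁅T.basis j, z⁆ = _ at this
        rw [this]
        exact Submodule.smul_mem _ _ hz0
      · rw [hz.pos j h]
        exact Submodule.zero_mem _
    · intro x
      rw [leibniz_lie]
      exact Submodule.add_mem _ (hm.2 _) (hneg j hj _ (hm.2 x))
  have hle : sInf F ≤ U := sInf_le hU
  exact ⟨{ sInf F with lie_mem := fun {x m} hm => (hle hm).2 x }, hz0, sInf_le ⟨hzS, hS⟩⟩

/-- `z` generates the module `M`. -/
def Generates (𝔤 : Type*) [LieRing 𝔤] [LieAlgebra ℂ 𝔤] {M : Type*} [AddCommGroup M] [Module ℂ M]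
    [LieRingModule 𝔤 M] (z : M) : Prop :=
  ∀ N : LieSubmodule ℂ 𝔤 M, z ∈ N → N = ⊤

theorem IsSingular.eq_top {μ : Dual ℂ H} {z : M} (hz : T.IsSingular μ z) (hg : Generates 𝔤 z)
    {S : Submodule ℂ M} (hzS : z ∈ S) (hS : ∀ j, T.deg j < 0 → ∀ m ∈ S, ⁅T.basis j, m⁆ ∈ S) :
    S = ⊤ := by
  obtain ⟨N, hzN, hN⟩ := hz.le_of_mem hzS hS
  rw [hg N hzN] at hN
  exact top_le_iff.1 hN

/-! ### The cone of negative weights and its grading by depth. -/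

variable (T)

/-- The sums of weights of basis vectors of negative degree. -/
def negCone : AddSubmonoid (Dual ℂ H) := AddSubmonoid.closure (T.wt '' {j | T.deg j < 0})

/-- The number `k` is the depth of `γ`, the parameter of the later inductions. Each generator of the
cone has depth at least 1, so only `γ = 0` has depth 0. -/
theorem exists_grading_eq {γ : Dual ℂ H} (hγ : γ ∈ T.negCone) :
    ∃ k : ℕ, γ T.grading = -(k : ℂ) ∧ (γ ≠ 0 → 0 < k) := by
  induction hγ using AddSubmonoid.closure_induction with
  | mem x hx =>
    obtain ⟨j, hj, rfl⟩ := hx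
    have hj : T.deg j < 0 := hj
    refine ⟨(T.deg j).natAbs, ?_, fun _ => by omega⟩
    rw [T.wt_grading]
    have h1 : T.deg j = -((T.deg j).natAbs : ℤ) := by omega
    exact_mod_cast congrArg (Int.cast : ℤ → ℂ) h1
  | zero => exact ⟨0, by simp, fun h => absurd rfl h⟩
  | add x y _ _ hx hy =>
    obtain ⟨k, hk, hk0⟩ := hx
    obtain ⟨l, hl, hl0⟩ := hy
    refine ⟨k + l, by rw [LinearMap.add_apply, hk, hl]; push_cast; ring, fun h => ?_⟩
    by_cases hx0 : x = 0
    · have := hl0 (by rintro rfl; simp [hx0] at h)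
      omega
    · have := hk0 hx0
      omega

theorem exists_eq_sum_of_mem_negCone [Fintype J] {γ : Dual ℂ H} (hγ : γ ∈ T.negCone) :
    ∃ n : J → ℕ, (∀ j, n j ≠ 0 → T.deg j < 0) ∧ γ = ∑ j, n j • T.wt j := by
  classical
  induction hγ using AddSubmonoid.closure_induction with
  | mem x hx =>
    obtain ⟨j, hj, rfl⟩ := hx
    refine ⟨Pi.single j 1, fun i hi => ?_, ?_⟩
    · by_cases h : i = j
      · subst h; exact hj
      · simp [h] at hi
    · rw [Finset.sum_eq_single j] <;> simp +contextual
  | zero => exact ⟨0, by simp, by simp⟩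
  | add x y _ _ hx hy =>
    obtain ⟨k, hk, rfl⟩ := hx
    obtain ⟨l, hl, rfl⟩ := hy
    refine ⟨k + l, fun j hj => ?_, by simp [add_smul, Finset.sum_add_distrib]⟩
    by_cases h : k j = 0
    · exact hl j (by simpa [h] using hj)
    · exact hk j h

/-- Only finitely many elements of the negative cone have bounded depth. -/
theorem finite_negCone [Fintype J] (K : ℕ) :
    {γ | γ ∈ T.negCone ∧ ∃ k : ℕ, k ≤ K ∧ γ T.grading = -(k : ℂ)}.Finite := by
  classical
  -- Each generator adds at least 1 to the depth, so every coefficient is at most `K`.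
  refine ((Fintype.piFinset fun _ : J => Finset.range (K + 1)).finite_toSet.image
    fun n => ∑ j, n j • T.wt j).subset ?_
  rintro γ ⟨hγ, k, hk, hk'⟩
  obtain ⟨n, hn, rfl⟩ := T.exists_eq_sum_of_mem_negCone hγ
  refine ⟨n, ?_, rfl⟩
  have h1 : ∑ j, (n j : ℤ) * T.deg j = -(k : ℤ) := by
    have : (∑ j, (n j : ℂ) * (T.deg j : ℂ)) = -(k : ℂ) := by
      rw [← hk']
      simp [LinearMap.sum_apply, T.wt_grading]
    exact_mod_cast this
  have h2 : ∀ j ∈ Finset.univ, (n j : ℤ) * T.deg j ≤ 0 := by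
    intro j _
    by_cases h : n j = 0
    · simp [h]
    · exact mul_nonpos_of_nonneg_of_nonpos (by positivity) (hn j h).le
  simp only [Finset.mem_coe, Fintype.mem_piFinset, Finset.mem_range]
  intro j
  by_cases h : n j = 0
  · omega
  have h3 : ∑ i, (n i : ℤ) * T.deg i ≤ (n j : ℤ) * T.deg j := by
    rw [← Finset.add_sum_erase _ _ (Finset.mem_univ j)]
    have := Finset.sum_nonpos fun i (hi : i ∈ Finset.univ.erase j) => h2 i (Finset.mem_univ i)
    linarith
  have h4 := hn j h
  have h5 : (n j : ℤ) * T.deg j ≤ -(n j : ℤ) := by nlinarith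
  omega

variable {T}

/-- A module generated by a singular vector of weight `μ` is spanned by weight vectors of weights
in `μ + negCone`. -/
theorem IsSingular.iSup_weightVectors {μ : Dual ℂ H} {z : M} (hz : T.IsSingular μ z)
    (hg : Generates 𝔤 z) :
    ⨆ χ ∈ {χ | ∃ γ ∈ T.negCone, χ = μ + γ}, weightVectors H M χ = ⊤ := by
  refine hz.eq_top hg ?_ fun j hj m hm => ?_
  · exact Submodule.mem_iSup_of_mem μ (Submodule.mem_iSup_of_mem
      ⟨0, T.negCone.zero_mem, (add_zero μ).symm⟩ hz.weight)
  · let f : M →ₗ[ℂ] M := LieModule.toEnd ℂ 𝔤 M (T.basis j)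
    refine (iSup₂_le ?_ : _ ≤ Submodule.comap f (⨆ χ ∈ {χ | ∃ γ ∈ T.negCone, χ = μ + γ},
      weightVectors H M χ)) hm
    rintro _ ⟨γ, hγ, rfl⟩ m hm
    refine Submodule.mem_iSup_of_mem (μ + γ + T.wt j) (Submodule.mem_iSup_of_mem
      ⟨γ + T.wt j, T.negCone.add_mem hγ (AddSubmonoid.subset_closure ⟨j, hj, rfl⟩),
        add_assoc _ _ _⟩ ?_)
    exact lie_mem_weightVectors (T.basis_mem j) hm

/-- The sum of the weight spaces of a highest weight module other than the highest one. -/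
def lowerPart (T : TriangularBasis H J) (M : Type*) [AddCommGroup M] [Module ℂ M]
    [LieRingModule 𝔤 M] [LieModule ℂ 𝔤 M] (μ : Dual ℂ H) : Submodule ℂ M :=
  ⨆ χ ∈ {χ | ∃ γ ∈ T.negCone, γ ≠ 0 ∧ χ = μ + γ}, weightVectors H M χ

theorem lie_mem_lowerPart (T : TriangularBasis H J) {μ : Dual ℂ H} (h : H) {m : M}
    (hm : m ∈ T.lowerPart M μ) : ⁅(h : 𝔤), m⁆ ∈ T.lowerPart M μ := by
  let f : M →ₗ[ℂ] M := LieModule.toEnd ℂ 𝔤 M (h : 𝔤)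
  refine (iSup₂_le ?_ : _ ≤ Submodule.comap f (T.lowerPart M μ)) hm
  intro χ hχ m hm
  change ⁅(h : 𝔤), m⁆ ∈ T.lowerPart M μ
  rw [hm h]
  exact Submodule.smul_mem _ _ (Submodule.mem_iSup_of_mem χ (Submodule.mem_iSup_of_mem hχ hm))

theorem IsSingular.notMem_lowerPart {μ : Dual ℂ H} {z : M} (hz : T.IsSingular μ z) (hz0 : z ≠ 0) :
    z ∉ T.lowerPart M μ := by
  intro h
  refine hz0 (eq_zero_of_mem_weightVectors_of_mem_iSup ?_ hz.weight h)
  rintro ⟨γ, _, h0, h1⟩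
  exact h0 (by simpa using h1.symm)

theorem add_wt_ne_zero (T : TriangularBasis H J) {γ : Dual ℂ H} (hγ : γ ∈ T.negCone) {j : J}
    (hj : T.deg j < 0) : γ + T.wt j ≠ 0 := by
  intro h
  obtain ⟨k, hk, _⟩ := T.exists_grading_eq hγ
  have h1 := LinearMap.congr_fun h T.grading
  rw [LinearMap.add_apply, hk, T.wt_grading, LinearMap.zero_apply] at h1
  have : -(k : ℤ) + T.deg j = 0 := by exact_mod_cast h1
  omega

theorem IsSingular.lie_mem_lowerPart {μ : Dual ℂ H} {z : M} (hz : T.IsSingular μ z)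
    (hg : Generates 𝔤 z) {j : J} (hj : T.deg j < 0) (m : M) :
    ⁅T.basis j, m⁆ ∈ T.lowerPart M μ := by
  let f : M →ₗ[ℂ] M := LieModule.toEnd ℂ 𝔤 M (T.basis j)
  have hm : m ∈ (⊤ : Submodule ℂ M) := trivial
  rw [← hz.iSup_weightVectors hg] at hm
  refine (iSup₂_le ?_ : _ ≤ Submodule.comap f (T.lowerPart M μ)) hm
  rintro _ ⟨γ, hγ, rfl⟩ m hm
  refine Submodule.mem_iSup_of_mem (μ + γ + T.wt j) (Submodule.mem_iSup_of_mem
      ⟨γ + T.wt j, T.negCone.add_mem hγ (AddSubmonoid.subset_closure ⟨j, hj, rfl⟩),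
        T.add_wt_ne_zero hγ hj, add_assoc _ _ _⟩ ?_)
  exact lie_mem_weightVectors (T.basis_mem j) hm

/-- The sum contains `z` and is stable under `𝔫⁻`, which maps all of `M` into the lower part. Thus
the weight space of weight `μ` is the line through `z`. -/
theorem IsSingular.span_sup_lowerPart {μ : Dual ℂ H} {z : M} (hz : T.IsSingular μ z)
    (hg : Generates 𝔤 z) : Submodule.span ℂ {z} ⊔ T.lowerPart M μ = ⊤ :=
  hz.eq_top hg (Submodule.mem_sup_left (Submodule.mem_span_singleton_self z))
    fun _ hj m _ => Submodule.mem_sup_right (hz.lie_mem_lowerPart hg hj m)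

/-- The projection onto the highest weight line. -/
theorem IsSingular.exists_functional {μ : Dual ℂ H} {z : M} (hz : T.IsSingular μ z)
    (hg : Generates 𝔤 z) (hz0 : z ≠ 0) :
    ∃ p : M →ₗ[ℂ] ℂ, p z = 1 ∧ (∀ j, T.deg j < 0 → ∀ m, p ⁅T.basis j, m⁆ = 0) ∧
      ∀ (h : H) m, p ⁅(h : 𝔤), m⁆ = μ h * p m := by
  obtain ⟨q, hq, hle⟩ := Submodule.exists_le_ker_of_notMem (hz.notMem_lowerPart hz0)
  refine ⟨(q z)⁻¹ • q, by simp [hq], fun j hj m => ?_, fun h m => ?_⟩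
  · have : q ⁅T.basis j, m⁆ = 0 := hle (hz.lie_mem_lowerPart hg hj m)
    simp [this]
  · have hm : m ∈ (⊤ : Submodule ℂ M) := trivial
    rw [← hz.span_sup_lowerPart hg, Submodule.mem_sup] at hm
    obtain ⟨y, hy, l, hl, rfl⟩ := hm
    obtain ⟨a, rfl⟩ := Submodule.mem_span_singleton.1 hy
    have h1 : q l = 0 := hle hl
    have h2 : q ⁅(h : 𝔤), l⁆ = 0 := hle (T.lie_mem_lowerPart h hl)
    rw [lie_add, lie_smul, hz.weight h]
    simp [h1, h2]
    ring

/-- A proper submodule of a module generated by a singular vector is contained in the sum of the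
lower weight spaces. -/
theorem IsSingular.le_lowerPart {μ : Dual ℂ H} {z : M} (hz : T.IsSingular μ z)
    (hg : Generates 𝔤 z) {N : LieSubmodule ℂ 𝔤 M} (hN : N ≠ ⊤) :
    N.toSubmodule ≤ T.lowerPart M μ := by
  intro n hn
  have h := mem_iSup_inf_weightVectors (A := {χ | ∃ γ ∈ T.negCone, χ = μ + γ}) N.toSubmodule
    (fun h m hm => N.lie_mem hm) hn (by rw [hz.iSup_weightVectors hg]; trivial)
  refine (iSup₂_le ?_ : _ ≤ T.lowerPart M μ) h
  rintro _ ⟨γ, hγ, rfl⟩ m ⟨hm, hm'⟩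
  -- A component of weight `μ` is a multiple of `z`; a nonzero one would put `z` in `N` and force `N
  -- = ⊤`.
  by_cases h0 : γ = 0
  · rw [h0, add_zero] at hm'
    have hmt : m ∈ (⊤ : Submodule ℂ M) := trivial
    rw [← hz.span_sup_lowerPart hg, Submodule.mem_sup] at hmt
    obtain ⟨y, hy, l, hl, rfl⟩ := hmt
    obtain ⟨a, rfl⟩ := Submodule.mem_span_singleton.1 hy
    have hl0 : l = 0 := by
      refine eq_zero_of_mem_weightVectors_of_mem_iSup (χ := μ) ?_
        ((Submodule.add_mem_iff_right _ (Submodule.smul_mem _ a hz.weight)).1 hm') hl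
      rintro ⟨γ, _, h0, h1⟩
      exact h0 (by simpa using h1.symm)
    by_cases ha : a = 0
    · simp [ha, hl0]
    · refine absurd (hg N ?_) hN
      rw [hl0, add_zero] at hm
      exact (Submodule.smul_mem_iff _ ha).1 hm
  · exact Submodule.mem_iSup_of_mem (μ + γ) (Submodule.mem_iSup_of_mem ⟨γ, hγ, h0, rfl⟩ hm')

end TriangularBasis

/-! ### The Casimir operator -/

set_option linter.unusedSectionVars false

namespace TriangularBasis

variable {𝔤 : Type*} [LieRing 𝔤] [LieAlgebra ℂ 𝔤] {H : LieSubalgebra ℂ 𝔤} {J : Type*}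
  (T : TriangularBasis H J)
variable {M : Type*} [AddCommGroup M] [Module ℂ M] [LieRingModule 𝔤 M] [LieModule ℂ 𝔤 M]

open Classical in
/-- The projection of `𝔤` onto `H` along the basis vectors of nonzero degree. -/
noncomputable def toCartan : 𝔤 →ₗ[ℂ] H :=
  T.basis.constr ℂ fun j => if h : T.deg j = 0 then ⟨T.basis j, T.mem_of_deg_eq_zero j h⟩ else 0

theorem deg_eq_zero_of_wt {j : J} (h : T.wt j = 0) : T.deg j = 0 := by
  have := T.wt_grading j
  rw [h, LinearMap.zero_apply] at this
  exact_mod_cast this.symm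

theorem toCartan_of_zero {x : 𝔤} (hx : x ∈ weightVectors H 𝔤 (0 : Dual ℂ H)) :
    (T.toCartan x : 𝔤) = x := by
  conv_rhs => rw [← T.basis.linearCombination_repr x]
  rw [toCartan, Basis.constr_apply, Finsupp.linearCombination_apply, Finsupp.sum, Finsupp.sum,
    AddSubmonoidClass.coe_finsetSum]
  refine Finset.sum_congr rfl fun j hj => ?_
  have h0 : T.deg j = 0 := by
    refine T.deg_eq_zero_of_wt ?_
    by_contra h
    exact Finsupp.mem_support_iff.1 hj (T.repr_eq_zero hx h)
  simp [h0]

theorem mem_zero_weightVectors (T : TriangularBasis H J) (h : H) : (h : 𝔤) ∈ weightVectors H 𝔤 (0 : Dual ℂ H) := by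
  intro h'
  rw [T.lie_eq_zero, LinearMap.zero_apply, zero_smul]

@[simp]
theorem toCartan_coe (h : H) : T.toCartan (h : 𝔤) = h :=
  Subtype.ext (T.toCartan_of_zero (T.mem_zero_weightVectors h))

theorem toCartan_basis_of_ne {j : J} (hj : T.deg j ≠ 0) : T.toCartan (T.basis j) = 0 := by
  rw [toCartan, Basis.constr_basis, dif_neg hj]

theorem toCartan_basis_of_eq {j : J} (hj : T.deg j = 0) :
    (T.toCartan (T.basis j) : 𝔤) = T.basis j := by
  rw [toCartan, Basis.constr_basis, dif_pos hj]

variable [IsKilling ℂ 𝔤] [Fintype J]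

open Classical in
/-- The dual basis with respect to the Killing form. -/
noncomputable def killingDual : Basis J ℂ 𝔤 :=
  LinearMap.BilinForm.dualBasis (killingForm ℂ 𝔤) (killingForm_nondegenerate ℂ 𝔤) T.basis

theorem killingDual_repr (x : 𝔤) (j : J) :
    T.killingDual.repr x j = killingForm ℂ 𝔤 x (T.basis j) := by
  classical
  exact LinearMap.BilinForm.dualBasis_repr_apply _ _ _ _

open Classical in
theorem killingForm_killingDual (i j : J) :
    killingForm ℂ 𝔤 (T.killingDual i) (T.basis j) = if j = i then 1 else 0 :=
  LinearMap.BilinForm.apply_dualBasis_left _ _ _ _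

theorem basis_repr (x : 𝔤) (j : J) :
    T.basis.repr x j = killingForm ℂ 𝔤 x (T.killingDual j) := by
  classical
  let f : 𝔤 →ₗ[ℂ] ℂ := (killingForm ℂ 𝔤).flip (T.killingDual j)
  have : T.basis.coord j = f := by
    refine T.basis.ext fun i => ?_
    change T.basis.coord j (T.basis i) = killingForm ℂ 𝔤 (T.basis i) (T.killingDual j)
    rw [LieModule.traceForm_comm, T.killingForm_killingDual]
    simp [Finsupp.single_apply]
  exact LinearMap.congr_fun this x

theorem killingForm_lie (x y z : 𝔤) :
    killingForm ℂ 𝔤 ⁅x, y⁆ z = -killingForm ℂ 𝔤 y ⁅x, z⁆ := by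
  rw [← lie_skew, map_neg, LinearMap.neg_apply, LieModule.traceForm_apply_lie_apply]

/-- Invariance of the Killing form makes `ad h` skew, so passing to the dual basis reverses weights.
-/
theorem killingDual_mem (j : J) : T.killingDual j ∈ weightVectors H 𝔤 (-T.wt j) := by
  classical
  intro h
  refine T.killingDual.repr.injective (Finsupp.ext fun i => ?_)
  rw [map_smul, Finsupp.smul_apply, T.killingDual_repr, T.killingDual_repr, killingForm_lie,
    T.lie_basis, map_smul, T.killingForm_killingDual]
  by_cases hij : i = j
  · subst hij; simp
  · simp [hij]

/-- Duals of lowering vectors are combinations of raising vectors and conversely. This allows each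
term of the Casimir operator to be reordered with the raising factor on the chosen side. -/
theorem deg_eq_neg_of_repr {i j : J} (h : T.basis.repr (T.killingDual j) i ≠ 0) :
    T.deg i = -T.deg j := by
  have h1 : T.wt i = -T.wt j := by
    by_contra hc
    exact h (T.repr_eq_zero (T.killingDual_mem j) hc)
  have h2 := LinearMap.congr_fun h1 T.grading
  rw [T.wt_grading, LinearMap.neg_apply, T.wt_grading] at h2
  exact_mod_cast h2

theorem killingDual_zero {j : J} (hj : T.deg j = 0) :
    (T.toCartan (T.killingDual j) : 𝔤) = T.killingDual j := by
  refine T.toCartan_of_zero ?_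
  have := T.killingDual_mem j
  rwa [T.wt_eq_zero hj, neg_zero] at this

theorem lie_basis_killingDual (j : J) :
    (T.toCartan ⁅T.basis j, T.killingDual j⁆ : 𝔤) = ⁅T.basis j, T.killingDual j⁆ := by
  refine T.toCartan_of_zero ?_
  have := lie_mem_weightVectors (T.basis_mem j) (T.killingDual_mem j)
  rwa [neg_add_cancel] at this


variable (M) in
/-- The Casimir operator. -/
noncomputable def casimir : Module.End ℂ M :=
  ∑ j, (LieModule.toEnd ℂ 𝔤 M (T.basis j)) ∘ₗ (LieModule.toEnd ℂ 𝔤 M (T.killingDual j))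

theorem casimir_apply (m : M) : T.casimir M m = ∑ j, ⁅T.basis j, ⁅T.killingDual j, m⁆⁆ := by
  simp [casimir, LinearMap.sum_apply]

/-- The matrix of `ad x` in the dual basis is minus the transpose of its matrix in the basis, so the
two sums in the commutator cancel. -/
theorem casimir_lie (x : 𝔤) (m : M) : T.casimir M ⁅x, m⁆ = ⁅x, T.casimir M m⁆ := by
  have h1 : ∀ j, ⁅x, T.basis j⁆ =
      ∑ i, killingForm ℂ 𝔤 ⁅x, T.basis j⁆ (T.killingDual i) • T.basis i := by
    intro j
    conv_lhs => rw [← T.basis.sum_repr ⁅x, T.basis j⁆]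
    simp_rw [T.basis_repr]
  have h2 : ∀ i, ⁅x, T.killingDual i⁆ =
      ∑ j, (-killingForm ℂ 𝔤 ⁅x, T.basis j⁆ (T.killingDual i)) • T.killingDual j := by
    intro i
    conv_lhs => rw [← T.killingDual.sum_repr ⁅x, T.killingDual i⁆]
    refine Finset.sum_congr rfl fun j _ => ?_
    rw [T.killingDual_repr, killingForm_lie, LieModule.traceForm_comm]
  have h3 : ⁅x, T.casimir M m⁆ - T.casimir M ⁅x, m⁆ =
      (∑ j, ⁅⁅x, T.basis j⁆, ⁅T.killingDual j, m⁆⁆) +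
        ∑ j, ⁅T.basis j, ⁅⁅x, T.killingDual j⁆, m⁆⁆ := by
    rw [casimir_apply, casimir_apply, lie_sum, ← Finset.sum_sub_distrib, ← Finset.sum_add_distrib]
    refine Finset.sum_congr rfl fun j _ => ?_
    rw [leibniz_lie x, leibniz_lie x (T.killingDual j) m, lie_add]
    abel
  have h4 : (∑ j, ⁅⁅x, T.basis j⁆, ⁅T.killingDual j, m⁆⁆) +
        ∑ j, ⁅T.basis j, ⁅⁅x, T.killingDual j⁆, m⁆⁆ = 0 := by
    have e1 : (∑ j, ⁅⁅x, T.basis j⁆, ⁅T.killingDual j, m⁆⁆) =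
        ∑ j, ∑ i, killingForm ℂ 𝔤 ⁅x, T.basis j⁆ (T.killingDual i) •
          ⁅T.basis i, ⁅T.killingDual j, m⁆⁆ := by
      refine Finset.sum_congr rfl fun j _ => ?_
      conv_lhs => rw [h1 j]
      rw [sum_lie]
      simp_rw [smul_lie]
    have e2 : (∑ j, ⁅T.basis j, ⁅⁅x, T.killingDual j⁆, m⁆⁆) =
        ∑ i, ∑ j, (-killingForm ℂ 𝔤 ⁅x, T.basis j⁆ (T.killingDual i)) •
          ⁅T.basis i, ⁅T.killingDual j, m⁆⁆ := by
      refine Finset.sum_congr rfl fun i _ => ?_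
      conv_lhs => rw [h2 i]
      rw [sum_lie, lie_sum]
      simp_rw [smul_lie, lie_smul]
    rw [e1, e2, Finset.sum_comm, ← Finset.sum_add_distrib]
    refine Finset.sum_eq_zero fun i _ => ?_
    rw [← Finset.sum_add_distrib]
    refine Finset.sum_eq_zero fun j _ => ?_
    rw [neg_smul, add_neg_cancel]
  rw [h4, sub_eq_zero] at h3
  exact h3.symm

/-- The scalar by which the Casimir operator acts on a module of highest weight `μ`. -/
noncomputable def casimirScalar (μ : Dual ℂ H) : ℂ :=
  ∑ j, (μ (T.toCartan (T.basis j)) * μ (T.toCartan (T.killingDual j)) +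
    if 0 < T.deg j then μ (T.toCartan ⁅T.basis j, T.killingDual j⁆) else 0)

/-- Put the raising factor on the right in each term: for `deg j > 0` this costs the commutator,
which lies in `H` and gives the extra summand of `casimirScalar`. Working modulo `N` covers both
singular vectors (`N = ⊥`) and vectors that become singular only in a quotient. -/
theorem casimir_sub_mem (N : LieSubmodule ℂ 𝔤 M) {μ : Dual ℂ H} {m : M}
    (hpos : ∀ j, 0 < T.deg j → ⁅T.basis j, m⁆ ∈ N) (hm : m ∈ weightVectors H M μ) :
    T.casimir M m - T.casimirScalar μ • m ∈ N := by
  rw [casimir_apply, casimirScalar, Finset.sum_smul, ← Finset.sum_sub_distrib]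
  refine N.toSubmodule.sum_mem fun j _ => ?_
  rcases lt_trichotomy (T.deg j) 0 with h | h | h
  · rw [T.toCartan_basis_of_ne h.ne, if_neg h.not_gt, map_zero, zero_mul, add_zero, zero_smul,
      sub_zero]
    refine N.lie_mem ?_
    exact T.lie_mem_of_basis (S := N.toSubmodule) fun i hi =>
      hpos i (by rw [T.deg_eq_neg_of_repr hi]; omega)
  · rw [if_neg (by omega), add_zero, ← T.killingDual_zero h, hm, lie_smul,
      ← T.toCartan_basis_of_eq h, hm, T.toCartan_coe, T.toCartan_coe, smul_smul, mul_comm, sub_self]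
    exact N.zero_mem
  · have h1 : ⁅⁅T.basis j, T.killingDual j⁆, m⁆ =
        μ (T.toCartan ⁅T.basis j, T.killingDual j⁆) • m := by
      rw [← hm, T.lie_basis_killingDual]
    rw [T.toCartan_basis_of_ne h.ne', if_pos h, map_zero, zero_mul, zero_add, leibniz_lie, h1,
      add_sub_cancel_left]
    exact N.lie_mem (hpos j h)

/-- Dual to `casimir_sub_mem`: with the lowering factor on the left, `φ` annihilates the term, and
the same commutators remain. -/
theorem apply_casimir (φ : M →ₗ[ℂ] ℂ) {μ : Dual ℂ H}
    (hneg : ∀ j, T.deg j < 0 → ∀ m, φ ⁅T.basis j, m⁆ = 0)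
    (hH : ∀ (h : H) m, φ ⁅(h : 𝔤), m⁆ = μ h * φ m) (m : M) :
    φ (T.casimir M m) = T.casimirScalar μ * φ m := by
  rw [casimir_apply, casimirScalar, Finset.sum_mul, map_sum]
  refine Finset.sum_congr rfl fun j _ => ?_
  rcases lt_trichotomy (T.deg j) 0 with h | h | h
  · rw [T.toCartan_basis_of_ne h.ne, if_neg h.not_gt, map_zero, zero_mul, add_zero, zero_mul,
      hneg j h]
  · rw [if_neg (by omega), add_zero]
    conv_lhs => rw [← T.killingDual_zero h, ← T.toCartan_basis_of_eq h, hH, hH]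
    ring
  · have h1 : φ ⁅T.killingDual j, ⁅T.basis j, m⁆⁆ = 0 :=
      T.lie_mem_of_basis (S := LinearMap.ker φ) fun i hi =>
        hneg i (by rw [T.deg_eq_neg_of_repr hi]; omega) _
    rw [T.toCartan_basis_of_ne h.ne', if_pos h, map_zero, zero_mul, zero_add, leibniz_lie, map_add,
      h1, add_zero, ← hH, T.lie_basis_killingDual]

/-! ### How the Casimir scalar varies along the direction of `gradingDual`. -/

/-- The linear functional on `H` dual to the grading element under the Killing form. -/
noncomputable def gradingDual : Dual ℂ H :=
  (killingForm ℂ 𝔤 (T.grading : 𝔤)) ∘ₗ H.toSubmodule.subtype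

theorem gradingDual_apply (h : H) : T.gradingDual h = killingForm ℂ 𝔤 T.grading h := rfl

theorem sum_mul_gradingDual (μ : Dual ℂ H) :
    ∑ j, μ (T.toCartan (T.basis j)) * T.gradingDual (T.toCartan (T.killingDual j)) =
      μ T.grading := by
  have h1 : T.grading = T.toCartan
      (∑ j, killingForm ℂ 𝔤 T.grading (T.killingDual j) • T.basis j) := by
    simp_rw [← T.basis_repr, T.basis.sum_repr, T.toCartan_coe]
  conv_rhs => rw [h1]
  rw [map_sum, map_sum]
  refine Finset.sum_congr rfl fun j _ => ?_
  rw [map_smul, map_smul, smul_eq_mul, mul_comm]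
  by_cases h : T.deg j = 0
  · rw [T.gradingDual_apply, T.killingDual_zero h]
  · rw [T.toCartan_basis_of_ne h, map_zero, mul_zero, mul_zero]

theorem sum_gradingDual_mul (μ : Dual ℂ H) :
    ∑ j, T.gradingDual (T.toCartan (T.basis j)) * μ (T.toCartan (T.killingDual j)) =
      μ T.grading := by
  have h1 : T.grading = T.toCartan
      (∑ j, killingForm ℂ 𝔤 T.grading (T.basis j) • T.killingDual j) := by
    simp_rw [← T.killingDual_repr, T.killingDual.sum_repr, T.toCartan_coe]
  have h2 : ∀ j, T.gradingDual (T.toCartan (T.basis j)) =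
      killingForm ℂ 𝔤 T.grading (T.basis j) := by
    intro j
    by_cases h : T.deg j = 0
    · rw [T.gradingDual_apply, T.toCartan_basis_of_eq h]
    · rw [T.toCartan_basis_of_ne h, map_zero, ← T.killingDual_repr]
      -- By invariance `deg j` times the pairing of `grading` with `basis j` is the pairing of
      -- `[grading, grading] = 0` with `basis j`, up to sign.
      have h3 : (T.killingDual.repr T.grading j) * T.wt j T.grading = 0 := by
        rw [T.killingDual_repr, ← smul_eq_mul, smul_eq_mul, mul_comm, ← smul_eq_mul, ← map_smul,
          ← T.lie_basis, ← neg_eq_zero, ← killingForm_lie, lie_self, map_zero,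
          LinearMap.zero_apply]
      rw [T.wt_grading, mul_eq_zero] at h3
      exact (h3.resolve_right (by exact_mod_cast h)).symm
  conv_rhs => rw [h1]
  rw [map_sum, map_sum]
  refine Finset.sum_congr rfl fun j _ => ?_
  rw [map_smul, map_smul, smul_eq_mul, h2]

/-- The scalar is a quadratic form plus a linear form. The polar form of the quadratic part pairs
`μ` with `gradingDual` to give `μ(grading)` twice, and the remaining terms in `t` do not involve
`μ`. -/
theorem casimirScalar_add_smul (μ : Dual ℂ H) (t : ℂ) :
    T.casimirScalar (μ + t • T.gradingDual) = T.casimirScalar μ + 2 * t * μ T.grading +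
      (t ^ 2 * ∑ j, T.gradingDual (T.toCartan (T.basis j)) *
        T.gradingDual (T.toCartan (T.killingDual j)) +
      t * ∑ j, if 0 < T.deg j then T.gradingDual (T.toCartan ⁅T.basis j, T.killingDual j⁆)
        else 0) := by
  have e : 2 * t * μ T.grading = t * (∑ j, μ (T.toCartan (T.basis j)) *
      T.gradingDual (T.toCartan (T.killingDual j))) +
      t * ∑ j, T.gradingDual (T.toCartan (T.basis j)) * μ (T.toCartan (T.killingDual j)) := by
    rw [T.sum_mul_gradingDual, T.sum_gradingDual_mul]; ring
  rw [e, casimirScalar, casimirScalar]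
  simp only [Finset.mul_sum, ← Finset.sum_add_distrib]
  refine Finset.sum_congr rfl fun j _ => ?_
  simp only [LinearMap.add_apply, LinearMap.smul_apply, smul_eq_mul]
  split_ifs <;> ring

/-- The source of every choice of large `t`: when `μ` and `ψ` differ at `grading`, the two scalars
agree for at most one `t`. -/
theorem casimirScalar_sub (μ ψ : Dual ℂ H) (t : ℂ) :
    T.casimirScalar (μ + t • T.gradingDual) - T.casimirScalar (ψ + t • T.gradingDual) =
      T.casimirScalar μ - T.casimirScalar ψ + 2 * t * (μ - ψ) T.grading := by
  rw [casimirScalar_add_smul, casimirScalar_add_smul, LinearMap.sub_apply]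
  ring

end TriangularBasis

/-! ### The Verma module as a module structure on the enveloping algebra of the negative part -/

section EnvelopingInduction

attribute [local instance 100] LieRing.ofAssociativeRing

variable {R L : Type*} [CommRing R] [LieRing L] [LieAlgebra R L]

/-- By the universal property, the map to the subalgebra `S` induced by `L → S`, followed by the
inclusion of `S`, is the identity. -/
theorem UniversalEnvelopingAlgebra.adjoin_range_ι :
    Algebra.adjoin R (Set.range (UniversalEnvelopingAlgebra.ι R : L → _)) = ⊤ := by
  let S := Algebra.adjoin R (Set.range (UniversalEnvelopingAlgebra.ι R : L → _))
  let f : L →ₗ⁅R⁆ S :=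
    { toFun := fun x => ⟨UniversalEnvelopingAlgebra.ι R x, Algebra.subset_adjoin ⟨x, rfl⟩⟩
      map_add' := fun x y => Subtype.ext (map_add _ x y)
      map_smul' := fun c x => Subtype.ext (map_smul _ c x)
      map_lie' := fun {x y} => Subtype.ext (LieHom.map_lie _ x y) }
  have h : S.val.comp (UniversalEnvelopingAlgebra.lift R f) = AlgHom.id R _ := by
    ext x
    change S.val (UniversalEnvelopingAlgebra.lift R f (UniversalEnvelopingAlgebra.ι R x)) =
      UniversalEnvelopingAlgebra.ι R x
    rw [UniversalEnvelopingAlgebra.lift_ι_apply]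
    rfl
  refine eq_top_iff.2 fun u _ => ?_
  rw [← AlgHom.id_apply (R := R) u, ← h]
  exact (UniversalEnvelopingAlgebra.lift R f u).2

/-- The enveloping algebra is spanned by the products of elements of the Lie algebra. -/
theorem UniversalEnvelopingAlgebra.mem_of_forall_ι_mul_mem
    (S : Submodule R (UniversalEnvelopingAlgebra R L)) (h1 : 1 ∈ S)
    (hS : ∀ x : L, ∀ u ∈ S, UniversalEnvelopingAlgebra.ι R x * u ∈ S)
    (u : UniversalEnvelopingAlgebra R L) : u ∈ S := by
  let A : Subalgebra R (UniversalEnvelopingAlgebra R L) :=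
    { carrier := {a | ∀ u ∈ S, a * u ∈ S}
      mul_mem' := fun ha hb u hu => by rw [mul_assoc]; exact ha _ (hb u hu)
      add_mem' := fun ha hb u hu => by rw [add_mul]; exact S.add_mem (ha u hu) (hb u hu)
      algebraMap_mem' := fun r u hu => by
        rw [← Algebra.smul_def]; exact S.smul_mem r hu }
  have hA : (⊤ : Subalgebra R (UniversalEnvelopingAlgebra R L)) ≤ A := by
    rw [← UniversalEnvelopingAlgebra.adjoin_range_ι, Algebra.adjoin_le_iff]
    rintro _ ⟨x, rfl⟩
    exact hS x
  have := hA (Algebra.mem_top (x := u)) 1 h1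
  rwa [mul_one] at this

end EnvelopingInduction

namespace TriangularBasis

attribute [local instance 100] LieRing.ofAssociativeRing

variable {𝔤 : Type*} [LieRing 𝔤] [LieAlgebra ℂ 𝔤] {H : LieSubalgebra ℂ 𝔤} {J : Type*}
  (T : TriangularBasis H J)

/-- The subalgebra spanned by the basis vectors of negative degree. -/
noncomputable def negPart : LieSubalgebra ℂ 𝔤 where
  carrier := {x | ∀ j, 0 ≤ T.deg j → T.basis.repr x j = 0}
  add_mem' := fun ha hb j hj => by simp [ha j hj, hb j hj]
  zero_mem' := fun j _ => by simp
  smul_mem' := fun c x hx j hj => by simp [hx j hj]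
  lie_mem' := by
    intro x y hx hy
    let S : Submodule ℂ 𝔤 :=
      { carrier := {x | ∀ j, 0 ≤ T.deg j → T.basis.repr x j = 0}
        add_mem' := fun ha hb j hj => by simp [ha j hj, hb j hj]
        zero_mem' := fun j _ => by simp
        smul_mem' := fun c x hx j hj => by simp [hx j hj] }
    refine T.lie_mem_of_basis (S := S) fun i hi => ?_
    rw [← lie_skew]
    refine S.neg_mem (T.lie_mem_of_basis (S := S) fun j hj => ?_)
    have hi' : T.deg i < 0 := by
      by_contra h
      exact hi (hx i (not_lt.1 h))
    have hj' : T.deg j < 0 := by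
      by_contra h
      exact hj (hy j (not_lt.1 h))
    intro k hk
    refine T.repr_eq_zero (lie_mem_weightVectors (T.basis_mem j) (T.basis_mem i)) fun hc => ?_
    have h2 := LinearMap.congr_fun hc T.grading
    rw [T.wt_grading, LinearMap.add_apply, T.wt_grading, T.wt_grading] at h2
    have h3 : T.deg k = T.deg i + T.deg j := by exact_mod_cast h2
    omega

theorem basis_mem_negPart {j : J} (hj : T.deg j < 0) : T.basis j ∈ T.negPart := by
  intro i hi
  have : j ≠ i := by rintro rfl; omega
  simp [Finsupp.single_eq_of_ne' this]

theorem mem_of_basis {S : Submodule ℂ 𝔤} {x : 𝔤} (h : ∀ j, T.basis.repr x j ≠ 0 → T.basis j ∈ S) :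
    x ∈ S := by
  rw [← T.basis.linearCombination_repr x, Finsupp.linearCombination_apply, Finsupp.sum]
  exact S.sum_mem fun j hj => S.smul_mem _ (h j (Finsupp.mem_support_iff.1 hj))

/-- The enveloping algebra of the negative part. -/
abbrev NegEnveloping : Type _ := UniversalEnvelopingAlgebra ℂ T.negPart

open Classical in
/-- The action of `𝔤` on the highest weight vector. -/
noncomputable def vermaBase (ν : Dual ℂ H) : 𝔤 →ₗ[ℂ] T.NegEnveloping :=
  T.basis.constr ℂ fun j =>
    if h : T.deg j < 0 then UniversalEnvelopingAlgebra.ι ℂ ⟨T.basis j, T.basis_mem_negPart h⟩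
    else ν (T.toCartan (T.basis j)) • 1

theorem vermaBase_neg (ν : Dual ℂ H) (x : T.negPart) :
    T.vermaBase ν x = UniversalEnvelopingAlgebra.ι ℂ x := by
  obtain ⟨x, hx⟩ := x
  change T.vermaBase ν x = _
  have key : (⟨x, hx⟩ : T.negPart) = ∑ j ∈ (T.basis.repr x).support,
      if h : T.deg j < 0 then T.basis.repr x j • (⟨T.basis j, T.basis_mem_negPart h⟩ : T.negPart)
      else 0 := by
    refine Subtype.ext ?_
    rw [AddSubmonoidClass.coe_finsetSum]
    change x = _
    conv_lhs => rw [← T.basis.linearCombination_repr x, Finsupp.linearCombination_apply,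
      Finsupp.sum]
    refine Finset.sum_congr rfl fun j hj => ?_
    have : T.deg j < 0 := by
      by_contra hc
      exact Finsupp.mem_support_iff.1 hj (hx j (not_lt.1 hc))
    simp [this]
  rw [key, vermaBase, Basis.constr_apply, map_sum, Finsupp.sum]
  refine Finset.sum_congr rfl fun j hj => ?_
  have : T.deg j < 0 := by
    by_contra hc
    exact Finsupp.mem_support_iff.1 hj (hx j (not_lt.1 hc))
  rw [dif_pos this, dif_pos this, map_smul]

theorem vermaBase_basis_pos (ν : Dual ℂ H) {j : J} (hj : 0 < T.deg j) :
    T.vermaBase ν (T.basis j) = 0 := by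
  rw [vermaBase, Basis.constr_basis, dif_neg hj.not_gt, T.toCartan_basis_of_ne hj.ne', map_zero,
    zero_smul]

theorem vermaBase_nonneg (ν : Dual ℂ H) {j : J} (hj : 0 ≤ T.deg j) :
    T.vermaBase ν (T.basis j) = ν (T.toCartan (T.basis j)) • 1 := by
  rw [vermaBase, Basis.constr_basis, dif_neg hj.not_gt]

/-- The action of the negative part on `Hom(𝔤, U(𝔫⁻))`. -/
noncomputable def negAction : T.negPart →ₗ⁅ℂ⁆ Module.End ℂ (𝔤 →ₗ[ℂ] T.NegEnveloping) where
  toFun f :=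
    { toFun := fun F => LinearMap.mulLeft ℂ (UniversalEnvelopingAlgebra.ι ℂ f) ∘ₗ F -
        F ∘ₗ (ad ℂ 𝔤 (f : 𝔤) : 𝔤 →ₗ[ℂ] 𝔤)
      map_add' := fun F G => by ext x; simp [mul_add]; abel
      map_smul' := fun c F => by ext x; simp [smul_sub] }
  map_add' f g := by ext F x; simp [add_mul]; abel
  map_smul' c f := by ext F x; simp [smul_sub]
  map_lie' := by
    intro f g
    ext F x
    rw [LieRing.of_associative_ring_bracket]
    simp only [LinearMap.sub_apply, Module.End.mul_apply, LinearMap.coe_mk, AddHom.coe_mk,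
      LinearMap.comp_apply, LinearMap.mulLeft_apply, LieHom.map_lie, LieAlgebra.ad_apply,
      LieSubalgebra.coe_bracket, LieRing.of_associative_ring_bracket, map_sub, sub_mul, mul_assoc]
    abel

/-- The action of `𝔤` on the Verma module, as a map in the first variable. -/
noncomputable def vermaAction (ν : Dual ℂ H) : T.NegEnveloping →ₗ[ℂ] 𝔤 →ₗ[ℂ] T.NegEnveloping :=
  -- Letting `u` act on the base map encodes the recursion on `u` of `vermaAction_mul`. It is well
  -- defined because `negAction` is a representation, so no basis of `U(𝔫⁻)` is needed.
  LinearMap.applyₗ (T.vermaBase ν) ∘ₗ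
    (UniversalEnvelopingAlgebra.lift ℂ T.negAction).toLinearMap

theorem vermaAction_one (ν : Dual ℂ H) (x : 𝔤) : T.vermaAction ν 1 x = T.vermaBase ν x := by
  change UniversalEnvelopingAlgebra.lift ℂ T.negAction 1 (T.vermaBase ν) x = _
  rw [map_one]
  rfl

/-- This is the rule `x f u = f x u + [x, f] u` forced in any `𝔤`-module; together with the values
at `u = 1` it determines the action. -/
theorem vermaAction_mul (ν : Dual ℂ H) (f : T.negPart) (u : T.NegEnveloping) (x : 𝔤) :
    T.vermaAction ν (UniversalEnvelopingAlgebra.ι ℂ f * u) x =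
      UniversalEnvelopingAlgebra.ι ℂ f * T.vermaAction ν u x + T.vermaAction ν u ⁅x, (f : 𝔤)⁆ := by
  change UniversalEnvelopingAlgebra.lift ℂ T.negAction (UniversalEnvelopingAlgebra.ι ℂ f * u)
    (T.vermaBase ν) x = _
  rw [map_mul, UniversalEnvelopingAlgebra.lift_ι_apply, ← lie_skew x (f : 𝔤), map_neg,
    ← sub_eq_add_neg]
  rfl

/-- Consistency of the recursion with left multiplication. It makes the module free over `U(𝔫⁻)`, so
that `𝔫⁻`-maps out of it are given by arbitrary vectors. -/
theorem vermaAction_neg (ν : Dual ℂ H) (f : T.negPart) (u : T.NegEnveloping) :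
    T.vermaAction ν u f = UniversalEnvelopingAlgebra.ι ℂ f * u := by
  let S : Submodule ℂ T.NegEnveloping :=
    { carrier := {u | ∀ f : T.negPart, T.vermaAction ν u f = UniversalEnvelopingAlgebra.ι ℂ f * u}
      add_mem' := fun ha hb f => by rw [map_add, LinearMap.add_apply, ha f, hb f, mul_add]
      zero_mem' := fun f => by simp
      smul_mem' := fun c u hu f => by
        rw [map_smul, LinearMap.smul_apply, hu f, mul_smul_comm] }
  refine UniversalEnvelopingAlgebra.mem_of_forall_ι_mul_mem S ?_ ?_ u f
  · intro f
    rw [vermaAction_one, vermaBase_neg, mul_one]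
  · intro g u hu f
    rw [vermaAction_mul, hu f, ← LieSubalgebra.coe_bracket, hu, LieHom.map_lie,
      LieRing.of_associative_ring_bracket, sub_mul, mul_assoc, mul_assoc]
    abel

/-- Induction on `u`; passing from `u` to `f u` is the Jacobi identity. At `u = 1` a negative
argument is handled by the recursion, and on nonnegative degrees the action on 1 is by a character.
-/
theorem vermaAction_lie (ν : Dual ℂ H) (u : T.NegEnveloping) (x y : 𝔤) :
    T.vermaAction ν u ⁅x, y⁆ =
      T.vermaAction ν (T.vermaAction ν u y) x - T.vermaAction ν (T.vermaAction ν u x) y := by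
  let S : Submodule ℂ T.NegEnveloping :=
    { carrier := {u | ∀ x y : 𝔤, T.vermaAction ν u ⁅x, y⁆ =
        T.vermaAction ν (T.vermaAction ν u y) x - T.vermaAction ν (T.vermaAction ν u x) y}
      add_mem' := fun ha hb x y => by
        simp only [map_add, LinearMap.add_apply, ha x y, hb x y]
        abel
      zero_mem' := fun f => by simp
      smul_mem' := fun c u hu x y => by
        simp only [map_smul, LinearMap.smul_apply, hu x y, smul_sub] }
  refine UniversalEnvelopingAlgebra.mem_of_forall_ι_mul_mem S ?_ ?_ u x y
  · have hneg : ∀ (f : T.negPart) (x : 𝔤), T.vermaAction ν 1 ⁅x, (f : 𝔤)⁆ =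
        T.vermaAction ν (T.vermaAction ν 1 f) x - T.vermaAction ν (T.vermaAction ν 1 x) f := by
      intro f x
      rw [T.vermaAction_neg ν f, T.vermaAction_neg ν f, vermaAction_mul]
      abel
    have hbasis : ∀ i j, T.vermaAction ν 1 ⁅T.basis i, T.basis j⁆ =
        T.vermaAction ν (T.vermaAction ν 1 (T.basis j)) (T.basis i) -
          T.vermaAction ν (T.vermaAction ν 1 (T.basis i)) (T.basis j) := by
      intro i j
      rcases lt_or_ge (T.deg j) 0 with hj | hj
      · exact hneg ⟨_, T.basis_mem_negPart hj⟩ _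
      · rcases lt_or_ge (T.deg i) 0 with hi | hi
        · rw [← lie_skew, map_neg, hneg ⟨_, T.basis_mem_negPart hi⟩, neg_sub]
        · simp only [vermaAction_one, T.vermaBase_nonneg ν hi, T.vermaBase_nonneg ν hj, map_smul,
            LinearMap.smul_apply]
          rw [smul_comm, sub_self]
          by_cases h0 : T.deg i = 0 ∧ T.deg j = 0
          · have := T.lie_eq_zero ⟨_, T.mem_of_deg_eq_zero i h0.1⟩
              ⟨_, T.mem_of_deg_eq_zero j h0.2⟩
            change ⁅T.basis i, T.basis j⁆ = 0 at this
            rw [this, map_zero]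
          -- If the two degrees are not both zero, the bracket has positive degree, where the
          -- character vanishes.
          · refine T.mem_of_basis (S := LinearMap.ker (T.vermaBase ν)) fun k hk =>
              T.vermaBase_basis_pos ν ?_
            have h1 : T.wt k = T.wt j + T.wt i := by
              by_contra hc
              exact hk (T.repr_eq_zero (lie_mem_weightVectors (T.basis_mem i) (T.basis_mem j)) hc)
            have h2 := LinearMap.congr_fun h1 T.grading
            rw [T.wt_grading, LinearMap.add_apply, T.wt_grading, T.wt_grading] at h2
            have h3 : T.deg k = T.deg j + T.deg i := by exact_mod_cast h2
            omega
    let D : 𝔤 →ₗ[ℂ] 𝔤 →ₗ[ℂ] T.NegEnveloping := LinearMap.mk₂ ℂ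
      (fun x y => T.vermaAction ν 1 ⁅x, y⁆ - (T.vermaAction ν (T.vermaAction ν 1 y) x -
          T.vermaAction ν (T.vermaAction ν 1 x) y))
      (fun x x' y => by simp only [add_lie, map_add, LinearMap.add_apply]; abel)
      (fun c x y => by simp only [smul_lie, map_smul, LinearMap.smul_apply, smul_sub])
      (fun x y y' => by simp only [lie_add, map_add, LinearMap.add_apply]; abel)
      (fun c x y => by simp only [lie_smul, map_smul, LinearMap.smul_apply, smul_sub])
    have hD : D = 0 := T.basis.ext fun i => T.basis.ext fun j => sub_eq_zero.2 (hbasis i j)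
    intro x y
    exact sub_eq_zero.1 (LinearMap.congr_fun (LinearMap.congr_fun hD x) y)
  · intro f u hu x y
    rw [vermaAction_mul, hu x y, vermaAction_mul, vermaAction_mul, map_add, map_add,
      LinearMap.add_apply, LinearMap.add_apply, vermaAction_mul, vermaAction_mul]
    have h1 := hu ⁅x, (f : 𝔤)⁆ y
    have h2 := hu x ⁅y, (f : 𝔤)⁆
    have h3 : ⁅⁅x, y⁆, (f : 𝔤)⁆ = ⁅⁅x, (f : 𝔤)⁆, y⁆ + ⁅x, ⁅y, (f : 𝔤)⁆⁆ := by
      rw [lie_lie, ← lie_skew y ⁅x, (f : 𝔤)⁆]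
      abel
    rw [h3, map_add, h1, h2, mul_sub]
    abel

/-- The representation of `𝔤` on the Verma module `U(𝔫⁻)`. -/
noncomputable def vermaRep (ν : Dual ℂ H) : 𝔤 →ₗ⁅ℂ⁆ Module.End ℂ T.NegEnveloping where
  toFun x := (T.vermaAction ν).flip x
  map_add' x y := map_add _ x y
  map_smul' c x := map_smul _ c x
  map_lie' {x y} := LinearMap.ext fun u => by
    rw [LieRing.of_associative_ring_bracket]
    exact T.vermaAction_lie ν u x y

theorem vermaRep_apply (ν : Dual ℂ H) (x : 𝔤) (u : T.NegEnveloping) :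
    T.vermaRep ν x u = T.vermaAction ν u x := rfl

/-- For any module `D` over `𝔤` and any `ξ ∈ D` there are a module generated by a singular vector
`z` of weight `ν` and a map from it to `D` compatible with the negative part and sending `z` to
`ξ`. -/
theorem exists_module_generated_by_singular (ν : Dual ℂ H) {D : Type*} [AddCommGroup D]
    [Module ℂ D] [LieRingModule 𝔤 D] [LieModule ℂ 𝔤 D] (ξ : D) :
    ∃ (ρ : 𝔤 →ₗ⁅ℂ⁆ Module.End ℂ T.NegEnveloping) (z : T.NegEnveloping)
      (θ : T.NegEnveloping →ₗ[ℂ] D),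
      (∀ j, 0 < T.deg j → ρ (T.basis j) z = 0) ∧ (∀ h : H, ρ h z = ν h • z) ∧
      (∀ S : Submodule ℂ T.NegEnveloping, z ∈ S → (∀ x, ∀ m ∈ S, ρ x m ∈ S) → S = ⊤) ∧
      (∀ j, T.deg j < 0 → ∀ m, θ (ρ (T.basis j) m) = ⁅T.basis j, θ m⁆) ∧ θ z = ξ := by
  let σ : T.negPart →ₗ⁅ℂ⁆ Module.End ℂ D := (LieModule.toEnd ℂ 𝔤 D).comp T.negPart.incl
  -- The map to `D` is `u ↦ u ξ`, with `U(𝔫⁻)` acting on `D` by restriction.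
  refine ⟨T.vermaRep ν, 1, LinearMap.applyₗ ξ ∘ₗ
    (UniversalEnvelopingAlgebra.lift ℂ σ).toLinearMap, ?_, ?_, ?_, ?_, ?_⟩
  · intro j hj
    rw [vermaRep_apply, vermaAction_one, T.vermaBase_basis_pos ν hj]
  · intro h
    rw [vermaRep_apply, vermaAction_one]
    have key : (h : 𝔤) ∈ LinearMap.eqLocus (T.vermaBase ν)
        ((LinearMap.toSpanSingleton ℂ T.NegEnveloping 1) ∘ₗ ν ∘ₗ T.toCartan) := by
      refine T.mem_of_basis fun j hj => ?_
      have h0 : T.deg j = 0 := by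
        refine T.deg_eq_zero_of_wt ?_
        by_contra hc
        exact hj (T.repr_eq_zero (T.mem_zero_weightVectors h) hc)
      exact T.vermaBase_nonneg ν h0.ge
    have key' : T.vermaBase ν h = ν (T.toCartan h) • 1 := key
    rw [key', T.toCartan_coe]
  · intro S h1 hS
    refine eq_top_iff.2 fun u _ => ?_
    refine UniversalEnvelopingAlgebra.mem_of_forall_ι_mul_mem S h1 (fun f u hu => ?_) u
    rw [← T.vermaAction_neg ν]
    exact hS f u hu
  · intro j hj m
    rw [vermaRep_apply, T.vermaAction_neg ν ⟨_, T.basis_mem_negPart hj⟩]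
    change UniversalEnvelopingAlgebra.lift ℂ σ (_ * m) ξ = _
    rw [map_mul, UniversalEnvelopingAlgebra.lift_ι_apply]
    rfl
  · change UniversalEnvelopingAlgebra.lift ℂ σ 1 ξ = ξ
    rw [map_one]
    rfl

end TriangularBasis

/-! ### Simple highest weight modules -/

section EnvelopingModule

attribute [local instance 100] LieRing.ofAssociativeRing

variable (R L : Type*) [CommRing R] [LieRing L] [LieAlgebra R L]
variable (M : Type*) [AddCommGroup M] [Module R M]

/-- The Lie module attached to a module over the enveloping algebra. -/
abbrev UniversalEnvelopingAlgebra.lieRingModule [Module (UniversalEnvelopingAlgebra R L) M] :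
    LieRingModule L M where
  bracket x w := UniversalEnvelopingAlgebra.ι R x • w
  add_lie x y w := by
    rw [map_add, add_smul]
  lie_add x w w' := smul_add _ w w'
  leibniz_lie x y w := by
    change _ • _ • w = UniversalEnvelopingAlgebra.ι R ⁅x, y⁆ • w + _ • _ • w
    rw [LieHom.map_lie, LieRing.of_associative_ring_bracket, sub_smul, mul_smul, mul_smul,
      sub_add_cancel]

theorem UniversalEnvelopingAlgebra.lieModule [Module (UniversalEnvelopingAlgebra R L) M]
    [IsScalarTower R (UniversalEnvelopingAlgebra R L) M] :
    letI := UniversalEnvelopingAlgebra.lieRingModule R L M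
    LieModule R L M :=
  letI := UniversalEnvelopingAlgebra.lieRingModule R L M
  { smul_lie := fun c x w => by
      change UniversalEnvelopingAlgebra.ι R (c • x) • w = c • (UniversalEnvelopingAlgebra.ι R x • w)
      rw [map_smul, smul_assoc]
    lie_smul := fun c x w => by
      change UniversalEnvelopingAlgebra.ι R x • (c • w) = c • (UniversalEnvelopingAlgebra.ι R x • w)
      rw [← algebraMap_smul (UniversalEnvelopingAlgebra R L) c w,
        ← algebraMap_smul (UniversalEnvelopingAlgebra R L) c (_ • w), ← mul_smul, ← mul_smul,
        Algebra.commutes] }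

/-- The module over the enveloping algebra attached to a Lie module. -/
noncomputable abbrev LieModule.envelopingModule [LieRingModule L M] [LieModule R L M] :
    Module (UniversalEnvelopingAlgebra R L) M :=
  Module.compHom M (UniversalEnvelopingAlgebra.lift R (LieModule.toEnd R L M)).toRingHom

end EnvelopingModule

section Verma

variable {𝔤 : Type*} [LieRing 𝔤] [LieAlgebra ℂ 𝔤] [FiniteDimensional ℂ 𝔤]
  [LieAlgebra.IsSemisimple ℂ 𝔤] {H : LieSubalgebra ℂ 𝔤} [H.IsCartanSubalgebra] {J : Type*}

/-- The basis vectors of positive degree span the sum of the positive root spaces. -/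
structure TriangularBasis.Compatible (T : TriangularBasis H J) (b : (rootSystem H).Base) :
    Prop where
  mem_rootSpace : ∀ j, 0 < T.deg j → ∃ α : H.root, (rootSystem H).root α ∈ positiveRootCone b ∧
    T.basis j ∈ rootSpace H (α : LieModule.Weight ℂ H 𝔤)
  pos_of_repr : ∀ α : H.root, (rootSystem H).root α ∈ positiveRootCone b →
    ∀ x ∈ rootSpace H (α : LieModule.Weight ℂ H 𝔤), ∀ j, T.basis.repr x j ≠ 0 → 0 < T.deg j

variable {T : TriangularBasis H J} {b : (rootSystem H).Base}

theorem vermaIdeal_ι_mem (hT : T.Compatible b) (μ : Dual ℂ H) {j : J} (hj : 0 < T.deg j) :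
    UniversalEnvelopingAlgebra.ι ℂ (T.basis j) ∈ vermaIdeal b μ := by
  obtain ⟨α, hα, hx⟩ := hT.mem_rootSpace j hj
  exact Submodule.subset_span (Or.inl ⟨α, hα, _, hx, rfl⟩)

theorem vermaIdeal_ι_sub_mem (b : (rootSystem H).Base) (μ : Dual ℂ H) (h : H) :
    UniversalEnvelopingAlgebra.ι ℂ (h : 𝔤) - algebraMap ℂ _ (μ h) ∈ vermaIdeal b μ :=
  Submodule.subset_span (Or.inr ⟨h, rfl⟩)

/-- The highest weight vector of a Verma module. -/
def VermaModule.vector (b : (rootSystem H).Base) (μ : Dual ℂ H) : VermaModule b μ :=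
  (vermaIdeal b μ).mkQ 1

theorem VermaModule.ι_smul_vector (hT : T.Compatible b) (μ : Dual ℂ H) {j : J}
    (hj : 0 < T.deg j) : UniversalEnvelopingAlgebra.ι ℂ (T.basis j) • vector b μ = 0 := by
  rw [vector, ← map_smul, smul_eq_mul, mul_one]
  exact (Submodule.Quotient.mk_eq_zero _).2 (vermaIdeal_ι_mem hT μ hj)

theorem VermaModule.ι_smul_vector_cartan (b : (rootSystem H).Base) (μ : Dual ℂ H) (h : H) :
    UniversalEnvelopingAlgebra.ι ℂ (h : 𝔤) • vector b μ = μ h • vector b μ := by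
  rw [vector, ← map_smul, ← algebraMap_smul (UniversalEnvelopingAlgebra ℂ 𝔤) (μ h), ← map_smul,
    smul_eq_mul, smul_eq_mul, mul_one, mul_one, ← sub_eq_zero, ← map_sub]
  exact (Submodule.Quotient.mk_eq_zero _).2 (vermaIdeal_ι_sub_mem b μ h)

theorem VermaModule.exists_smul_vector (b : (rootSystem H).Base) (μ : Dual ℂ H)
    (m : VermaModule b μ) : ∃ u : UniversalEnvelopingAlgebra ℂ 𝔤, m = u • vector b μ := by
  obtain ⟨u, rfl⟩ := (vermaIdeal b μ).mkQ_surjective m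
  exact ⟨u, by rw [vector, ← map_smul, smul_eq_mul, mul_one]⟩

/-- Each proper submodule lies in the lower part, hence so does their sum, and the sum is still
proper. -/
theorem VermaModule.vector_notMem_vermaMaximal (hT : T.Compatible b) (μ : Dual ℂ H)
    (h0 : VermaModule.vector b μ ≠ 0) : VermaModule.vector b μ ∉ vermaMaximal b μ := by
  let := UniversalEnvelopingAlgebra.lieRingModule ℂ 𝔤 (VermaModule b μ)
  have : LieModule ℂ 𝔤 (VermaModule b μ) := UniversalEnvelopingAlgebra.lieModule ℂ 𝔤 _
  have hsing : T.IsSingular μ (vector b μ) :=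
    ⟨fun j hj => ι_smul_vector hT μ hj, fun h => ι_smul_vector_cartan b μ h⟩
  have hgen : TriangularBasis.Generates 𝔤 (vector b μ) := by
    intro N hN
    refine eq_top_iff.2 fun m _ => ?_
    obtain ⟨u, rfl⟩ := exists_smul_vector b μ m
    let f : UniversalEnvelopingAlgebra ℂ 𝔤 →ₗ[ℂ] VermaModule b μ :=
      (LinearMap.toSpanSingleton (UniversalEnvelopingAlgebra ℂ 𝔤) _ (vector b μ)).restrictScalars ℂ
    refine UniversalEnvelopingAlgebra.mem_of_forall_ι_mul_mem (N.toSubmodule.comap f) ?_ ?_ u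
    · change (1 : UniversalEnvelopingAlgebra ℂ 𝔤) • vector b μ ∈ N
      rwa [one_smul]
    · intro x u hu
      change (_ * u) • vector b μ ∈ N
      rw [mul_smul]
      exact N.lie_mem hu
  have hle : (vermaMaximal b μ).restrictScalars ℂ ≤ T.lowerPart (VermaModule b μ) μ := by
    have h1 : (vermaMaximal b μ).restrictScalars ℂ =
        sSup (Submodule.restrictScalarsLatticeHom ℂ (UniversalEnvelopingAlgebra ℂ 𝔤)
          (VermaModule b μ) '' {N | N ≠ ⊤}) :=
      map_sSup (Submodule.restrictScalarsLatticeHom ℂ (UniversalEnvelopingAlgebra ℂ 𝔤)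
        (VermaModule b μ)) _
    rw [h1]
    refine sSup_le ?_
    rintro _ ⟨N, hN, rfl⟩
    let N' : LieSubmodule ℂ 𝔤 (VermaModule b μ) :=
      { N.restrictScalars ℂ with lie_mem := fun {x m} hm => N.smul_mem _ hm }
    refine hsing.le_lowerPart hgen (N := N') fun hc => hN ?_
    refine eq_top_iff.2 fun m _ => ?_
    have : m ∈ N' := by rw [hc]; trivial
    exact this
  exact fun h => hsing.notMem_lowerPart h0 (hle h)

namespace SimpleHighestWeightModule

/-- The highest weight vector of `V(μ)`. -/
def vector (b : (rootSystem H).Base) (μ : Dual ℂ H) : SimpleHighestWeightModule b μ :=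
  (vermaMaximal b μ).mkQ (VermaModule.vector b μ)

theorem isSingular_vector (hT : T.Compatible b) (μ : Dual ℂ H) :
    T.IsSingular μ (vector b μ) where
  pos j hj := by
    change (vermaMaximal b μ).mkQ
      (UniversalEnvelopingAlgebra.ι ℂ (T.basis j) • VermaModule.vector b μ) = 0
    rw [VermaModule.ι_smul_vector hT μ hj, map_zero]
  weight h := by
    change (vermaMaximal b μ).mkQ
      (UniversalEnvelopingAlgebra.ι ℂ (h : 𝔤) • VermaModule.vector b μ) = _
    rw [VermaModule.ι_smul_vector_cartan]
    rfl

theorem exists_smul_vector {μ : Dual ℂ H} (m : SimpleHighestWeightModule b μ) :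
    ∃ u : UniversalEnvelopingAlgebra ℂ 𝔤, m = u • vector b μ := by
  obtain ⟨m, rfl⟩ := (vermaMaximal b μ).mkQ_surjective m
  obtain ⟨u, rfl⟩ := VermaModule.exists_smul_vector b μ m
  exact ⟨u, rfl⟩

theorem generates_vector (b : (rootSystem H).Base) (μ : Dual ℂ H) :
    TriangularBasis.Generates 𝔤 (vector b μ) := by
  intro N hN
  refine eq_top_iff.2 fun m _ => ?_
  obtain ⟨u, rfl⟩ := exists_smul_vector m
  let f : UniversalEnvelopingAlgebra ℂ 𝔤 →ₗ[ℂ] SimpleHighestWeightModule b μ :=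
    (LinearMap.toSpanSingleton (UniversalEnvelopingAlgebra ℂ 𝔤) _ (vector b μ)).restrictScalars ℂ
  refine UniversalEnvelopingAlgebra.mem_of_forall_ι_mul_mem (N.toSubmodule.comap f) ?_ ?_ u
  · change (1 : UniversalEnvelopingAlgebra ℂ 𝔤) • vector b μ ∈ N
    rwa [one_smul]
  · intro x u hu
    change (_ * u) • vector b μ ∈ N
    rw [mul_smul]
    exact N.lie_mem hu

/-- A submodule of `V(μ)` not containing the highest weight vector is zero. -/
theorem eq_bot_of_vector_notMem {μ : Dual ℂ H}
    (N : LieSubmodule ℂ 𝔤 (SimpleHighestWeightModule b μ)) (hN : vector b μ ∉ N) : N = ⊥ := by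
  have hsmul : ∀ (u : UniversalEnvelopingAlgebra ℂ 𝔤), ∀ m ∈ N, u • m ∈ N := by
    intro u m hm
    let f : UniversalEnvelopingAlgebra ℂ 𝔤 →ₗ[ℂ] SimpleHighestWeightModule b μ :=
      (LinearMap.toSpanSingleton (UniversalEnvelopingAlgebra ℂ 𝔤) _ m).restrictScalars ℂ
    refine UniversalEnvelopingAlgebra.mem_of_forall_ι_mul_mem (N.toSubmodule.comap f) ?_ ?_ u
    · change (1 : UniversalEnvelopingAlgebra ℂ 𝔤) • m ∈ N
      rwa [one_smul]
    · intro x u hu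
      change (_ * u) • m ∈ N
      rw [mul_smul]
      exact N.lie_mem hu
  let N' : Submodule (UniversalEnvelopingAlgebra ℂ 𝔤) (VermaModule b μ) :=
    { carrier := {m | ((vermaMaximal b μ).mkQ m : SimpleHighestWeightModule b μ) ∈ N}
      add_mem' := fun {a b} ha hb => by
        change _ ∈ N
        rw [map_add]
        exact N.add_mem ha hb
      zero_mem' := by
        change _ ∈ N
        rw [map_zero]
        exact N.zero_mem
      smul_mem' := fun u m hm => by
        change _ ∈ N
        rw [map_smul]
        exact hsmul u _ hm }
  have hle : N' ≤ vermaMaximal b μ := by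
    refine le_sSup (show N' ≠ ⊤ from fun hc => hN ?_)
    have : VermaModule.vector b μ ∈ N' := by rw [hc]; trivial
    exact this
  refine (LieSubmodule.eq_bot_iff _).2 fun m hm => ?_
  obtain ⟨m, rfl⟩ := (vermaMaximal b μ).mkQ_surjective m
  exact (Submodule.Quotient.mk_eq_zero _).2 (hle hm)

/-- Every nonzero highest weight module of highest weight `μ` surjects onto `V(μ)`. -/
theorem exists_lieModuleHom (hT : T.Compatible b) {μ : Dual ℂ H} {Y : Type*} [AddCommGroup Y]
    [Module ℂ Y] [LieRingModule 𝔤 Y] [LieModule ℂ 𝔤 Y] {y : Y} (hy : T.IsSingular μ y)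
    (hg : TriangularBasis.Generates 𝔤 y) (hy0 : y ≠ 0) :
    vector b μ ≠ 0 ∧ ∃ f : Y →ₗ⁅ℂ, 𝔤⁆ SimpleHighestWeightModule b μ, f y = vector b μ := by
  let := LieModule.envelopingModule ℂ 𝔤 Y
  have hι : ∀ (x : 𝔤) (m : Y), UniversalEnvelopingAlgebra.ι ℂ x • m = ⁅x, m⁆ := by
    intro x m
    change UniversalEnvelopingAlgebra.lift ℂ (LieModule.toEnd ℂ 𝔤 Y) (UniversalEnvelopingAlgebra.ι ℂ x) m = _
    rw [UniversalEnvelopingAlgebra.lift_ι_apply]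
    rfl
  have halg : ∀ (c : ℂ) (m : Y),
      algebraMap ℂ (UniversalEnvelopingAlgebra ℂ 𝔤) c • m = c • m := by
    intro c m
    change UniversalEnvelopingAlgebra.lift ℂ (LieModule.toEnd ℂ 𝔤 Y) (algebraMap ℂ _ c) m = _
    rw [AlgHom.commutes]
    rfl
  have hker : vermaIdeal b μ ≤
      LinearMap.ker (LinearMap.toSpanSingleton (UniversalEnvelopingAlgebra ℂ 𝔤) Y y) := by
    refine Submodule.span_le.2 ?_
    rintro u (⟨α, hα, x, hx, rfl⟩ | ⟨h, rfl⟩)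
    · change UniversalEnvelopingAlgebra.ι ℂ x • y = 0
      rw [hι]
      exact T.lie_mem_of_basis (S := ⊥) fun j hj => hy.pos j (hT.pos_of_repr α hα x hx j hj)
    · change (UniversalEnvelopingAlgebra.ι ℂ (h : 𝔤) - algebraMap ℂ _ (μ h)) • y = 0
      rw [sub_smul, hι, halg, hy.weight, sub_self]
  let q : VermaModule b μ →ₗ[UniversalEnvelopingAlgebra ℂ 𝔤] Y := (vermaIdeal b μ).liftQ _ hker
  have hq1 : q (VermaModule.vector b μ) = y := by
    change (1 : UniversalEnvelopingAlgebra ℂ 𝔤) • y = y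
    rw [one_smul]
  have hq : Function.Surjective q := by
    let R : LieSubmodule ℂ 𝔤 Y :=
      { carrier := LinearMap.range q
        add_mem' := fun ha hb => Submodule.add_mem _ ha hb
        zero_mem' := Submodule.zero_mem _
        smul_mem' := fun c m hm => by
          rw [← halg]; exact Submodule.smul_mem _ _ hm
        lie_mem := fun {x m} hm => by
          change ⁅x, m⁆ ∈ LinearMap.range q
          rw [← hι]; exact Submodule.smul_mem _ _ hm }
    have hR : R = ⊤ := hg R ⟨_, hq1⟩
    intro m
    have : m ∈ R := by rw [hR]; trivial
    exact this
  -- The kernel of the Verma module's map onto `Y` misses the highest weight vector, so it is proper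
  -- and the simple quotient factors through `Y`.
  have hqmax : LinearMap.ker q ≤ vermaMaximal b μ := by
    refine le_sSup (show LinearMap.ker q ≠ ⊤ from fun hc => hy0 ?_)
    have : VermaModule.vector b μ ∈ LinearMap.ker q := by rw [hc]; trivial
    rwa [LinearMap.mem_ker, hq1] at this
  let π : (VermaModule b μ ⧸ LinearMap.ker q) →ₗ[UniversalEnvelopingAlgebra ℂ 𝔤]
      SimpleHighestWeightModule b μ :=
    (LinearMap.ker q).liftQ (vermaMaximal b μ).mkQ
      fun m hm => (Submodule.Quotient.mk_eq_zero _).2 (hqmax hm)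
  let g : Y →ₗ[UniversalEnvelopingAlgebra ℂ 𝔤] SimpleHighestWeightModule b μ :=
    π ∘ₗ (q.quotKerEquivOfSurjective hq).symm.toLinearMap
  have hg1 : g y = vector b μ := by
    have : (q.quotKerEquivOfSurjective hq).symm y =
        (LinearMap.ker q).mkQ (VermaModule.vector b μ) := by
      rw [LinearEquiv.symm_apply_eq]
      exact hq1.symm
    exact congrArg π this
  -- Given by generators and relations, the Verma module might a priori be zero; the nonzero `y`
  -- rules this out.
  refine ⟨fun h0 => ?_, ⟨{ toFun := g, map_add' := map_add g, map_smul' := ?_, map_lie' := ?_ }, hg1⟩⟩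
  · refine VermaModule.vector_notMem_vermaMaximal hT μ (fun h => hy0 ?_)
      ((Submodule.Quotient.mk_eq_zero _).1 h0)
    rw [← hq1, h, map_zero]
  · intro c m
    rw [RingHom.id_apply, ← halg, map_smul, algebraMap_smul]
  · intro x m
    change g ⁅x, m⁆ = UniversalEnvelopingAlgebra.ι ℂ x • g m
    rw [← hι, map_smul]

end SimpleHighestWeightModule

end Verma

/-! ### Maps out of simple highest weight modules -/

namespace TriangularBasis

variable {𝔤 : Type*} [LieRing 𝔤] [LieAlgebra ℂ 𝔤] {H : LieSubalgebra ℂ 𝔤} {J : Type*}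
  {T : TriangularBasis H J}
variable {M : Type*} [AddCommGroup M] [Module ℂ M] [LieRingModule 𝔤 M] [LieModule ℂ 𝔤 M]

theorem IsSingular.casimir_eq [IsKilling ℂ 𝔤] [Fintype J] {μ : Dual ℂ H} {z : M}
    (hz : T.IsSingular μ z) : T.casimir M z = T.casimirScalar μ • z := by
  have := T.casimir_sub_mem (⊥ : LieSubmodule ℂ 𝔤 M)
    (fun j hj => by rw [hz.pos j hj]; exact zero_mem _) hz.weight
  exact sub_eq_zero.1 this

theorem IsSingular.casimir_eq_of_generates [IsKilling ℂ 𝔤] [Fintype J] {μ : Dual ℂ H} {z : M}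
    (hz : T.IsSingular μ z) (hg : Generates 𝔤 z) (m : M) :
    T.casimir M m = T.casimirScalar μ • m := by
  let N : LieSubmodule ℂ 𝔤 M :=
    { LinearMap.ker (T.casimir M - T.casimirScalar μ • LinearMap.id) with
      lie_mem := fun {x m} hm => by
        have hm' : T.casimir M m - T.casimirScalar μ • m = 0 := hm
        change T.casimir M ⁅x, m⁆ - T.casimirScalar μ • ⁅x, m⁆ = 0
        rw [casimir_lie, ← lie_smul, ← lie_sub, hm', lie_zero] }
  have hN : N = ⊤ := hg N (sub_eq_zero.2 hz.casimir_eq)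
  have : m ∈ N := by rw [hN]; trivial
  exact sub_eq_zero.1 this

/-- A proper submodule of a highest weight module has no weight `ν + γ` of bounded depth if the
Casimir operator separates these weights from `ν`. -/
theorem IsSingular.eq_zero_of_depth_le [IsKilling ℂ 𝔤] [Fintype J] {ν : Dual ℂ H} {z : M}
    (hz : T.IsSingular ν z) (hg : Generates 𝔤 z) {N : LieSubmodule ℂ 𝔤 M} (hN : N ≠ ⊤) {K : ℕ}
    (hν : ∀ γ ∈ T.negCone, γ ≠ 0 → ∀ k : ℕ, k ≤ K → γ T.grading = -(k : ℂ) →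
      T.casimirScalar (ν + γ) ≠ T.casimirScalar ν) (k : ℕ) :
    k ≤ K → ∀ γ ∈ T.negCone, γ T.grading = -(k : ℂ) → ∀ m ∈ N, m ∈ weightVectors H M (ν + γ) →
      m = 0 := by
  induction k using Nat.strong_induction_on with
  | _ k ih =>
  intro hkK γ hγ hk m hmN hm
  by_cases h0 : γ = 0
  · rw [h0, add_zero] at hm
    refine eq_zero_of_mem_weightVectors_of_mem_iSup ?_ hm (hz.le_lowerPart hg hN hmN)
    rintro ⟨γ', _, h0', h1⟩
    exact h0' (by simpa using h1.symm)
  -- A raising vector either decreases the depth, where induction gives zero, or leaves the cone,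
  -- where there are no weights. So `m` is singular, and nonzero `m` would force equal Casimir
  -- scalars.
  · have hs : T.IsSingular (ν + γ) m := by
      refine ⟨fun j hj => ?_, hm⟩
      have hw := lie_mem_weightVectors (T.basis_mem j) hm
      by_cases hc : γ + T.wt j ∈ T.negCone
      · obtain ⟨l, hl, _⟩ := T.exists_grading_eq hc
        rw [add_assoc] at hw
        refine ih l ?_ ?_ _ hc hl _ (N.lie_mem hmN) hw
        all_goals
          rw [LinearMap.add_apply, hk, T.wt_grading] at hl
          have : -(k : ℤ) + T.deg j = -(l : ℤ) := by exact_mod_cast hl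
          omega
      · refine eq_zero_of_mem_weightVectors_of_mem_iSup (A := {χ | ∃ γ ∈ T.negCone, χ = ν + γ})
          ?_ hw (by rw [hz.iSup_weightVectors hg]; trivial)
        rintro ⟨γ', hγ', h1⟩
        rw [add_assoc, add_right_inj] at h1
        exact hc (h1 ▸ hγ')
    have h1 := hs.casimir_eq.symm.trans (hz.casimir_eq_of_generates hg m)
    rw [← sub_eq_zero, ← sub_smul] at h1
    exact (smul_eq_zero.1 h1).resolve_left (sub_ne_zero.2 (hν γ hγ h0 k hkK hk))

end TriangularBasis

namespace SimpleHighestWeightModule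

attribute [local instance 100] LieRing.ofAssociativeRing

variable {𝔤 : Type*} [LieRing 𝔤] [LieAlgebra ℂ 𝔤] [FiniteDimensional ℂ 𝔤]
  [LieAlgebra.IsSemisimple ℂ 𝔤] {H : LieSubalgebra ℂ 𝔤} [H.IsCartanSubalgebra] {J : Type*}
  {T : TriangularBasis H J} {b : (rootSystem H).Base}

/-- If the Casimir operator separates `ν` from the weights `ν + γ` of small depth, then there is a
map `V(ν) → D` compatible with the negative part and sending the highest weight vector to `ξ`. -/
theorem exists_neg_linearMap [Fintype J] (hT : T.Compatible b) {D : Type*} [AddCommGroup D]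
    [Module ℂ D] [LieRingModule 𝔤 D] [LieModule ℂ 𝔤 D] {χ ν : Dual ℂ H} {ξ : D}
    (hξ : ξ ∈ weightVectors H D χ) (hξ0 : ξ ≠ 0) {K : ℕ}
    (hK : ∀ γ ∈ T.negCone, ∀ k : ℕ, K < k → γ T.grading = -(k : ℂ) →
      weightVectors H D (χ + γ) = ⊥)
    (hν : ∀ γ ∈ T.negCone, γ ≠ 0 → ∀ k : ℕ, k ≤ K → γ T.grading = -(k : ℂ) →
      T.casimirScalar (ν + γ) ≠ T.casimirScalar ν) :
    ∃ θ : SimpleHighestWeightModule b ν →ₗ[ℂ] D, θ (vector b ν) = ξ ∧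
      (∀ j, T.deg j < 0 → ∀ m, θ ⁅T.basis j, m⁆ = ⁅T.basis j, θ m⁆) ∧
      ∀ (h : H) m, θ ⁅(h : 𝔤), m⁆ = ⁅(h : 𝔤), θ m⁆ + (ν - χ) h • θ m := by
  obtain ⟨ρ, z, θ, hpos, hwt, hgen, hneg, hθz⟩ := T.exists_module_generated_by_singular ν ξ
  let i1 : LieRingModule 𝔤 T.NegEnveloping := LieRingModule.compLieHom T.NegEnveloping ρ
  have i2 : LieModule ℂ 𝔤 T.NegEnveloping := LieModule.compLieHom T.NegEnveloping ρ
  have hz : T.IsSingular ν z := ⟨hpos, hwt⟩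
  have hg : TriangularBasis.Generates 𝔤 z := by
    intro N hN
    have := hgen N.toSubmodule hN (fun x m hm => N.lie_mem hm)
    rwa [LieSubmodule.toSubmodule_eq_top] at this
  have hneg' : ∀ j, T.deg j < 0 → ∀ m, θ ⁅T.basis j, m⁆ = ⁅T.basis j, θ m⁆ := hneg
  have hz0 : z ≠ 0 := by
    rintro rfl
    exact hξ0 (by rw [← hθz, map_zero])
  obtain ⟨hv0, f, hf⟩ := exists_lieModuleHom hT hz hg hz0
  have hθH : ∀ (m : T.NegEnveloping) (h : H),
      θ ⁅(h : 𝔤), m⁆ = ⁅(h : 𝔤), θ m⁆ + (ν - χ) h • θ m := by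
    let S : Submodule ℂ T.NegEnveloping :=
      { carrier := {m | ∀ h : H, θ ⁅(h : 𝔤), m⁆ = ⁅(h : 𝔤), θ m⁆ + (ν - χ) h • θ m}
        add_mem' := fun ha hb h => by
          simp only [lie_add, map_add, ha h, hb h, smul_add]
          abel
        zero_mem' := fun h => by simp
        smul_mem' := fun c m hm h => by
          simp only [lie_smul, map_smul, hm h, smul_add]
          rw [smul_comm c] }
    have hS : S = ⊤ := by
      refine hz.eq_top hg (fun h => ?_) fun j hj m hm h => ?_
      · rw [hz.weight, map_smul, hθz, hξ h, ← add_smul, LinearMap.sub_apply, add_sub_cancel]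
      · rw [leibniz_lie, map_add, hneg' j hj, hm h, T.lie_basis, smul_lie, map_smul, hneg' j hj,
          leibniz_lie (h : 𝔤), T.lie_basis, smul_lie, lie_add, lie_smul]
        abel
    intro m h
    have : m ∈ S := by rw [hS]; trivial
    exact this h
  have hker : f.ker ≠ ⊤ := by
    intro hc
    have : z ∈ f.ker := by rw [hc]; trivial
    rw [LieModuleHom.mem_ker, hf] at this
    exact hv0 this
  -- Weight components of the kernel of depth at most `K` vanish by the Casimir argument. Those of
  -- greater depth are sent by `θ` to weights that `D` does not have.
  have hθker : LinearMap.ker (f : T.NegEnveloping →ₗ[ℂ] SimpleHighestWeightModule b ν) ≤ LinearMap.ker θ := by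
    intro n hn
    have h := mem_iSup_inf_weightVectors (A := {χ | ∃ γ ∈ T.negCone, χ = ν + γ})
      f.ker.toSubmodule (fun h m hm => f.ker.lie_mem hm) hn
      (by rw [hz.iSup_weightVectors hg]; trivial)
    refine (iSup₂_le ?_ : _ ≤ LinearMap.ker θ) h
    rintro _ ⟨γ, hγ, rfl⟩ m ⟨hm, hm'⟩
    obtain ⟨k, hk, _⟩ := T.exists_grading_eq hγ
    rcases le_or_gt k K with hkK | hkK
    · rw [hz.eq_zero_of_depth_le hg hker hν k hkK γ hγ hk m hm hm']
      exact zero_mem _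
    · have : θ m ∈ weightVectors H D (χ + γ) := by
        intro h
        have h1 := hθH m h
        rw [hm' h, map_smul] at h1
        rw [eq_sub_of_add_eq h1.symm, ← sub_smul]
        congr 1
        simp only [LinearMap.add_apply, LinearMap.sub_apply]
        ring
      rw [hK γ hγ k hkK hk] at this
      exact this
  have hsurj : Function.Surjective (f : T.NegEnveloping →ₗ[ℂ] SimpleHighestWeightModule b ν) := by
    have hr : f.range = ⊤ := generates_vector b ν _ ⟨z, hf⟩
    intro m
    have : m ∈ f.range := by rw [hr]; trivial
    exact this
  let f' : T.NegEnveloping →ₗ[ℂ] SimpleHighestWeightModule b ν := f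
  let θ' : SimpleHighestWeightModule b ν →ₗ[ℂ] D :=
    (LinearMap.ker f').liftQ θ hθker ∘ₗ (f'.quotKerEquivOfSurjective hsurj).symm.toLinearMap
  have hθ' : ∀ m, θ' (f m) = θ m := by
    intro m
    have : (f'.quotKerEquivOfSurjective hsurj).symm (f' m) = (LinearMap.ker f').mkQ m := by
      rw [LinearEquiv.symm_apply_eq]
      rfl
    exact congrArg ((LinearMap.ker f').liftQ θ hθker) this
  refine ⟨θ', by rw [← hf, hθ', hθz], fun j hj m => ?_, fun h m => ?_⟩
  · obtain ⟨m, rfl⟩ := hsurj m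
    change θ' ⁅T.basis j, f m⁆ = ⁅T.basis j, θ' (f m)⁆
    rw [← LieModuleHom.map_lie, hθ', hθ', hneg' j hj]
  · obtain ⟨m, rfl⟩ := hsurj m
    change θ' ⁅(h : 𝔤), f m⁆ = ⁅(h : 𝔤), θ' (f m)⁆ + (ν - χ) h • θ' (f m)
    rw [← LieModuleHom.map_lie, hθ', hθ', hθH]

variable {W I : Type*} [AddCommGroup W] [Module ℂ W] [LieRingModule 𝔤 W] [LieModule ℂ 𝔤 W]

/-- If the weight `wt i₀` of `W` is simple, then the multiplicity of `V(ν + wt i₀)` in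
`W ⊗ V(ν)` is at most one. -/
theorem rank_lieModuleHom_le_one (hT : T.Compatible b) (w : Basis I ℂ W) (wt : I → Dual ℂ H)
    (hw : ∀ i, w i ∈ weightVectors H W (wt i)) (i₀ : I) (hi₀ : ∀ i, i ≠ i₀ → wt i ≠ wt i₀)
    (ν : Dual ℂ H) :
    Module.rank ℂ (W ⊗[ℂ] SimpleHighestWeightModule b ν →ₗ⁅ℂ, 𝔤⁆
      SimpleHighestWeightModule b (ν + wt i₀)) ≤ 1 := by
  -- A zero highest weight vector would make the target zero; otherwise the projection onto its line
  -- is available.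
  by_cases h0 : vector b (ν + wt i₀) = 0
  · have hsub : ∀ m : SimpleHighestWeightModule b (ν + wt i₀), m = 0 := by
      intro m
      obtain ⟨u, rfl⟩ := exists_smul_vector m
      rw [h0, smul_zero]
    refine rank_le_one_iff.2 ⟨0, fun f => ⟨0, ?_⟩⟩
    ext m
    exact (hsub _).trans (hsub _).symm
  obtain ⟨p, hp1, hpneg, hpH⟩ := (isSingular_vector hT (ν + wt i₀)).exists_functional
    (generates_vector b _) h0
  let e : (W ⊗[ℂ] SimpleHighestWeightModule b ν →ₗ⁅ℂ, 𝔤⁆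
      SimpleHighestWeightModule b (ν + wt i₀)) →ₗ[ℂ] ℂ :=
    { toFun := fun f => p (f (w i₀ ⊗ₜ vector b ν))
      map_add' := fun f g => by rw [LieModuleHom.add_apply, map_add]
      map_smul' := fun c f => by
        rw [LieModuleHom.smul_apply, map_smul]; rfl }
  have he : Function.Injective e := by
    refine (injective_iff_map_eq_zero e).2 fun f hf => ?_
    have hf : p (f (w i₀ ⊗ₜ vector b ν)) = 0 := hf
    -- The functional `p ∘ f` sees only the weight `ν + wt i₀`, which among the vectors `w i ⊗
    -- vector b ν` occurs only for `i = i₀`.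
    have hbase : ∀ x, p (f (x ⊗ₜ vector b ν)) = 0 := by
      let g : W →ₗ[ℂ] ℂ := p ∘ₗ (f : _ →ₗ[ℂ] _) ∘ₗ (TensorProduct.mk ℂ _ _).flip (vector b ν)
      have hg : g = 0 := by
        refine w.ext fun i => ?_
        change p (f (w i ⊗ₜ vector b ν)) = 0
        by_cases hi : i = i₀
        · rw [hi, hf]
        · obtain ⟨h, hh⟩ : ∃ h, (wt i - wt i₀) h ≠ 0 := by
            by_contra! hc
            exact sub_ne_zero.2 (hi₀ i hi) (LinearMap.ext hc)
          have h1 := hpH h (f (w i ⊗ₜ vector b ν))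
          rw [← LieModuleHom.map_lie, TensorProduct.LieModule.lie_tmul_right, hw i h,
            (isSingular_vector hT ν).weight h, ← TensorProduct.smul_tmul', TensorProduct.tmul_smul,
            ← add_smul, map_smul, map_smul, smul_eq_mul, ← sub_eq_zero, ← sub_mul] at h1
          refine (mul_eq_zero.1 h1).resolve_left ?_
          rw [LinearMap.sub_apply] at hh
          rwa [LinearMap.add_apply, add_comm (wt i h), add_sub_add_left_eq_sub]
      exact fun x => LinearMap.congr_fun hg x
    -- As `p ∘ f` kills the image of `𝔫⁻`, a lowering vector can be moved from the second factor to
    -- the first, up to sign.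
    have hall : ∀ m x, p (f (x ⊗ₜ m)) = 0 := by
      let S : Submodule ℂ (SimpleHighestWeightModule b ν) :=
        { carrier := {m | ∀ x, p (f (x ⊗ₜ m)) = 0}
          add_mem' := fun ha hb x => by
            rw [TensorProduct.tmul_add, map_add, map_add, ha x, hb x, add_zero]
          zero_mem' := fun x => by rw [TensorProduct.tmul_zero, map_zero, map_zero]
          smul_mem' := fun c m hm x => by
            rw [TensorProduct.tmul_smul, map_smul, map_smul, hm x, smul_zero] }
      have hS : S = ⊤ := by
        refine (isSingular_vector hT ν).eq_top (generates_vector b ν) hbase fun j hj m hm x => ?_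
        have h1 := hpneg j hj (f (x ⊗ₜ m))
        rwa [← LieModuleHom.map_lie, TensorProduct.LieModule.lie_tmul_right, map_add, map_add,
          hm, zero_add] at h1
      intro m x
      have : m ∈ S := by rw [hS]; trivial
      exact this x
    have hpf : ∀ y, p (f y) = 0 := by
      intro y
      induction y using TensorProduct.induction_on with
      | zero => rw [map_zero, map_zero]
      | tmul x m => exact hall m x
      | add a c ha hc => rw [map_add, map_add, ha, hc, add_zero]
    have hr : f.range = ⊥ := by
      refine eq_bot_of_vector_notMem _ fun hv => ?_
      obtain ⟨y, hy⟩ := (LieModuleHom.mem_range _ _).1 hv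
      have := hpf y
      rw [hy, hp1] at this
      exact one_ne_zero this
    ext y
    have : f y ∈ f.range := (LieModuleHom.mem_range _ _).2 ⟨y, rfl⟩
    rw [hr] at this
    exact this
  have := LinearMap.lift_rank_le_of_injective e he
  rw [Module.rank_self, Cardinal.lift_one] at this
  simpa using this

end SimpleHighestWeightModule

/-! ### Existence of highest weight quotients of tensor products -/

section LargestSubmodule

variable {𝔤 : Type*} [LieRing 𝔤]
variable {M : Type*} [AddCommGroup M] [Module ℂ M] [LieRingModule 𝔤 M]

theorem LieSubmodule.exists_largest_le_ker (φ : M →ₗ[ℂ] ℂ) :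
    ∃ K : LieSubmodule ℂ 𝔤 M, K.toSubmodule ≤ LinearMap.ker φ ∧
      ∀ N : LieSubmodule ℂ 𝔤 M, N.toSubmodule ≤ LinearMap.ker φ → N ≤ K := by
  refine ⟨sSup {N | N.toSubmodule ≤ LinearMap.ker φ}, ?_, fun N hN => le_sSup hN⟩
  rw [LieSubmodule.sSup_toSubmodule]
  refine sSup_le ?_
  rintro _ ⟨N, hN, rfl⟩
  exact hN

/-- A linear functional factors through a quotient with no nonzero submodule in its kernel. -/
theorem LieModule.exists_quotient_functional [LieAlgebra ℂ 𝔤] [LieModule ℂ 𝔤 M] (φ : M →ₗ[ℂ] ℂ) :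
    ∃ (K : LieSubmodule ℂ 𝔤 M) (φ' : M ⧸ K →ₗ[ℂ] ℂ),
      (∀ m, φ' (LieSubmodule.Quotient.mk' K m) = φ m) ∧
      ∀ N : LieSubmodule ℂ 𝔤 (M ⧸ K), N.toSubmodule ≤ LinearMap.ker φ' → N = ⊥ := by
  obtain ⟨K, hK, hmax⟩ := LieSubmodule.exists_largest_le_ker (𝔤 := 𝔤) φ
  refine ⟨K, K.toSubmodule.liftQ φ hK, fun m => rfl, fun N hN => ?_⟩
  have h1 : N.comap (LieSubmodule.Quotient.mk' K) ≤ K := by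
    refine hmax _ fun m hm => ?_
    exact hN (show LieSubmodule.Quotient.mk' K m ∈ N from hm)
  refine (LieSubmodule.eq_bot_iff _).2 fun y hy => ?_
  obtain ⟨m, rfl⟩ := LieSubmodule.Quotient.surjective_mk' K y
  exact (LieSubmodule.Quotient.mk_eq_zero K).2 (h1 (show m ∈ N.comap _ from hy))

end LargestSubmodule

namespace SimpleHighestWeightModule

variable {𝔤 : Type*} [LieRing 𝔤] [LieAlgebra ℂ 𝔤] [FiniteDimensional ℂ 𝔤]
  [LieAlgebra.IsSemisimple ℂ 𝔤] {H : LieSubalgebra ℂ 𝔤} [H.IsCartanSubalgebra] {J : Type*}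
  {T : TriangularBasis H J} {b : (rootSystem H).Base}
variable {W I : Type*} [AddCommGroup W] [Module ℂ W] [LieRingModule 𝔤 W] [LieModule ℂ 𝔤 W]

open TriangularBasis

/-- The functional on `W ⊗ V(ν)` that extends the coordinate of a weight vector of `W`. -/
theorem exists_tensor_functional [Fintype J] (hT : T.Compatible b) (w : Basis I ℂ W)
    (wt : I → Dual ℂ H) (hw : ∀ i, w i ∈ weightVectors H W (wt i)) (i₀ : I)
    {ν : Dual ℂ H} {K : ℕ}
    (hK : ∀ i, ∀ k : ℕ, K < k → wt i T.grading ≠ wt i₀ T.grading + k)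
    (hν : ∀ γ ∈ T.negCone, γ ≠ 0 → ∀ k : ℕ, k ≤ K → γ T.grading = -(k : ℂ) →
      T.casimirScalar (ν + γ) ≠ T.casimirScalar ν) :
    ∃ φ : W ⊗[ℂ] SimpleHighestWeightModule b ν →ₗ[ℂ] ℂ,
      (∀ j, T.deg j < 0 → ∀ x, φ ⁅T.basis j, x⁆ = 0) ∧
      (∀ (h : H) x, φ ⁅(h : 𝔤), x⁆ = (ν + wt i₀) h * φ x) ∧
      ∀ i, φ (w i ⊗ₜ vector b ν) = w.coord i₀ (w i) := by
  have hξ : w.coord i₀ ∈ weightVectors H (W →ₗ[ℂ] ℂ) (-wt i₀) := by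
    intro h
    refine w.ext fun i => ?_
    rw [Module.Dual.lie_apply, hw i h]
    by_cases hi : i = i₀
    · subst hi; simp
    · simp [Finsupp.single_eq_of_ne' hi]
  have hξ0 : w.coord i₀ ≠ 0 := fun h0 => by
    have := LinearMap.congr_fun h0 (w i₀)
    simp at this
  -- Here `D = W*`, with the coordinate of weight `-wt i₀` as `ξ`; `hK` says that `W*` has no
  -- weights at depth greater than `K` below it.
  obtain ⟨θ, hθv, hθneg, hθH⟩ := exists_neg_linearMap (D := W →ₗ[ℂ] ℂ) hT hξ hξ0 (K := K)
    (by
      intro γ hγ k hk hγk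
      refine (Submodule.eq_bot_iff _).2 fun η hη => w.ext fun i => ?_
      have h1 := LinearMap.congr_fun (hη T.grading) (w i)
      rw [Module.Dual.lie_apply, hw i, map_smul, LinearMap.smul_apply, LinearMap.add_apply,
        LinearMap.neg_apply, hγk, smul_eq_mul, smul_eq_mul, ← sub_eq_zero] at h1
      have h2 : (wt i₀ T.grading + k - wt i T.grading) * η (w i) = 0 := by linear_combination h1
      exact (mul_eq_zero.1 h2).resolve_left (sub_ne_zero.2 (hK i k hk).symm)) hν
  -- With `φ (x ⊗ m) = θ m x`, compatibility of `θ` with `𝔫⁻` says exactly that `φ` kills the image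
  -- of `𝔫⁻`.
  refine ⟨TensorProduct.lift θ.flip, fun j hj x => ?_, fun h x => ?_, fun i => ?_⟩
  · induction x using TensorProduct.induction_on with
    | zero => simp
    | tmul x m =>
      rw [TensorProduct.LieModule.lie_tmul_right, map_add, TensorProduct.lift.tmul,
        TensorProduct.lift.tmul, LinearMap.flip_apply, LinearMap.flip_apply, hθneg j hj,
        Module.Dual.lie_apply, add_neg_cancel]
    | add a c ha hc => rw [lie_add, map_add, ha, hc, add_zero]
  · induction x using TensorProduct.induction_on with
    | zero => simp
    | tmul x m =>
      rw [TensorProduct.LieModule.lie_tmul_right, map_add, TensorProduct.lift.tmul,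
        TensorProduct.lift.tmul, TensorProduct.lift.tmul, LinearMap.flip_apply,
        LinearMap.flip_apply, LinearMap.flip_apply, hθH, LinearMap.add_apply,
        Module.Dual.lie_apply, add_neg_cancel_left, sub_neg_eq_add]
      rfl
    | add a c ha hc => rw [lie_add, map_add, ha, hc, map_add, mul_add]
  · rw [TensorProduct.lift.tmul, LinearMap.flip_apply, hθv]

/-- If the Casimir operator separates the relevant weights, then `V(ν + wt i₀)` is a quotient of
`W ⊗ V(ν)`. -/
theorem exists_lieModuleHom_ne_zero [Fintype J] [Finite I] (hT : T.Compatible b) (w : Basis I ℂ W)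
    (wt : I → Dual ℂ H) (hw : ∀ i, w i ∈ weightVectors H W (wt i)) (i₀ : I)
    {ν : Dual ℂ H} {K : ℕ}
    (hK : ∀ i, ∀ k : ℕ, K < k → wt i T.grading ≠ wt i₀ T.grading + k)
    (hν : ∀ γ ∈ T.negCone, γ ≠ 0 → ∀ k : ℕ, k ≤ K → γ T.grading = -(k : ℂ) →
      T.casimirScalar (ν + γ) ≠ T.casimirScalar ν)
    (hlow : ∀ i, (wt i T.grading).re < (wt i₀ T.grading).re →
      T.casimirScalar (ν + wt i) ≠ T.casimirScalar (ν + wt i₀)) :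
    ∃ f : W ⊗[ℂ] SimpleHighestWeightModule b ν →ₗ⁅ℂ, 𝔤⁆
      SimpleHighestWeightModule b (ν + wt i₀), f ≠ 0 := by
  obtain ⟨φ₀, hneg₀, hH₀, hφ₀⟩ := exists_tensor_functional hT w wt hw i₀ hK hν
  obtain ⟨K', φ, hφ, hbot⟩ := LieModule.exists_quotient_functional (𝔤 := 𝔤) φ₀
  let mk := LieSubmodule.Quotient.mk' K'
  let Y := (W ⊗[ℂ] SimpleHighestWeightModule b ν) ⧸ K'
  have hmk : Function.Surjective mk := LieSubmodule.Quotient.surjective_mk' K'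
  have hneg : ∀ j, T.deg j < 0 → ∀ y : Y, φ ⁅T.basis j, y⁆ = 0 := by
    intro j hj y
    obtain ⟨x, rfl⟩ := hmk y
    rw [← LieModuleHom.map_lie, hφ, hneg₀ j hj]
  have hH : ∀ (h : H) (y : Y), φ ⁅(h : 𝔤), y⁆ = (ν + wt i₀) h * φ y := by
    intro h y
    obtain ⟨x, rfl⟩ := hmk y
    rw [← LieModuleHom.map_lie, hφ, hφ, hH₀]
  -- The image of the Casimir operator minus the scalar is a submodule in the kernel of `φ`, hence
  -- zero.
  have hcas : ∀ y : Y, T.casimir Y y = T.casimirScalar (ν + wt i₀) • y := by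
    intro y
    let f : Y →ₗ[ℂ] Y := T.casimir Y - T.casimirScalar (ν + wt i₀) • LinearMap.id
    let R : LieSubmodule ℂ 𝔤 Y :=
      { LinearMap.range f with
        lie_mem := by
          rintro x _ ⟨m, rfl⟩
          refine ⟨⁅x, m⁆, ?_⟩
          change T.casimir Y ⁅x, m⁆ - T.casimirScalar (ν + wt i₀) • ⁅x, m⁆ =
            ⁅x, T.casimir Y m - T.casimirScalar (ν + wt i₀) • m⁆
          rw [T.casimir_lie, lie_sub, lie_smul] }
    have hR : R = ⊥ := by
      refine hbot R ?_
      rintro _ ⟨m, rfl⟩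
      change φ (T.casimir Y m - T.casimirScalar (ν + wt i₀) • m) = 0
      rw [map_sub, T.apply_casimir φ hneg hH, map_smul, smul_eq_mul, sub_self]
    have : f y ∈ R := ⟨y, rfl⟩
    rw [hR] at this
    exact sub_eq_zero.1 this
  let v : I → Y := fun i => mk (w i ⊗ₜ vector b ν)
  have hφv : ∀ i, φ (v i) = w.coord i₀ (w i) := fun i => (hφ _).trans (hφ₀ i)
  have hvw : ∀ i, v i ∈ weightVectors H Y (ν + wt i) := by
    intro i h
    change ⁅(h : 𝔤), mk (w i ⊗ₜ vector b ν)⁆ = _ • mk (w i ⊗ₜ vector b ν)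
    rw [← LieModuleHom.map_lie, TensorProduct.LieModule.lie_tmul_right, hw i h,
      (isSingular_vector hT ν).weight h, ← TensorProduct.smul_tmul', TensorProduct.tmul_smul,
      ← add_smul, map_smul, LinearMap.add_apply, add_comm]
  have hraise : ∀ (N : LieSubmodule ℂ 𝔤 Y) i j, 0 < T.deg j →
      (∀ i', (wt i T.grading).re < (wt i' T.grading).re → v i' ∈ N) → ⁅T.basis j, v i⁆ ∈ N := by
    intro N i j hj hN
    have h1 : ⁅T.basis j, v i⁆ = mk (⁅T.basis j, w i⁆ ⊗ₜ vector b ν) := by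
      change ⁅T.basis j, mk (w i ⊗ₜ vector b ν)⁆ = _
      rw [← LieModuleHom.map_lie, TensorProduct.LieModule.lie_tmul_right,
        (isSingular_vector hT ν).pos j hj, TensorProduct.tmul_zero, add_zero]
    rw [h1]
    let g : W →ₗ[ℂ] Y := (mk : _ →ₗ[ℂ] Y) ∘ₗ (TensorProduct.mk ℂ _ _).flip (vector b ν)
    change g ⁅T.basis j, w i⁆ ∈ N.toSubmodule
    rw [← w.linearCombination_repr ⁅T.basis j, w i⁆, Finsupp.linearCombination_apply,
      Finsupp.sum, map_sum]
    refine Submodule.sum_mem _ fun i' hi' => ?_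
    rw [map_smul]
    refine Submodule.smul_mem _ _ (hN i' ?_)
    have h2 : wt i' = wt i + T.wt j := by
      by_contra hc
      exact Finsupp.mem_support_iff.1 hi' (repr_eq_zero_of_mem_weightVectors w hw
        (lie_mem_weightVectors (T.basis_mem j) (hw i)) hc)
    rw [h2, LinearMap.add_apply, T.wt_grading, Complex.add_re, Complex.intCast_re]
    have : (0 : ℝ) < T.deg j := by exact_mod_cast hj
    linarith
  -- Induction runs from the highest weights of `W` downwards.
  have hwf : WellFounded fun i' i => (wt i T.grading).re < (wt i' T.grading).re := by
    have : IsTrans I fun i' i => (wt i T.grading).re < (wt i' T.grading).re :=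
      ⟨fun a b c h h' => h'.trans h⟩
    have : Std.Irrefl fun i' i : I => (wt i T.grading).re < (wt i' T.grading).re :=
      ⟨fun a => lt_irrefl _⟩
    exact Finite.wellFounded_of_trans_of_irrefl _
  -- Once the higher ones vanish, `v i` is singular, and the submodule it generates lies in the
  -- kernel of `φ`. Weights level with `wt i₀` are included, so `hlow` only concerns strictly lower
  -- ones.
  have hupper : ∀ i, i ≠ i₀ → (wt i₀ T.grading).re ≤ (wt i T.grading).re → v i = 0 := by
    intro i
    induction i using hwf.induction with
    | _ i ih =>
    intro hi hre
    have hs : T.IsSingular (ν + wt i) (v i) := by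
      refine ⟨fun j hj => ?_, hvw i⟩
      refine hraise ⊥ i j hj fun i' hi' => ih i' hi' ?_ (hre.trans hi'.le)
      rintro rfl
      exact hi'.not_ge hre
    obtain ⟨N, hN, hle⟩ := hs.le_of_mem (S := LinearMap.ker φ)
      ((hφv i).trans (by simp [Finsupp.single_eq_of_ne' hi])) fun j hj m _ => hneg j hj m
    rw [hbot N hle] at hN
    exact hN
  have hs₀ : T.IsSingular (ν + wt i₀) (v i₀) := by
    refine ⟨fun j hj => ?_, hvw i₀⟩
    refine hraise ⊥ i₀ j hj fun i' hi' => hupper i' ?_ hi'.le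
    rintro rfl
    exact lt_irrefl _ hi'
  have hv₀ : v i₀ ≠ 0 := fun h0 => by
    have := hφv i₀
    rw [h0] at this
    simp at this
  have hgen : Generates 𝔤 (v i₀) := by
    intro N hN
    have hall : ∀ i, v i ∈ N := by
      intro i
      induction i using hwf.induction with
      | _ i ih =>
      by_cases hi : i = i₀
      · rwa [hi]
      rcases le_or_gt (wt i₀ T.grading).re (wt i T.grading).re with hre | hre
      · rw [hupper i hi hre]
        exact zero_mem _
      -- Modulo `N` the vector `v i` is singular, so the Casimir operator acts on it by the scalar
      -- of `ν + wt i` as well as by that of `ν + wt i₀`. These differ by `hlow`, hence `v i ∈ N`.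
      · have h1 := T.casimir_sub_mem N (fun j hj => hraise N i j hj ih) (hvw i)
        rw [hcas, ← sub_smul] at h1
        exact (Submodule.smul_mem_iff N.toSubmodule (sub_ne_zero.2 (hlow i hre).symm)).1 h1
    have hbase : ∀ x, mk (x ⊗ₜ vector b ν) ∈ N := by
      intro x
      let g : W →ₗ[ℂ] Y := (mk : _ →ₗ[ℂ] Y) ∘ₗ (TensorProduct.mk ℂ _ _).flip (vector b ν)
      change g x ∈ N.toSubmodule
      rw [← w.linearCombination_repr x, Finsupp.linearCombination_apply, Finsupp.sum, map_sum]
      refine Submodule.sum_mem _ fun i' hi' => ?_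
      rw [map_smul]
      exact Submodule.smul_mem _ _ (hall i')
    have htmul : ∀ m x, mk (x ⊗ₜ m) ∈ N := by
      let S : Submodule ℂ (SimpleHighestWeightModule b ν) :=
        { carrier := {m | ∀ x, mk (x ⊗ₜ m) ∈ N}
          add_mem' := fun ha hb x => by
            rw [TensorProduct.tmul_add, map_add]
            exact N.add_mem (ha x) (hb x)
          zero_mem' := fun x => by
            rw [TensorProduct.tmul_zero, map_zero]
            exact N.zero_mem
          smul_mem' := fun c m hm x => by
            rw [TensorProduct.tmul_smul, map_smul]
            exact N.smul_mem c (hm x) }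
      have hS : S = ⊤ := by
        refine (isSingular_vector hT ν).eq_top (generates_vector b ν) hbase fun j hj m hm x => ?_
        have h1 : x ⊗ₜ[ℂ] ⁅T.basis j, m⁆ = ⁅T.basis j, x ⊗ₜ[ℂ] m⁆ - ⁅T.basis j, x⁆ ⊗ₜ[ℂ] m := by
          rw [TensorProduct.LieModule.lie_tmul_right, add_sub_cancel_left]
        rw [h1, map_sub, LieModuleHom.map_lie]
        exact N.sub_mem (N.lie_mem (hm x)) (hm _)
      intro m x
      have : m ∈ S := by rw [hS]; trivial
      exact this x
    refine eq_top_iff.2 fun y _ => ?_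
    obtain ⟨x, rfl⟩ := hmk y
    induction x using TensorProduct.induction_on with
    | zero => rw [map_zero]; exact zero_mem _
    | tmul x m => exact htmul m x
    | add a c ha hc =>
      rw [map_add]
      exact N.add_mem (ha trivial) (hc trivial)
  obtain ⟨hne, f, hf⟩ := exists_lieModuleHom hT hs₀ hgen hv₀
  refine ⟨f.comp mk, fun h0 => hne ?_⟩
  rw [← hf]
  exact LieModuleHom.congr_fun h0 (w i₀ ⊗ₜ vector b ν)

end SimpleHighestWeightModule

/-! ### The root space decomposition -/

section RootSpaces

variable {𝔤 : Type*} [LieRing 𝔤] [LieAlgebra ℂ 𝔤] [FiniteDimensional ℂ 𝔤]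
  [LieAlgebra.IsSemisimple ℂ 𝔤] {H : LieSubalgebra ℂ 𝔤} [H.IsCartanSubalgebra]

/-- The simple roots form a basis of the dual of `H`, so their values can be prescribed; evaluation
at `h₀` is then the height. -/
theorem exists_height_element (b : (rootSystem H).Base) :
    ∃ h₀ : H, ∀ i ∈ b.support, (rootSystem H).root i h₀ = 1 := by
  let f : Dual ℂ H →ₗ[ℂ] ℂ := b.toWeightBasis.constr ℂ fun _ => 1
  refine ⟨(evalEquiv ℂ H).symm f, fun i hi => ?_⟩
  have h1 : (rootSystem H).root i ((evalEquiv ℂ H).symm f) = f ((rootSystem H).root i) := by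
    conv_rhs => rw [← (evalEquiv ℂ H).apply_symm_apply f]
    rfl
  rw [h1]
  have h2 : b.toWeightBasis ⟨i, hi⟩ = (rootSystem H).root i := by simp
  rw [← h2, Basis.constr_basis]

variable {b : (rootSystem H).Base} {h₀ : H}

theorem exists_nat_of_mem_positiveRootCone (hh : ∀ i ∈ b.support, (rootSystem H).root i h₀ = 1)
    {x : Dual ℂ H} (hx : x ∈ positiveRootCone b) : ∃ k : ℕ, x h₀ = k ∧ (x ≠ 0 → 0 < k) := by
  induction hx using AddSubmonoid.closure_induction with
  | mem x hx =>
    obtain ⟨i, hi, rfl⟩ := hx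
    exact ⟨1, by rw [hh i hi, Nat.cast_one], fun _ => Nat.one_pos⟩
  | zero => exact ⟨0, by simp, fun h => absurd rfl h⟩
  | add x y _ _ hx hy =>
    obtain ⟨k, hk, hk0⟩ := hx
    obtain ⟨l, hl, hl0⟩ := hy
    refine ⟨k + l, by rw [LinearMap.add_apply, hk, hl]; push_cast; rfl, fun h => ?_⟩
    by_cases hx0 : x = 0
    · have := hl0 (by rintro rfl; simp [hx0] at h)
      omega
    · have := hk0 hx0
      omega

/-- The height of a root, computed by evaluation. -/
theorem exists_int_of_root (hh : ∀ i ∈ b.support, (rootSystem H).root i h₀ = 1) (α : H.root) :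
    ∃ z : ℤ, (rootSystem H).root α h₀ = z ∧ z ≠ 0 ∧
      (0 < z → (rootSystem H).root α ∈ positiveRootCone b) ∧
      (z < 0 → -(rootSystem H).root α ∈ positiveRootCone b) := by
  have hne : (rootSystem H).root α ≠ 0 := (rootSystem H).ne_zero α
  rcases b.root_mem_or_neg_mem α with h | h
  · obtain ⟨k, hk, hk0⟩ := exists_nat_of_mem_positiveRootCone hh h
    have := hk0 hne
    exact ⟨k, by rw [hk]; push_cast; rfl, by omega, fun _ => h, fun h => by omega⟩
  · obtain ⟨k, hk, hk0⟩ := exists_nat_of_mem_positiveRootCone hh h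
    have := hk0 (neg_ne_zero.2 hne)
    refine ⟨-k, ?_, by omega, fun h => by omega, fun _ => h⟩
    rw [LinearMap.neg_apply] at hk
    rw [← neg_neg ((rootSystem H).root α h₀), hk]
    push_cast
    rfl

theorem exists_int_of_weight (hh : ∀ i ∈ b.support, (rootSystem H).root i h₀ = 1)
    (χ : LieModule.Weight ℂ H 𝔤) :
    ∃ z : ℤ, (LieModule.Weight.toLinear ℂ H 𝔤 χ) h₀ = z ∧ (z = 0 → (χ : H → ℂ) = 0) ∧
      (0 < z → ∃ α : H.root, (α : LieModule.Weight ℂ H 𝔤) = χ ∧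
        (rootSystem H).root α ∈ positiveRootCone b) := by
  by_cases h0 : χ.IsZero
  · exact ⟨0, by simp [LieModule.Weight.toLinear_apply, show (χ : H → ℂ) = 0 from h0], fun _ => h0,
      fun h => absurd h (lt_irrefl _)⟩
  · have hm : χ ∈ H.root := by simpa using h0
    obtain ⟨z, hz, hz0, hpos, _⟩ := exists_int_of_root hh ⟨χ, hm⟩
    exact ⟨z, hz, fun h => absurd h hz0, fun h => ⟨⟨χ, hm⟩, rfl, hpos h⟩⟩

set_option linter.unusedSectionVars false in
open Classical in
theorem isInternal_rootSpace (H : LieSubalgebra ℂ 𝔤) [H.IsCartanSubalgebra] :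
    DirectSum.IsInternal fun χ : LieModule.Weight ℂ H 𝔤 => (rootSpace H χ).toSubmodule := by
  refine DirectSum.isInternal_submodule_of_iSupIndep_of_iSup_eq_top ?_ ?_
  · exact LieSubmodule.iSupIndep_toSubmodule.2 (LieModule.iSupIndep_genWeightSpace' ℂ H 𝔤)
  · rw [← LieSubmodule.iSup_toSubmodule, LieModule.iSup_genWeightSpace_eq_top' ℂ H 𝔤,
      LieSubmodule.top_toSubmodule]

theorem rootSpace_mem_weightVectors {χ : LieModule.Weight ℂ H 𝔤} {x : 𝔤}
    (hx : x ∈ rootSpace H χ) : x ∈ weightVectors H 𝔤 (LieModule.Weight.toLinear ℂ H 𝔤 χ) := fun h =>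
  lie_eq_smul_of_mem_rootSpace hx h

/-- A basis of `𝔤` adapted to the root space decomposition and to a base of the root system. -/
theorem exists_triangularBasis (b : (rootSystem H).Base) :
    ∃ T : TriangularBasis H
      (Σ χ : LieModule.Weight ℂ H 𝔤, Fin (finrank ℂ (rootSpace H χ).toSubmodule)),
      T.Compatible b ∧ ∀ i ∈ b.support, (rootSystem H).root i T.grading = 1 := by
  classical
  obtain ⟨h₀, hh⟩ := exists_height_element b
  choose z hz hz0 hzpos using exists_int_of_weight (𝔤 := 𝔤) hh
  let B := (isInternal_rootSpace H).collectedBasis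
    fun χ => finBasis ℂ (rootSpace H χ).toSubmodule
  have hB : ∀ j, B j ∈ rootSpace H j.1 := fun j =>
    (isInternal_rootSpace H).collectedBasis_mem (fun χ => finBasis ℂ (rootSpace H χ).toSubmodule) j
  refine ⟨{ basis := B
            wt := fun j => (LieModule.Weight.toLinear ℂ H 𝔤 j.1)
            deg := fun j => z j.1
            grading := h₀
            wt_grading := fun j => hz j.1
            lie_basis := fun h j => rootSpace_mem_weightVectors (hB j) h
            mem_of_deg_eq_zero := fun j hj => ?_
            lie_eq_zero := fun h h' => ?_ }, ⟨fun j hj => ?_, fun α hα x hx j hj => ?_⟩, hh⟩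
  · have h1 := hB j
    rw [hz0 _ hj, rootSpace_zero_eq] at h1
    exact h1
  · rw [← LieSubalgebra.coe_bracket, trivial_lie_zero]
    rfl
  · obtain ⟨α, hα, hα'⟩ := hzpos j.1 hj
    refine ⟨α, hα', ?_⟩
    rw [hα]
    exact hB j
  · have hj1 : (α : LieModule.Weight ℂ H 𝔤) = j.1 := by
      by_contra hne
      exact hj ((isInternal_rootSpace H).collectedBasis_repr_of_mem_ne _ hne hx)
    obtain ⟨k, hk, hk0⟩ := exists_nat_of_mem_positiveRootCone hh hα
    have h1 := hk0 ((rootSystem H).ne_zero α)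
    have h2 := hz j.1
    rw [← hj1] at h2
    have h3 := hk.symm.trans h2
    change 0 < z j.1
    rw [← hj1]
    have h4 : (k : ℤ) = z α := by exact_mod_cast h3
    omega

variable {J : Type*} [Fintype J] {T : TriangularBasis H J}

theorem gradingDual_eq_sum :
    T.gradingDual = ∑ α ∈ H.root, (LieModule.Weight.toLinear ℂ H 𝔤 α) T.grading • (LieModule.Weight.toLinear ℂ H 𝔤 α) := by
  ext h
  have h1 := LinearMap.congr_fun (LinearMap.congr_fun (restrict_killingForm_eq_sum (K := ℂ)
    (L := 𝔤) (H := H)) T.grading) h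
  rw [T.gradingDual_apply]
  refine Eq.trans h1 ?_
  simp [LinearMap.sum_apply]
  rfl

/-- Each summand is height times root, and for a negative root the two signs cancel. -/
theorem gradingDual_mem_positiveRootCone
    (hh : ∀ i ∈ b.support, (rootSystem H).root i T.grading = 1) :
    T.gradingDual ∈ positiveRootCone b := by
  rw [gradingDual_eq_sum]
  refine AddSubmonoid.sum_mem _ fun α hα => ?_
  obtain ⟨z, hz, hz0, hpos, hneg⟩ := exists_int_of_root hh ⟨α, hα⟩
  have hz' : (LieModule.Weight.toLinear ℂ H 𝔤 α) T.grading = z := hz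
  rw [hz']
  rcases lt_or_gt_of_ne hz0 with h | h
  · have h1 : ((z : ℂ) • (LieModule.Weight.toLinear ℂ H 𝔤 α) : Dual ℂ H) = z.natAbs • -(LieModule.Weight.toLinear ℂ H 𝔤 α) := by
      rw [← Nat.cast_smul_eq_nsmul ℂ, smul_neg, ← neg_smul]
      congr 1
      have : z = -(z.natAbs : ℤ) := by omega
      rw [← Int.cast_natCast, ← Int.cast_neg]
      exact congrArg _ this
    rw [h1]
    exact AddSubmonoid.nsmul_mem _ (hneg h) _
  · have h1 : ((z : ℂ) • (LieModule.Weight.toLinear ℂ H 𝔤 α) : Dual ℂ H) = z.natAbs • (LieModule.Weight.toLinear ℂ H 𝔤 α) := by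
      rw [← Nat.cast_smul_eq_nsmul ℂ]
      congr 1
      have : z = (z.natAbs : ℤ) := by omega
      rw [← Int.cast_natCast]
      exact congrArg _ this
    rw [h1]
    exact AddSubmonoid.nsmul_mem _ (hpos h) _

/-- The functional `κ(hᵢ, ·)` is proportional to `αᵢ`, which is 1 at `grading` and 2 at `hᵢ`, so
twice the value sought is `κ(hᵢ, hᵢ)`. That is a sum of squares of integers, one of them 4.
Integrality comes from the sum over roots of height times `α(hᵢ)`. -/
theorem gradingDual_coroot
    (hh : ∀ i ∈ b.support, (rootSystem H).root i T.grading = 1) {i : H.root} (hi : i ∈ b.support) :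
    ∃ n : ℕ, 0 < n ∧ T.gradingDual ((rootSystem H).coroot i) = n := by
  have hint : ∀ α : LieModule.Weight ℂ H 𝔤, ∃ z : ℤ, (LieModule.Weight.toLinear ℂ H 𝔤 α) (coroot i.1) = z := fun α =>
    ⟨_, by rw [LieModule.Weight.toLinear_apply]; exact apply_coroot_eq_cast i.1 α⟩
  choose z hz using hint
  choose! y hy _ using exists_int_of_weight (𝔤 := 𝔤) hh
  have h1 : T.gradingDual (coroot i.1) = ((∑ α ∈ H.root, y α * z α : ℤ) : ℂ) := by
    rw [gradingDual_eq_sum, LinearMap.sum_apply]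
    push_cast
    refine Finset.sum_congr rfl fun α _ => ?_
    rw [LinearMap.smul_apply, smul_eq_mul, hy, hz]
  have h2 : LieModule.traceForm ℂ H 𝔤 (coroot i.1) (coroot i.1) =
      ((∑ α ∈ H.root, z α * z α : ℤ) : ℂ) := by
    have h3 := LinearMap.congr_fun (LinearMap.congr_fun (restrict_killingForm_eq_sum (K := ℂ)
      (L := 𝔤) (H := H)) (coroot i.1)) (coroot i.1)
    refine Eq.trans h3 ?_
    push_cast
    simp only [LinearMap.coe_sum, Finset.sum_apply]
    refine Finset.sum_congr rfl fun α _ => ?_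
    rw [← hz]
    rfl
  have hi0 : (i : LieModule.Weight ℂ H 𝔤).IsNonZero := LieSubalgebra.isNonZero_coe_root i
  have hroot : (LieModule.Weight.toLinear ℂ H 𝔤 i.1) T.grading = 1 := hh i hi
  have h4 : 2 * T.gradingDual (coroot i.1) =
      LieModule.traceForm ℂ H 𝔤 (coroot i.1) (coroot i.1) := by
    have h5 : T.gradingDual (coroot i.1) = LieModule.traceForm ℂ H 𝔤 (coroot i.1) T.grading := by
      rw [LieModule.traceForm_comm]
      rfl
    rw [h5, traceForm_coroot, traceForm_coroot, root_apply_coroot hi0,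
      show (i.1 : H → ℂ) T.grading = 1 from hroot]
    simp only [nsmul_eq_mul, smul_eq_mul]
    push_cast
    ring
  rw [h1, h2] at h4
  have h6 : 2 * (∑ α ∈ H.root, y α * z α) = ∑ α ∈ H.root, z α * z α := by exact_mod_cast h4
  have h7 : 0 < ∑ α ∈ H.root, z α * z α := by
    refine Finset.sum_pos' (fun α _ => mul_self_nonneg _) ⟨i.1, i.2, ?_⟩
    have h8 := hz i.1
    rw [LieModule.Weight.toLinear_apply, root_apply_coroot hi0] at h8
    have : z i.1 = 2 := by exact_mod_cast h8.symm
    rw [this]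
    norm_num
  refine ⟨(∑ α ∈ H.root, y α * z α).natAbs, by omega, ?_⟩
  rw [rootSystem_coroot_apply, h1]
  have : (∑ α ∈ H.root, y α * z α) = ((∑ α ∈ H.root, y α * z α).natAbs : ℤ) := by omega
  rw [← Int.cast_natCast]
  exact congrArg _ this

end RootSpaces

/-! ### Semisimplicity of the action of a coroot -/

namespace SlTwo

variable {V : Type*} [AddCommGroup V] [Module ℂ V]

/-- Endomorphisms `E`, `F`, `D` satisfying the relations of an `sl₂` triple, with `E` and `F`
nilpotent. -/
structure IsNilpotentTriple (D E F : Module.End ℂ V) : Prop where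
  mul_sub_mul : E * F = F * E + D
  mul_raise : D * E = E * (D + 2)
  mul_lower : D * F = F * (D - 2)
  nilpotent_raise : IsNilpotent E
  nilpotent_lower : IsNilpotent F

namespace IsNilpotentTriple

variable {D E F : Module.End ℂ V}

theorem mul_raise_pow (t : IsNilpotentTriple D E F) (j : ℕ) :
    D * E ^ j = E ^ j * (D + 2 * (j : Module.End ℂ V)) := by
  induction j with
  | zero => simp
  | succ j ih =>
    have hc : Commute (2 * (j : Module.End ℂ V)) E :=
      (Commute.ofNat_left 2 E).mul_left (Nat.cast_commute j E)
    rw [pow_succ, ← mul_assoc, ih, mul_assoc, add_mul, hc.eq, t.mul_raise, ← mul_add, ← mul_assoc]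
    push_cast
    congr 1
    rw [add_assoc, mul_add, mul_one, add_comm (2 : Module.End ℂ V)]

theorem raise_mul_lower_pow (t : IsNilpotentTriple D E F) (k : ℕ) :
    E * F ^ (k + 1) = F ^ (k + 1) * E +
      ((k + 1 : ℕ) : Module.End ℂ V) * (F ^ k * (D - (k : Module.End ℂ V))) := by
  induction k with
  | zero => simp [t.mul_sub_mul]
  | succ k ih =>
    have hc : (D - (k : Module.End ℂ V)) * F = F * (D - 2 - (k : Module.End ℂ V)) := by
      rw [sub_mul, t.mul_lower, (Nat.cast_commute k F).eq, mul_sub F (D - 2)]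
    have hk : ∀ n : ℕ, ∀ A : Module.End ℂ V, (n : Module.End ℂ V) * A = (n : ℂ) • A := fun n A => by
      rw [← nsmul_eq_mul, Nat.cast_smul_eq_nsmul]
    have hk' : ∀ n : ℕ, (n : Module.End ℂ V) = (n : ℂ) • (1 : Module.End ℂ V) := fun n => by
      rw [← hk, mul_one]
    have h2 : (2 : Module.End ℂ V) = (2 : ℂ) • (1 : Module.End ℂ V) := by
      exact_mod_cast hk' 2
    rw [pow_succ F (k + 1), ← mul_assoc, ih, add_mul, mul_assoc _ E, t.mul_sub_mul, mul_assoc,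
      mul_assoc (F ^ k), hc, ← mul_assoc (F ^ k) F, ← pow_succ, mul_add, ← mul_assoc _ F E,
      ← pow_succ, add_assoc, hk, hk, hk' k, hk' (k + 1), h2]
    congr 1
    simp only [mul_sub, mul_smul_comm, mul_one, smul_sub, smul_smul]
    push_cast
    module

theorem raise_lower_pow_apply (t : IsNilpotentTriple D E F) (k : ℕ) {x : V} (hx : E x = 0) :
    E ((F ^ (k + 1)) x) = (k + 1 : ℂ) • (F ^ k) (D x - (k : ℂ) • x) := by
  have h := LinearMap.congr_fun (t.raise_mul_lower_pow k) x
  have h1 : ∀ n : ℕ, ∀ y : V, (n : Module.End ℂ V) y = (n : ℂ) • y := fun n y => by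
    rw [Module.End.natCast_apply, Nat.cast_smul_eq_nsmul]
  simp only [Module.End.mul_apply, LinearMap.add_apply, LinearMap.sub_apply, hx, map_zero,
    zero_add, h1] at h
  rw [h]
  push_cast
  rfl

theorem weight_raise_pow (t : IsNilpotentTriple D E F) (j : ℕ) (c : ℂ) (x : V) :
    D ((E ^ j) x) - (c + 2 * j) • (E ^ j) x = (E ^ j) (D x - c • x) := by
  have h := LinearMap.congr_fun (t.mul_raise_pow j) x
  have h1 : (2 * (j : Module.End ℂ V)) x = (2 * (j : ℂ)) • x := by
    have : (2 * (j : Module.End ℂ V)) = ((2 * j : ℕ) : Module.End ℂ V) := by push_cast; rfl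
    rw [this, Module.End.natCast_apply, ← Nat.cast_smul_eq_nsmul ℂ]
    push_cast
    rfl
  simp only [Module.End.mul_apply, LinearMap.add_apply, map_add, h1, map_smul] at h
  rw [h, map_sub, map_smul]
  module

theorem exists_pow_apply_ne_zero {A : Module.End ℂ V} (hA : IsNilpotent A) {x : V} (hx : x ≠ 0) :
    ∃ k : ℕ, (A ^ k) x ≠ 0 ∧ (A ^ (k + 1)) x = 0 := by
  obtain ⟨n, hn⟩ := hA
  exact Nat.exists_not_and_succ_of_not_zero_of_exists (p := fun k => (A ^ k) x = 0) (by simpa)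
    ⟨n, by rw [hn, LinearMap.zero_apply]⟩

/-- The weight of a primitive vector is a natural number. -/
theorem exists_nat (t : IsNilpotentTriple D E F) {c : ℂ} {x : V} (hx : E x = 0) (hc : D x = c • x)
    (h0 : x ≠ 0) : ∃ n : ℕ, c = n ∧ (F ^ n) x ≠ 0 ∧ (F ^ (n + 1)) x = 0 := by
  obtain ⟨k, hk, hk1⟩ := exists_pow_apply_ne_zero t.nilpotent_lower h0
  refine ⟨k, ?_, hk, hk1⟩
  have h := t.raise_lower_pow_apply k hx
  rw [hk1, map_zero, hc, ← sub_smul, map_smul, smul_smul, eq_comm, smul_eq_zero] at h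
  have h1 := (mul_eq_zero.1 (h.resolve_right hk)).resolve_left (Nat.cast_add_one_ne_zero k)
  exact sub_eq_zero.1 h1

/-- If `u = D x - c x` were nonzero, it would be primitive of some weight `n`, with `F ^ n u ≠ 0`
and `F ^ (n + 1) u = 0`. Then `E F ^ (n + 1) x` is a nonzero multiple of `F ^ n u`, and from there
on `E F ^ (k + 1) x` is a nonzero multiple of `F ^ k x`. No power of `F` would kill `x`, against
nilpotency. -/
theorem weight_of_raise_eq_zero (t : IsNilpotentTriple D E F) {c : ℂ} {x : V} (hx : E x = 0)
    (hc : D (D x - c • x) = c • (D x - c • x)) : D x = c • x := by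
  by_contra hne
  have hne' : D x - c • x ≠ 0 := fun h => hne (sub_eq_zero.1 h)
  have hx' : E (D x - c • x) = 0 := by
    have h := t.weight_raise_pow 1 c x
    rw [pow_one, hx] at h
    simpa using h.symm
  obtain ⟨n, rfl, hn, hn1⟩ := t.exists_nat hx' hc hne'
  have h1 : ∀ i : ℕ, (F ^ (n + 1 + i)) x ≠ 0 := by
    intro i
    induction i with
    | zero =>
      intro h
      have h2 := t.raise_lower_pow_apply n hx
      rw [add_zero] at h
      rw [h, map_zero, eq_comm, smul_eq_zero] at h2
      exact h2.elim (Nat.cast_add_one_ne_zero n) hn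
    | succ i ih =>
      intro h
      have h2 := t.raise_lower_pow_apply (n + 1 + i) hx
      have h3 : D x - ((n + 1 + i : ℕ) : ℂ) • x = (D x - (n : ℂ) • x) - ((1 + i : ℕ) : ℂ) • x := by
        push_cast
        module
      have h4 : (F ^ (n + 1 + i)) (D x - (n : ℂ) • x) = 0 := by
        rw [add_comm (n + 1), pow_add, Module.End.mul_apply, hn1, map_zero]
      rw [← add_assoc] at h
      rw [h, map_zero, h3, map_sub, h4, zero_sub, map_smul, smul_neg, smul_smul, eq_comm,
        neg_eq_zero, smul_eq_zero, mul_eq_zero] at h2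
      rcases h2 with (h2 | h2) | h2
      · exact Nat.cast_add_one_ne_zero _ h2
      · exact Nat.cast_ne_zero.2 (by omega) h2
      · exact ih h2
  obtain ⟨m, hm⟩ := t.nilpotent_lower
  refine h1 m ?_
  rw [pow_add, hm, mul_zero, LinearMap.zero_apply]

/-- The Casimir operator of a triple. -/
noncomputable def omega (D E F : Module.End ℂ V) : Module.End ℂ V :=
  4 * (F * E) + D * D + 2 * D

theorem commute_omega_weight (t : IsNilpotentTriple D E F) : Commute (omega D E F) D := by
  have h : D * (F * E) = F * E * D := by
    rw [← mul_assoc, t.mul_lower, mul_assoc, sub_mul, t.mul_raise]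
    noncomm_ring
  change _ * _ = _ * _
  rw [omega]
  simp only [add_mul, mul_add]
  rw [mul_assoc 4, ← h]
  noncomm_ring

theorem commute_omega_raise (t : IsNilpotentTriple D E F) : Commute (omega D E F) E := by
  have h := t.mul_sub_mul
  have h1 : E * D = D * E - 2 * E := by
    rw [t.mul_raise]
    noncomm_ring
  have h2 : D * E * D = D * (D * E) - 2 * (D * E) := by
    rw [mul_assoc, h1]
    noncomm_ring
  change _ * _ = _ * _
  rw [omega]
  have e1 : E * (4 * (F * E) + D * D + 2 * D) = 4 * ((E * F) * E) + (E * D) * D + 2 * (E * D) := by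
    noncomm_ring
  rw [e1, h, h1, sub_mul, h2, mul_assoc 2 E D, h1]
  noncomm_ring

theorem omega_apply_of_raise_eq_zero {c : ℂ} {x : V} (hx : E x = 0) (hc : D x = c • x) :
    omega D E F x = (c * c + 2 * c) • x := by
  have h2 : (2 : Module.End ℂ V) = ((2 : ℕ) : Module.End ℂ V) := by push_cast; rfl
  have h4 : (4 : Module.End ℂ V) = ((4 : ℕ) : Module.End ℂ V) := by push_cast; rfl
  rw [omega, h2, h4]
  simp only [LinearMap.add_apply, Module.End.mul_apply, hx, hc, map_smul, Module.End.natCast_apply,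
    map_zero, ← Nat.cast_smul_eq_nsmul ℂ]
  push_cast
  module

/-- Take the last nonzero `E ^ j x`. It is primitive, so by `weight_of_raise_eq_zero` a true
eigenvector of `D`, and `omega` acts on it by a number that must be `ω`. -/
theorem exists_nat_of_mem_maxGenEigenspace (t : IsNilpotentTriple D E F) {ω c : ℂ} {x : V}
    (hω : x ∈ (omega D E F).maxGenEigenspace ω) (hc : D (D x - c • x) = c • (D x - c • x))
    (h0 : x ≠ 0) : ∃ j n : ℕ, (E ^ j) x ≠ 0 ∧ (E ^ j) (D x - c • x) = 0 ∧ c + 2 * j = n ∧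
      ω = n * n + 2 * n := by
  obtain ⟨j, hj, hj1⟩ := exists_pow_apply_ne_zero t.nilpotent_raise h0
  rw [pow_succ', Module.End.mul_apply] at hj1
  have h1 := t.weight_raise_pow j c x
  have h2 := t.weight_raise_pow j c (D x - c • x)
  rw [hc, sub_self, map_zero, ← h1] at h2
  have h3 := t.weight_of_raise_eq_zero hj1 (sub_eq_zero.1 h2)
  obtain ⟨n, hn, -⟩ := t.exists_nat hj1 h3 hj
  have h4 : (E ^ j) x ∈ (omega D E F).maxGenEigenspace ω :=
    Module.End.mapsTo_maxGenEigenspace_of_comm (t.commute_omega_raise.pow_right j) ω hω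
  refine ⟨j, n, hj, by rw [← h1, h3, sub_self], hn, ?_⟩
  rw [Module.End.mem_maxGenEigenspace] at h4
  obtain ⟨k, hk⟩ := h4
  have h5 := omega_apply_of_raise_eq_zero (F := F) hj1 h3
  have h6 : ∀ k : ℕ, ((omega D E F - ω • (1 : Module.End ℂ V)) ^ k) ((E ^ j) x) =
      (((c + 2 * j) * (c + 2 * j) + 2 * (c + 2 * j)) - ω) ^ k • (E ^ j) x := by
    intro k
    induction k with
    | zero => simp
    | succ k ih =>
      rw [pow_succ', Module.End.mul_apply, ih, map_smul, LinearMap.sub_apply, h5,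
        LinearMap.smul_apply, Module.End.one_apply, ← sub_smul, smul_smul, pow_succ]
  rw [h6, smul_eq_zero] at hk
  have h7 := eq_zero_of_pow_eq_zero (hk.resolve_right hj)
  rw [hn] at h7
  exact (sub_eq_zero.1 h7).symm

/-- Apply the previous lemma to `x` and to `u = D x - c x`. The value `ω = n² + 2n` determines `n`,
hence the exponent `j` is the same for both; yet `E ^ j` kills `u` in one case and not in the other.
-/
theorem weight_of_mem_maxGenEigenspace (t : IsNilpotentTriple D E F) {ω c : ℂ} {x : V}
    (hω : x ∈ (omega D E F).maxGenEigenspace ω) (hc : D (D x - c • x) = c • (D x - c • x)) :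
    D x = c • x := by
  by_contra hne
  have hne' : D x - c • x ≠ 0 := fun h => hne (sub_eq_zero.1 h)
  have h0 : x ≠ 0 := by
    rintro rfl
    simp at hne
  obtain ⟨j, n, hj, hju, hn, hωn⟩ := t.exists_nat_of_mem_maxGenEigenspace hω hc h0
  have hω' : D x - c • x ∈ (omega D E F).maxGenEigenspace ω :=
    Submodule.sub_mem _
      (Module.End.mapsTo_maxGenEigenspace_of_comm t.commute_omega_weight ω hω)
      (Submodule.smul_mem _ _ hω)
  obtain ⟨j', n', hj', -, hn', hωn'⟩ := t.exists_nat_of_mem_maxGenEigenspace hω'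
    (c := c) (by rw [hc, sub_self, map_zero, smul_zero]) hne'
  have h1 : n * n + 2 * n = n' * n' + 2 * n' := by exact_mod_cast hωn.symm.trans hωn'
  have h2 : n = n' := by nlinarith
  subst h2
  have h3 : (j : ℂ) = j' := by
    have := hn.trans hn'.symm
    have h4 : (2 : ℂ) * j = 2 * j' := add_left_cancel this
    exact mul_left_cancel₀ two_ne_zero h4
  rw [Nat.cast_inj] at h3
  subst h3
  exact hj' hju

/-- In a finite-dimensional representation, the middle operator of a triple is diagonalizable. -/
theorem maxGenEigenspace_le_eigenspace [FiniteDimensional ℂ V] (t : IsNilpotentTriple D E F)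
    (c : ℂ) : D.maxGenEigenspace c ≤ D.eigenspace c := by
  -- Since `omega` commutes with `D`, it suffices to treat vectors in a single generalized
  -- eigenspace of `omega`.
  rw [Submodule.eq_iSup_inf_genEigenspace (f := omega D E F) (p := D.maxGenEigenspace c) ⊤
    (fun x hx => Module.End.mapsTo_maxGenEigenspace_of_comm t.commute_omega_weight.symm c hx)
    (Module.End.iSup_maxGenEigenspace_eq_top (omega D E F))]
  refine iSup_le fun ω => ?_
  rintro x ⟨hxc, hx⟩
  obtain ⟨k, hk⟩ := (Module.End.mem_maxGenEigenspace D c x).1 hxc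
  have hmem : ∀ k : ℕ, ((D - c • (1 : Module.End ℂ V)) ^ k) x ∈
      (omega D E F).maxGenEigenspace ω := by
    intro k
    induction k with
    | zero => exact hx
    | succ k ih =>
      rw [pow_succ', Module.End.mul_apply]
      exact Submodule.sub_mem _
        (Module.End.mapsTo_maxGenEigenspace_of_comm t.commute_omega_weight ω ih)
        (Submodule.smul_mem _ _ ih)
  -- Having excluded Jordan blocks of size two, one lowers the exponent of `D - c` down to 1.
  have hred : ∀ k : ℕ, ((D - c • (1 : Module.End ℂ V)) ^ (k + 1)) x = 0 →
      ((D - c • (1 : Module.End ℂ V)) ^ 1) x = 0 := by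
    intro k
    induction k with
    | zero => exact id
    | succ k ih =>
      intro h
      refine ih ?_
      rw [pow_succ', Module.End.mul_apply, pow_succ', Module.End.mul_apply] at h
      have h1 := t.weight_of_mem_maxGenEigenspace (hmem k) (c := c) (sub_eq_zero.1 h)
      rw [pow_succ', Module.End.mul_apply, LinearMap.sub_apply, h1]
      simp
  rw [Module.End.mem_eigenspace_iff]
  rw [pow_one] at hred
  refine sub_eq_zero.1 (hred k ?_)
  rw [pow_succ', Module.End.mul_apply, hk, map_zero]

/-- The eigenvalues of the middle operator of a triple are integers. -/
theorem exists_int (t : IsNilpotentTriple D E F) {c : ℂ} {x : V} (h0 : x ≠ 0)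
    (hc : D x = c • x) : ∃ z : ℤ, c = z := by
  obtain ⟨j, hj, hj1⟩ := exists_pow_apply_ne_zero t.nilpotent_raise h0
  rw [pow_succ', Module.End.mul_apply] at hj1
  have h1 := t.weight_raise_pow j c x
  rw [hc, sub_self, map_zero] at h1
  obtain ⟨n, hn, -⟩ := t.exists_nat hj1 (sub_eq_zero.1 h1) hj
  refine ⟨n - 2 * j, ?_⟩
  push_cast
  rw [← hn]
  ring

end IsNilpotentTriple

end SlTwo

/-! ### The weight decomposition of a finite-dimensional module -/

section WeightBasis

set_option linter.unusedSectionVars false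

variable {𝔤 : Type*} [LieRing 𝔤] [LieAlgebra ℂ 𝔤] [FiniteDimensional ℂ 𝔤]
  [LieAlgebra.IsSemisimple ℂ 𝔤] {H : LieSubalgebra ℂ 𝔤} [H.IsCartanSubalgebra]
  {V : Type*} [AddCommGroup V] [Module ℂ V] [FiniteDimensional ℂ V]
  [LieRingModule 𝔤 V] [LieModule ℂ 𝔤 V]

theorem exists_isNilpotentTriple (V : Type*) [AddCommGroup V] [Module ℂ V] [FiniteDimensional ℂ V]
    [LieRingModule 𝔤 V] [LieModule ℂ 𝔤 V] {α : LieModule.Weight ℂ H 𝔤} (hα : α.IsNonZero) :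
    ∃ E F, SlTwo.IsNilpotentTriple (LieModule.toEnd ℂ 𝔤 V (coroot α : H)) E F := by
  obtain ⟨h, e, f, ht, he, hf⟩ := exists_isSl2Triple_of_weight_isNonZero hα
  rw [← ht.h_eq_coroot hα he hf]
  have h2 : ∀ v : V, (2 : Module.End ℂ V) v = (2 : ℂ) • v := fun v => by
    rw [show (2 : Module.End ℂ V) = ((2 : ℕ) : Module.End ℂ V) by push_cast; rfl,
      Module.End.natCast_apply, ← Nat.cast_smul_eq_nsmul ℂ]
    push_cast
    rfl
  refine ⟨LieModule.toEnd ℂ 𝔤 V e, LieModule.toEnd ℂ 𝔤 V f, ?_, ?_, ?_, ?_, ?_⟩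
  · ext v
    simp only [Module.End.mul_apply, LinearMap.add_apply, LieModule.toEnd_apply_apply]
    rw [leibniz_lie e f v, ht.lie_e_f, add_comm]
  · ext v
    simp only [Module.End.mul_apply, LinearMap.add_apply, LieModule.toEnd_apply_apply, h2]
    rw [leibniz_lie h e v, ht.lie_h_e_smul ℂ, smul_lie, lie_add, lie_smul, add_comm]
  · ext v
    simp only [Module.End.mul_apply, LinearMap.sub_apply, LieModule.toEnd_apply_apply, h2]
    rw [leibniz_lie h f v, ht.lie_lie_smul_f ℂ, neg_lie, smul_lie, lie_sub, lie_smul]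
    abel
  · exact LieModule.isNilpotent_toEnd_of_mem_rootSpace V H hα he
  · exact LieModule.isNilpotent_toEnd_of_mem_rootSpace V H (neg_ne_zero.2 hα) hf

/-- Generalized weight spaces span `V`. The simple coroots span `H` and each acts diagonalizably,
being the middle of an `sl₂`-triple, so generalized weight vectors are weight vectors. -/
theorem iSup_weightVectors_eq_top (H : LieSubalgebra ℂ 𝔤) [H.IsCartanSubalgebra]
    (b : (rootSystem H).Base)
    (V : Type*) [AddCommGroup V] [Module ℂ V] [FiniteDimensional ℂ V]
    [LieRingModule 𝔤 V] [LieModule ℂ 𝔤 V] : ⨆ χ, weightVectors H V χ = ⊤ := by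
  have h := LieModule.iSup_genWeightSpace_eq_top ℂ H V
  rw [← LieSubmodule.toSubmodule_inj, LieSubmodule.iSup_toSubmodule,
    LieSubmodule.top_toSubmodule] at h
  rw [eq_top_iff, ← h]
  refine iSup_le fun χ x hx => ?_
  -- The generalized weight `χ` is only a function on `H`; the linear form is rebuilt from its
  -- values on the simple coroots.
  refine Submodule.mem_iSup_of_mem
    (b.toCoweightBasis.constr ℂ fun i => χ ((rootSystem H).coroot i)) ?_
  have key : ((LieModule.toEnd ℂ H V : H →ₗ[ℂ] Module.End ℂ V).flip x) =
      LinearMap.toSpanSingleton ℂ V x ∘ₗ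
        b.toCoweightBasis.constr ℂ fun i => χ ((rootSystem H).coroot i) := by
    refine b.toCoweightBasis.ext fun i => ?_
    rw [LinearMap.comp_apply, Basis.constr_basis, LinearMap.toSpanSingleton_apply,
      LinearMap.flip_apply]
    obtain ⟨E, F, t⟩ := exists_isNilpotentTriple V
      (LieSubalgebra.isNonZero_coe_root (i : H.root))
    have h1 : x ∈ (LieModule.toEnd ℂ H V (coroot (i : H.root).1)).maxGenEigenspace
        (χ (coroot (i : H.root).1)) := by
      have h2 := LieModule.genWeightSpace_le_genWeightSpaceOf V (coroot (i : H.root).1) χ hx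
      exact h2
    have h2 := Module.End.mem_eigenspace_iff.1 (t.maxGenEigenspace_le_eigenspace _ h1)
    simpa using h2
  exact fun h => LinearMap.congr_fun key h

theorem iSupIndep_weightVectors : iSupIndep fun χ => weightVectors H V χ := by
  rw [iSupIndep_def]
  intro χ
  rw [Submodule.disjoint_def]
  intro x hx hx'
  exact eq_zero_of_mem_weightVectors_of_mem_iSup (A := {ψ | ψ ≠ χ}) (by simp) hx hx'

theorem finrank_weightSpace (μ : Dual ℂ H) :
    finrank ℂ (LieModule.weightSpace V (μ : H → ℂ)) = finrank ℂ (weightVectors H V μ) :=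
  congrArg (fun W : Submodule ℂ V => finrank ℂ W)
    (show (LieModule.weightSpace V (μ : H → ℂ)).toSubmodule = weightVectors H V μ by
      ext v
      exact LieModule.mem_weightSpace (μ : H → ℂ) v)

/-- A basis of weight vectors of a finite-dimensional module. -/
theorem exists_weightBasis (H : LieSubalgebra ℂ 𝔤) [H.IsCartanSubalgebra]
    (b : (rootSystem H).Base)
    (V : Type*) [AddCommGroup V] [Module ℂ V] [FiniteDimensional ℂ V]
    [LieRingModule 𝔤 V] [LieModule ℂ 𝔤 V] :
    ∃ (n : ℕ) (B : Basis (Fin n) ℂ V) (wt : Fin n → Dual ℂ H),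
      (∀ i, B i ∈ weightVectors H V (wt i)) ∧
      ∀ (μ : Dual ℂ H) (s : Finset (Fin n)), (∀ i, i ∈ s ↔ wt i = μ) →
        s.card = finrank ℂ (LieModule.weightSpace V (μ : H → ℂ)) := by
  classical
  have hI : DirectSum.IsInternal fun χ => weightVectors H V χ :=
    DirectSum.isInternal_submodule_of_iSupIndep_of_iSup_eq_top iSupIndep_weightVectors
      (iSup_weightVectors_eq_top H b V)
  let B := hI.collectedBasis fun χ => finBasis ℂ (weightVectors H V χ)
  have hB : ∀ j, B j ∈ weightVectors H V j.1 := fun j =>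
    hI.collectedBasis_mem (fun χ => finBasis ℂ (weightVectors H V χ)) j
  have : Finite (Σ χ : Dual ℂ H, Fin (finrank ℂ (weightVectors H V χ))) :=
    Module.Finite.finite_basis B
  have := Fintype.ofFinite (Σ χ : Dual ℂ H, Fin (finrank ℂ (weightVectors H V χ)))
  let e := Fintype.equivFin (Σ χ : Dual ℂ H, Fin (finrank ℂ (weightVectors H V χ)))
  refine ⟨_, B.reindex e, fun i => (e.symm i).1, fun i => ?_, fun μ s hs => ?_⟩
  · rw [Basis.reindex_apply]
    exact hB _
  · rw [finrank_weightSpace]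
    have h1 : s = Finset.univ.map
        ⟨fun k : Fin (finrank ℂ (weightVectors H V μ)) => e ⟨μ, k⟩, fun k l h => by
          simpa using h⟩ := by
      ext i
      rw [hs, Finset.mem_map]
      constructor
      · rintro rfl
        exact ⟨(e.symm i).2, Finset.mem_univ _, e.apply_symm_apply i⟩
      · rintro ⟨k, -, rfl⟩
        change (e.symm (e ⟨μ, k⟩)).1 = μ
        rw [e.symm_apply_apply]
    rw [h1, Finset.card_map, Finset.card_univ, Fintype.card_fin]

/-- The weights of a finite-dimensional module are integral. -/
theorem exists_int_of_mem_weightsOf {μ : Dual ℂ H} (hμ : μ ∈ weightsOf H V) (i : H.root) :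
    ∃ z : ℤ, μ ((rootSystem H).coroot i) = z := by
  obtain ⟨v, hv, hv0⟩ : ∃ v ∈ LieModule.weightSpace V (μ : H → ℂ), v ≠ 0 := by
    by_contra! hc
    exact hμ ((LieSubmodule.eq_bot_iff _).2 hc)
  obtain ⟨E, F, t⟩ := exists_isNilpotentTriple V (LieSubalgebra.isNonZero_coe_root i)
  exact t.exists_int hv0 ((LieModule.mem_weightSpace (μ : H → ℂ) v).1 hv _)

theorem weightSum_mem_weightLattice (b : (rootSystem H).Base) {Ψ : Finset (Dual ℂ H)}
    (hΨ : (Ψ : Set (Dual ℂ H)) ⊆ weightsOf H V) : weightSum H V Ψ ∈ weightLattice b := by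
  intro i _
  have h : ∀ μ : Dual ℂ H, ∃ z : ℤ, μ ∈ Ψ → μ ((rootSystem H).coroot i) = z := fun μ => by
    by_cases hμ : μ ∈ Ψ
    · obtain ⟨z, hz⟩ := exists_int_of_mem_weightsOf (hΨ hμ) i
      exact ⟨z, fun _ => hz⟩
    · exact ⟨0, fun h => absurd h hμ⟩
  choose z hz using h
  refine ⟨∑ μ ∈ Ψ, finrank ℂ (LieModule.weightSpace V (μ : H → ℂ)) * z μ, ?_⟩
  rw [weightSum, LinearMap.sum_apply]
  push_cast
  refine Finset.sum_congr rfl fun μ hμ => ?_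
  rw [LinearMap.smul_apply, hz μ hμ, nsmul_eq_mul]

/-! ### Weights of the exterior power and the use of rigidity. -/

/-- The weights of the exterior products of weight vectors. -/
theorem ιMulti_mem_weightVectors {n : ℕ} {v : Fin n → V} {wt : Fin n → Dual ℂ H}
    (hv : ∀ i, v i ∈ weightVectors H V (wt i)) :
    exteriorPower.ιMulti ℂ n v ∈ weightVectors H (⋀[ℂ]^n V) (∑ i, wt i) := by
  intro h
  rw [exteriorPower.lie_ιMulti, LinearMap.sum_apply, Finset.sum_smul]
  refine Finset.sum_congr rfl fun i _ => ?_
  rw [hv i h, AlternatingMap.map_update_smul, Function.update_eq_self]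

theorem sum_ofFinEmbEquiv_symm {n N : ℕ} {A : Type*} [AddCommMonoid A] (f : Fin n → A)
    (s : Set.powersetCard (Fin n) N) :
    ∑ k, f (Set.powersetCard.ofFinEmbEquiv.symm s k) = ∑ i ∈ s.1, f i := by
  rw [← Finset.map_orderEmbOfFin_univ s.1 s.2, Finset.sum_map]
  rfl

/-- The exterior power of degree `N_Ψ` has a basis of weight vectors in which the weight `λ_Ψ`
occurs exactly once. -/
theorem exists_exteriorPower_weightBasis (b : (rootSystem H).Base) {Ψ : Finset (Dual ℂ H)}
    (hrigid : IsRigid H V Ψ) :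
    ∃ (n : ℕ) (B : Basis (Set.powersetCard (Fin n) (weightCount H V Ψ)) ℂ
        (⋀[ℂ]^(weightCount H V Ψ) V))
      (wt : Set.powersetCard (Fin n) (weightCount H V Ψ) → Dual ℂ H)
      (s₀ : Set.powersetCard (Fin n) (weightCount H V Ψ)),
      (∀ s, B s ∈ weightVectors H (⋀[ℂ]^(weightCount H V Ψ) V) (wt s)) ∧
      wt s₀ = weightSum H V Ψ ∧ ∀ s, s ≠ s₀ → wt s ≠ wt s₀ := by
  classical
  obtain ⟨n, B, wt, hB, hcard⟩ := exists_weightBasis H b V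
  let S := Finset.univ.filter fun i => wt i ∈ Ψ
  have hS : ∀ i, i ∈ S ↔ wt i ∈ Ψ := fun i => by simp [S]
  have hfib : ∀ μ ∈ Ψ, (S.filter fun i => wt i = μ).card =
      finrank ℂ (LieModule.weightSpace V (μ : H → ℂ)) := fun μ hμ =>
    hcard μ _ fun i => by
      rw [Finset.mem_filter, hS]
      exact ⟨fun h => h.2, fun h => ⟨h ▸ hμ, h⟩⟩
  have hScard : S.card = weightCount H V Ψ := by
    rw [Finset.card_eq_sum_card_fiberwise fun i hi => (hS i).1 hi, weightCount]
    exact Finset.sum_congr rfl hfib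
  have hSsum : ∑ i ∈ S, wt i = weightSum H V Ψ := by
    rw [← Finset.sum_fiberwise_of_maps_to fun i hi => (hS i).1 hi, weightSum]
    refine Finset.sum_congr rfl fun μ hμ => ?_
    rw [← hfib μ hμ, Finset.sum_congr rfl fun i hi => (Finset.mem_filter.1 hi).2,
      Finset.sum_const]
  have hwt : ∀ i, wt i ∈ weightsOf H V := fun i => by
    intro h
    exact B.ne_zero i ((LieSubmodule.eq_bot_iff _).1 h _
      ((LieModule.mem_weightSpace (wt i : H → ℂ) _).2 (hB i)))
  have hcount : ∀ s : Finset (Fin n),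
      ((∑ i ∈ s, Finsupp.single (wt i) 1 : Dual ℂ H →₀ ℕ).sum fun _ k => k) = s.card := fun s => by
    rw [← Finsupp.sum_finsetSum_index (fun _ => rfl) fun _ _ _ => rfl]
    simp
  have hweight : ∀ s : Finset (Fin n),
      ((∑ i ∈ s, Finsupp.single (wt i) 1 : Dual ℂ H →₀ ℕ).sum fun μ k => k • μ) =
        ∑ i ∈ s, wt i := fun s => by
    rw [← Finsupp.sum_finsetSum_index (h := fun (μ : Dual ℂ H) (k : ℕ) => k • μ)
      (fun _ => zero_nsmul _) fun _ _ _ => add_nsmul _ _ _]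
    simp
  have hsupp : ∀ (s : Finset (Fin n)) (μ : Dual ℂ H),
      (∑ i ∈ s, Finsupp.single (wt i) 1 : Dual ℂ H →₀ ℕ) μ ≠ 0 ↔ ∃ i ∈ s, wt i = μ := by
    intro s μ
    rw [Finsupp.finsetSum_apply, Ne, Finset.sum_eq_zero_iff]
    simp [Finsupp.single_apply]
  refine ⟨n, B.exteriorPower _, fun s => ∑ i ∈ s.1, wt i, ⟨S, hScard⟩, fun s => ?_, hSsum,
    fun s hs he => hs ?_⟩
  · change _ ∈ weightVectors H _ (∑ i ∈ s.1, wt i)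
    rw [exteriorPower.basis_apply, ← sum_ofFinEmbEquiv_symm]
    exact ιMulti_mem_weightVectors fun k => hB _
  -- Take for `m` and `r` the multiplicities of the weights in `S` and in `s`. Both total `N_Ψ`, so
  -- the equality case gives `s ⊆ S`, and then `s = S` by cardinality.
  · have h := hrigid (∑ i ∈ S, Finsupp.single (wt i) 1) (∑ i ∈ s.1, Finsupp.single (wt i) 1)
      (fun μ hμ => by
        obtain ⟨i, hi, rfl⟩ := (hsupp _ _).1 (Finsupp.mem_support_iff.1 hμ)
        exact (hS i).1 hi)
      (fun μ hμ => by
        obtain ⟨i, hi, rfl⟩ := (hsupp _ _).1 (Finsupp.mem_support_iff.1 hμ)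
        exact hwt i)
      (by rw [hweight, hweight]; exact he.symm)
    have hs2 : s.1.card = weightCount H V Ψ := s.2
    have h1 := h.2.1 (by rw [hcount, hcount, hScard, hs2])
    refine Subtype.ext (Finset.eq_of_subset_of_card_le (fun i hi => ?_) (by rw [hs2, hScard]))
    exact (hS i).2 (h1 _ (Nat.pos_of_ne_zero ((hsupp _ _).2 ⟨i, hi, rfl⟩)))

end WeightBasis

/-! ### Weights far inside the dominant chamber -/

theorem eventually_add_natCast_mul_ne_zero (a : ℂ) {s : ℂ} (hs : s ≠ 0) :
    ∀ᶠ t : ℕ in Filter.atTop, a + t * s ≠ 0 := by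
  by_cases h : ∃ t₀ : ℕ, a + t₀ * s = 0
  · obtain ⟨t₀, h₀⟩ := h
    filter_upwards [Filter.eventually_gt_atTop t₀] with t ht h1
    have h2 : (t : ℂ) * s = t₀ * s := add_left_cancel (h1.trans h₀.symm)
    have h3 : (t : ℂ) = t₀ := mul_right_cancel₀ hs h2
    rw [Nat.cast_inj] at h3
    omega
  · exact Filter.Eventually.of_forall fun t ht => h ⟨t, ht⟩

section FinalAssembly

variable {𝔤 : Type*} [LieRing 𝔤] [LieAlgebra ℂ 𝔤] [FiniteDimensional ℂ 𝔤]
  [LieAlgebra.IsSemisimple ℂ 𝔤] {H : LieSubalgebra ℂ 𝔤} [H.IsCartanSubalgebra]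
  {b : (rootSystem H).Base} {J : Type*} [Fintype J] {T : TriangularBasis H J}

theorem dominantWeights_subset_weightLattice (b : (rootSystem H).Base) :
    dominantWeights b ⊆ weightLattice b := fun μ hμ i hi => by
  obtain ⟨n, hn⟩ := hμ i hi
  exact ⟨n, by rw [hn, Int.cast_natCast]⟩

theorem add_mem_weightLattice {μ ψ : Dual ℂ H} (hμ : μ ∈ weightLattice b)
    (hψ : ψ ∈ weightLattice b) : μ + ψ ∈ weightLattice b := fun i hi => by
  obtain ⟨m, hm⟩ := hμ i hi
  obtain ⟨n, hn⟩ := hψ i hi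
  exact ⟨m + n, by rw [LinearMap.add_apply, hm, hn]; push_cast; rfl⟩

theorem eventually_mem_regularDominantWeights
    (hh : ∀ i ∈ b.support, (rootSystem H).root i T.grading = 1) {μ : Dual ℂ H}
    (hμ : μ ∈ weightLattice b) :
    ∀ᶠ t : ℕ in Filter.atTop, μ + (t : ℂ) • T.gradingDual ∈ regularDominantWeights b := by
  have h : ∀ i ∈ b.support, ∀ᶠ t : ℕ in Filter.atTop,
      ∃ n : ℕ, 0 < n ∧ (μ + (t : ℂ) • T.gradingDual) ((rootSystem H).coroot i) = n := by
    intro i hi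
    obtain ⟨z, hz⟩ := hμ i hi
    obtain ⟨d, hd, hd'⟩ := gradingDual_coroot hh hi
    -- Since `d ≥ 1`, any `t` larger than `|z|` makes `z + t d` positive.
    filter_upwards [Filter.eventually_gt_atTop z.natAbs] with t ht
    have h1 : (t : ℤ) ≤ t * d := by
      have : (1 : ℤ) ≤ d := by exact_mod_cast hd
      nlinarith
    have h2 : 0 < z + t * d := by omega
    refine ⟨(z + t * d).natAbs, by omega, ?_⟩
    rw [LinearMap.add_apply, LinearMap.smul_apply, hz, hd', smul_eq_mul,
      ← Int.cast_natCast (z + t * d).natAbs, Int.natAbs_of_nonneg h2.le]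
    push_cast
    rfl
  exact (Filter.eventually_all_finset b.support).2 h

/-- If the weight `wt i₀` of `W` is simple, then for `ν` far inside the dominant chamber the
multiplicity of `V(ν + wt i₀)` in `W ⊗ V(ν)` is at least one. -/
theorem eventually_exists_lieModuleHom_ne_zero {W : Type*} [AddCommGroup W] [Module ℂ W]
    [LieRingModule 𝔤 W] [LieModule ℂ 𝔤 W] {I : Type*} [Finite I] (hT : T.Compatible b)
    (w : Basis I ℂ W) (wt : I → Dual ℂ H) (hw : ∀ i, w i ∈ weightVectors H W (wt i)) (i₀ : I)
    (η : Dual ℂ H) :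
    ∀ᶠ t : ℕ in Filter.atTop,
      ∃ f : W ⊗[ℂ] SimpleHighestWeightModule b (η + (t : ℂ) • T.gradingDual) →ₗ⁅ℂ, 𝔤⁆
        SimpleHighestWeightModule b (η + (t : ℂ) • T.gradingDual + wt i₀), f ≠ 0 := by
  -- `K` bounds how far the weights of `W` rise above `wt i₀`. It does not depend on `t`, so the
  -- separation below concerns a fixed finite set of `γ`.
  have hK : ∀ᶠ k : ℕ in Filter.atTop, ∀ i, wt i T.grading ≠ wt i₀ T.grading + k := by
    refine Filter.eventually_all.2 fun i => ?_
    filter_upwards [eventually_add_natCast_mul_ne_zero (wt i₀ T.grading - wt i T.grading)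
      one_ne_zero] with k hk h
    refine hk ?_
    rw [h]
    ring
  obtain ⟨K, hK⟩ := Filter.eventually_atTop.1 hK
  have hcas : ∀ μ ψ : Dual ℂ H, (μ - ψ) T.grading ≠ 0 → ∀ᶠ t : ℕ in Filter.atTop,
      T.casimirScalar (μ + (t : ℂ) • T.gradingDual) ≠
        T.casimirScalar (ψ + (t : ℂ) • T.gradingDual) := by
    intro μ ψ hne
    filter_upwards [eventually_add_natCast_mul_ne_zero (T.casimirScalar μ - T.casimirScalar ψ)
      (mul_ne_zero two_ne_zero hne)] with t ht h
    refine ht ?_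
    rw [← sub_eq_zero, T.casimirScalar_sub] at h
    rw [← h]
    ring
  have hν : ∀ᶠ t : ℕ in Filter.atTop,
      ∀ γ ∈ {γ | γ ∈ T.negCone ∧ ∃ k : ℕ, k ≤ K ∧ γ T.grading = -(k : ℂ)}, γ ≠ 0 →
        T.casimirScalar (γ + η + (t : ℂ) • T.gradingDual) ≠
          T.casimirScalar (η + (t : ℂ) • T.gradingDual) := by
    refine (Filter.eventually_all_finite (T.finite_negCone K)).2 fun γ hγ => ?_
    by_cases h0 : γ = 0
    · exact Filter.Eventually.of_forall fun t h => absurd h0 h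
    · obtain ⟨k, hk, hk0⟩ := T.exists_grading_eq hγ.1
      filter_upwards [hcas (γ + η) η (by
        rw [add_sub_cancel_right, hk, neg_ne_zero, Nat.cast_ne_zero]
        exact (hk0 h0).ne')] with t ht _ using ht
  have hlow : ∀ᶠ t : ℕ in Filter.atTop, ∀ i, (wt i T.grading).re < (wt i₀ T.grading).re →
      T.casimirScalar (η + wt i + (t : ℂ) • T.gradingDual) ≠
        T.casimirScalar (η + wt i₀ + (t : ℂ) • T.gradingDual) := by
    refine Filter.eventually_all.2 fun i => ?_
    by_cases h0 : (wt i T.grading).re < (wt i₀ T.grading).re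
    · filter_upwards [hcas (η + wt i) (η + wt i₀) (by
        rw [add_sub_add_left_eq_sub, LinearMap.sub_apply, sub_ne_zero]
        intro h
        rw [h] at h0
        exact lt_irrefl _ h0)] with t ht _ using ht
    · exact Filter.Eventually.of_forall fun t h => absurd h h0
  filter_upwards [hν, hlow] with t h1 h2
  refine SimpleHighestWeightModule.exists_lieModuleHom_ne_zero hT w wt hw i₀ (K := K)
    (fun i k hk => hK k hk.le i) (fun γ hγ h0 k hk hγk => ?_) fun i hi => ?_
  · have h3 := h1 γ ⟨hγ, k, hk, hγk⟩ h0
    rwa [add_comm _ γ, ← add_assoc]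
  · have h3 := h2 i hi
    rwa [add_right_comm η (wt i), add_right_comm η (wt i₀)] at h3

end FinalAssembly

/-! ### Assembly of the theorem. -/

theorem lemmaL74 {𝔤 : Type*} [LieRing 𝔤] [LieAlgebra ℂ 𝔤] [FiniteDimensional ℂ 𝔤]
    [LieAlgebra.IsSemisimple ℂ 𝔤] (H : LieSubalgebra ℂ 𝔤) [H.IsCartanSubalgebra]
    (b : (rootSystem H).Base)
    (V : Type*) [AddCommGroup V] [Module ℂ V] [FiniteDimensional ℂ V]
    [LieRingModule 𝔤 V] [LieModule ℂ 𝔤 V]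
    (Ψ : Finset (Dual ℂ H)) (hΨ : (Ψ : Set (Dual ℂ H)) ⊆ weightsOf H V)
    (hrigid : IsRigid H V Ψ) :
    weightSum H V Ψ ∈ weightLattice b ∧
    (∀ ν ∈ dominantWeights b, ν + weightSum H V Ψ ∈ dominantWeights b →
      Module.rank ℂ
        ((⋀[ℂ]^(weightCount H V Ψ) V) ⊗[ℂ] SimpleHighestWeightModule b ν →ₗ⁅ℂ, 𝔤⁆
          SimpleHighestWeightModule b (ν + weightSum H V Ψ)) ≤ 1) ∧
    (∀ η ∈ dominantWeights b, ∃ ν ∈ regularDominantWeights b,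
      ν + weightSum H V Ψ ∈ regularDominantWeights b ∧
      ν - η ∈ positiveRootCone b ∧
      Module.rank ℂ
        ((⋀[ℂ]^(weightCount H V Ψ) V) ⊗[ℂ] SimpleHighestWeightModule b ν →ₗ⁅ℂ, 𝔤⁆
          SimpleHighestWeightModule b (ν + weightSum H V Ψ)) = 1) := by

  obtain ⟨T, hT, hh⟩ := exists_triangularBasis b
  have := Module.Finite.finite_basis T.basis
  have := Fintype.ofFinite
    (Σ χ : LieModule.Weight ℂ H 𝔤, Fin (finrank ℂ (rootSpace H χ).toSubmodule))
  obtain ⟨n, B, wt, s₀, hB, hs₀, hsimple⟩ := exists_exteriorPower_weightBasis b hrigid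
  have hlat := weightSum_mem_weightLattice b hΨ
  rw [← hs₀] at hlat ⊢
  have hle := SimpleHighestWeightModule.rank_lieModuleHom_le_one hT B wt hB s₀ hsimple
  refine ⟨hlat, fun ν _ _ => hle ν, fun η hη => ?_⟩
  have hη' := dominantWeights_subset_weightLattice b hη
  -- Three conditions hold for all large `t`: regularity of `ν = η + tδ`, regularity of `ν + λ_Ψ`,
  -- and existence of a nonzero map. The difference `ν - η = tδ` lies in `Q⁺` for every `t`.
  obtain ⟨t, h1, h2, f, hf⟩ := ((eventually_mem_regularDominantWeights hh hη').and
    ((eventually_mem_regularDominantWeights hh (add_mem_weightLattice hη' hlat)).and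
      (eventually_exists_lieModuleHom_ne_zero hT B wt hB s₀ η))).exists
  refine ⟨η + (t : ℂ) • T.gradingDual, h1, ?_, ?_, le_antisymm (hle _) ?_⟩
  · rwa [add_right_comm] at h2
  · rw [add_sub_cancel_left, Nat.cast_smul_eq_nsmul]
    exact AddSubmonoid.nsmul_mem _ (gradingDual_mem_positiveRootCone hh) t
  · exact Cardinal.one_le_iff_pos.2 (rank_pos_iff_exists_ne_zero.2 ⟨f, hf⟩)
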